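/- **Setting.** Let $\zeta$ be a primitive 12th root of unity, $\mathbb Z[\zeta]$ the ring of integers of $\mathbb Q(\zeta)$, $\mathbb U$ its group of units (which consists of the elements $\zeta^i(1+\zeta)^j$, $i,j\in\mathbb Z$) and $N$ the norm of $\mathbb Q(\zeta)/\mathbb Q$. Identify the $\mathbb Z^2$-triangle $\{m,n,k,l\}$ with vertices $(0,0),(m,n),(k,l)\in\mathbb Z^2$ (degenerate triangles are allowed) with the element $\alpha=m\zeta^{10}+n\zeta+k\zeta^2+l\zeta^5$ of $\mathbb Z[\zeta]$. Two triangles are *congruent* if they have the same three side-lengths, and *$\mathbb Z^2$-congruent* if an isometry of $\mathbb Z^2$ takes the vertices of one to those of the other. Multiplying $\alpha$ by a power of $\zeta$ does not change its $\mathbb Z^2$-congruence class. A *solution coset* of the norm equation $N(\alpha)=r$ ($r$ a positive integer) is a coset $\alpha\mathbb U$ with $N(\alpha)=r$, regarded as the doubly infinite sequence $(\triangle_j)_{j\in\mathbb Z}$, where $\triangle_j$ is the $\mathbb Z^2$-congruence class of the triangle $\alpha(1+\zeta)^j$ and $\alpha$ is chosen to be of minimal area in its coset (so that a triangle of minimal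 area has label $j=0$). Two solution cosets are the same if they are equal as labelled sequences. A *Class B0 family* is a set $\mathfrak B$ of at least two solution cosets such that for all $j\in\mathbb Z$ the triangles labelled by $j$ in any two members of $\mathfrak B$ are congruent, and which is maximal in the sense that every solution coset whose triangles have, for each label $j$, the same area as those of a member of $\mathfrak B$ belongs to $\mathfrak B$. **Theorem 7 (Class B0).** Let $$r = 2^{2\varrho(2)}\,3^{2\varrho(3)}\,p^{\varrho(p)}\prod_j q_j^{2\varrho(q_j)}\prod_k w_k^{2\varrho(w_k)}\,z^{2\varrho(z)},\qquad(5.27)$$ where the products are finite, $p$, $z$, the (distinct) $q_j$ and the (distinct) $w_k$ are primes with $p\equiv 1$, $q_j\equiv 11$, $w_k\equiv 5$, $z\equiv 7 \pmod{12}$, all $\varrho(\cdot)$ are non-negative integers, $\varrho(p),\varrho(z)\in\{0,1\}$, $\varrho(p)+\varrho(z)\le 1$ and $\varrho(p)+\varrho(z)+\sum_k\varrho(w_k)\ge 2$. Then: 1. The solution cosets of $N(\alpha)=r$ are partitioned into finitely many (and at least one) Class B0 families. 2. These families are finite and all have the same number $\sharp(r)$ of members. 3. If $\varrho(w_k)\le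 1$ for all $k$, then $\sharp(r)=2^{-1+\varrho(p)+\varrho(z)+\sum_k\varrho(w_k)}$. 4. If one of the $\varrho(w_k)$ is replaced by a larger integer, then $\sharp(r)$ does not decrease; it strictly increases if $\varrho(p)+\varrho(z)\ne0$ or $\varrho(w_i)\neq 0$ for some $i\ne k$. 5. If $\varrho(w_k)=0$ for all $k\neq1$, then $\sharp(r)=\varrho(w_1)+1$ when $\varrho(p)+\varrho(z)\ne0$, and $\sharp(r)=\lfloor\varrho(w_1)/2\rfloor+1$ otherwise. Conversely, every Class B0 family consists of solution cosets of $N(\alpha)=r$ for some $r$ of the form (5.27). -/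

import Mathlib

/-- The `ℤ²`-triangle `{m,n,k,l}` with vertices `(0,0)`, `(m,n)`, `(k,l)`; degenerate triangles are
included. -/
@[ext]
structure LatticeTriangle where
  m : ℤ
  n : ℤ
  k : ℤ
  l : ℤ

namespace LatticeTriangle

/-- The vertices of the triangle. -/
def vertex (T : LatticeTriangle) : Fin 3 → Fin 2 → ℤ :=
  ![![0, 0], ![T.m, T.n], ![T.k, T.l]]

/-- The doubled area. -/
def doubledArea (T : LatticeTriangle) : ℤ := |T.n * T.k - T.m * T.l|

/-- The (unordered) triple of squared side-lengths. -/
def squaredSides (T : LatticeTriangle) : Multiset ℤ :=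
  {(T.m - T.k) ^ 2 + (T.n - T.l) ^ 2, T.k ^ 2 + T.l ^ 2, T.m ^ 2 + T.n ^ 2}

/-- Congruence of triangles in the Euclidean plane (equal triples of side-lengths). -/
def Congruent (T T' : LatticeTriangle) : Prop := T.squaredSides = T'.squaredSides

/-- `ℤ²`-congruence: an isometry of `ℤ²` (a shift composed with a rotation by a multiple of `π/2`
or with a reflection in a coordinate axis or in a bisectrix) takes the vertices of `T` to the
vertices of `T'`, in some order. -/
def LatticeCongruent (T T' : LatticeTriangle) : Prop :=
  ∃ M ∈ Matrix.orthogonalGroup (Fin 2) ℤ, ∃ c : Fin 2 → ℤ, ∃ π : Equiv.Perm (Fin 3),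
    ∀ i, M.mulVec (T.vertex i) + c = T'.vertex (π i)

end LatticeTriangle

/-- The field `ℚ[ζ]`, where `ζ` is a primitive 12th root of unity. -/
abbrev K12 : Type := CyclotomicField 12 ℚ

instance : IsCyclotomicExtension {12} ℚ K12 := CyclotomicField.isCyclotomicExtension 12 ℚ

/-- The primitive 12th root of unity `ζ`. -/
noncomputable def zeta12 : K12 := IsCyclotomicExtension.zeta 12 ℚ K12

/-- The element `m ζ¹⁰ + n ζ + k ζ² + l ζ⁵` of `ℤ[ζ]` identified with the triangle
`{m,n,k,l}`. -/
noncomputable def LatticeTriangle.toField (T : LatticeTriangle) : K12 :=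
  (T.m : K12) * zeta12 ^ 10 + (T.n : K12) * zeta12 + (T.k : K12) * zeta12 ^ 2
    + (T.l : K12) * zeta12 ^ 5

/-- A doubly infinite sequence of sets of triangles. -/
abbrev TriangleSequence : Type := ℤ → Set LatticeTriangle

/-- `T` is a leading triangle of the coset `T · U[ζ]`: it has the minimal area there. -/
def IsLeader (T : LatticeTriangle) : Prop :=
  ∀ (u : (NumberField.RingOfIntegers K12)ˣ) (T' : LatticeTriangle),
    T'.toField = T.toField * ((u : NumberField.RingOfIntegers K12) : K12) →
      T.doubledArea ≤ T'.doubledArea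

/-- `C` is a full solution coset of the norm equation `N(α) = r`, viewed as a sequence of triangles
labelled by `j ∈ ℤ`, each triangle being taken up to `ℤ²`-congruence. The coset `α U[ζ]` consists of
the elements `ζ^i α (1 + ζ)^j`; the factor `ζ^i` does not change the `ℤ²`-congruence class, and
the label `0` is given to a leading triangle. -/
def IsSolutionCoset (r : ℕ) (C : TriangleSequence) : Prop :=
  ∃ T : ℤ → LatticeTriangle,
    Algebra.norm ℚ (T 0).toField = (r : ℚ) ∧
    IsLeader (T 0) ∧
    (∀ j : ℤ, (T j).toField = (T 0).toField * (1 + zeta12) ^ j) ∧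
    ∀ j : ℤ, C j = {T' | (T j).LatticeCongruent T'}

/-- The set of all solution cosets of the norm equation `N(α) = r`. -/
def solutionCosets (r : ℕ) : Set TriangleSequence := {C | IsSolutionCoset r C}

/-- The triangles with the same label in `C` and `C'` have equal areas. -/
def SameAreas (C C' : TriangleSequence) : Prop :=
  ∀ j, ∀ T ∈ C j, ∀ T' ∈ C' j, T.doubledArea = T'.doubledArea

/-- The triangles with the same label in `C` and `C'` are congruent in the plane. -/
def SameTriangles (C C' : TriangleSequence) : Prop :=
  ∀ j, ∀ T ∈ C j, ∀ T' ∈ C' j, T.Congruent T'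

/-- `F` is a Class B0 family of solution cosets (of norm equations with positive right-hand sides):
it has more than one member, the triangles with the same label are congruent, and `F` cannot be
enlarged, not even by a coset whose triangles merely have the same areas (which would turn `F` into
a family of Class B1 or B2). -/
structure IsB0Family (F : Set TriangleSequence) : Prop where
  isSolutionCoset : ∀ C ∈ F, ∃ r : ℕ, 0 < r ∧ IsSolutionCoset r C
  nontrivial : F.Nontrivial
  sameTriangles : ∀ C ∈ F, ∀ C' ∈ F, SameTriangles C C'
  maximal : ∀ C ∈ F, ∀ (r : ℕ) (C' : TriangleSequence), 0 < r → IsSolutionCoset r C' →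
    SameAreas C C' → C' ∈ F

/-- The Class B0 families formed by solution cosets of `N(α) = r`. -/
def b0Families (r : ℕ) : Set (Set TriangleSequence) :=
  {F | IsB0Family F ∧ F ⊆ solutionCosets r}

/-- The primes `p ≡ 1`, `z ≡ 7`, `q ∈ Q` with `q ≡ 11` and `w ∈ W` with `w ≡ 5` modulo 12 and the
exponents `ρ` are admissible for Class B0. -/
structure IsB0Data (p z : ℕ) (Q W : Finset ℕ) (ρ : ℕ → ℕ) : Prop where
  prime_p : p.Prime
  p_mod : p % 12 = 1
  prime_z : z.Prime
  z_mod : z % 12 = 7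
  prime_q : ∀ q ∈ Q, q.Prime
  q_mod : ∀ q ∈ Q, q % 12 = 11
  prime_w : ∀ w ∈ W, w.Prime
  w_mod : ∀ w ∈ W, w % 12 = 5
  p_add_z_le : ρ p + ρ z ≤ 1
  two_le : 2 ≤ ρ p + ρ z + ∑ w ∈ W, ρ w

/-- The integer `r = 2^{2ρ(2)} 3^{2ρ(3)} p^{ρ(p)} ∏ q^{2ρ(q)} ∏ w^{2ρ(w)} z^{2ρ(z)}`. -/
def b0Norm (p z : ℕ) (Q W : Finset ℕ) (ρ : ℕ → ℕ) : ℕ :=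
  2 ^ (2 * ρ 2) * 3 ^ (2 * ρ 3) * p ^ ρ p * (∏ q ∈ Q, q ^ (2 * ρ q)) *
    (∏ w ∈ W, w ^ (2 * ρ w)) * z ^ (2 * ρ z)

/-! Writing a triangle as (m + ni)ζ¹⁰ + (k + li)ζ² turns its geometry into relative norms. The norm
to ℤ[√3] is X + S√3, where X is half the sum of the squared sides and S is the signed doubled area;
the norm to ℤ[√-3] records the differences of the squared sides. The 8 · 6 = 48 combinations of a
linear isometry of ℤ² and a permutation of the vertices correspond to the 12 roots of unity combined
with the 4 Galois automorphisms (`latticeCongruent_iff`).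

Multiplication by 1 + ζ sends S to 2S + X, so the sequence of areas determines X + S√3 and is
determined by it (`sameAreas_cosetSeq_iff`). Two elements with the same norm to ℤ[√3] give the same
sequence iff they are associated up to complex conjugation (`cosetSeq_eq_iff`), and congruent
sequences iff their norms to ℤ[√-3] are associated up to conjugation (`sameTriangles_cosetSeq_iff`).
A Class B0 family is therefore the set of all cosets sharing one norm to ℤ[√3], provided that there
are at least two of them and that their norms to ℤ[√-3] agree in this sense (`isB0Family_iff`).

Since ℤ[ζ] is Euclidean, unique factorization settles both conditions. Without changing the norm to
ℤ[√3], an element can be replaced by γ∏L, where the prime factors of γ are self-conjugate and those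
in L are not. The elements with this norm arise, up to units, by conjugating some members of L.
Conjugating everything does not change the coset, so the family has half of ∏(mult + 1) members,
rounded up (`family_finite_and_ncard`). Conjugating a prime t in L affects the norm to ℤ[√-3] iff t
is not associated to its image under ζ ↦ ζ⁵. A single such t is harmless, because flipping it
amounts to a global conjugation; two of them can be flipped independently, which destroys congruence
(`allCongruent_of_card_le`, `card_le_of_allCongruent`).

Finally, the primes in L lie over rational primes ≡ 1, 5, 7 mod 12, and those moved by ζ ↦ ζ⁵ over
primes ≡ 1, 7 (`prime_class_split`). The criterion becomes ρ(p) + ρ(z) ≤ 1, the size becomes a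
function of the exponents (`IsB0Shape.family_spec`), and the remaining claims are arithmetic of that
function. -/

namespace LatticeTriangle

/-! ### The ring structure of `ℤ[ζ]` on triangles -/

instance : Zero LatticeTriangle := ⟨⟨0, 0, 0, 0⟩⟩
instance : One LatticeTriangle := ⟨⟨1, 0, 1, 0⟩⟩
instance : Add LatticeTriangle := ⟨fun a b => ⟨a.m + b.m, a.n + b.n, a.k + b.k, a.l + b.l⟩⟩
instance : Neg LatticeTriangle := ⟨fun a => ⟨-a.m, -a.n, -a.k, -a.l⟩⟩
instance : Sub LatticeTriangle := ⟨fun a b => ⟨a.m - b.m, a.n - b.n, a.k - b.k, a.l - b.l⟩⟩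
-- With z = m + ni and w = k + li the element is zζ¹⁰ + wζ². The formula expands a product by means
-- of ζ¹⁰ + ζ² = ζ¹⁰ · ζ² = 1, which also explains why 1 has the coordinates ⟨1, 0, 1, 0⟩.
instance : Mul LatticeTriangle := ⟨fun a b =>
  ⟨a.m * b.k - a.n * b.l + (b.m * a.k - b.n * a.l) - (a.k * b.k - a.l * b.l),
   a.m * b.l + a.n * b.k + (b.m * a.l + b.n * a.k) - (a.k * b.l + a.l * b.k),
   a.m * b.k - a.n * b.l + (b.m * a.k - b.n * a.l) - (a.m * b.m - a.n * b.n),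
   a.m * b.l + a.n * b.k + (b.m * a.l + b.n * a.k) - (a.m * b.n + a.n * b.m)⟩⟩
instance : NatCast LatticeTriangle := ⟨fun c => ⟨c, 0, c, 0⟩⟩
instance : IntCast LatticeTriangle := ⟨fun c => ⟨c, 0, c, 0⟩⟩

section coordinates

variable (a b : LatticeTriangle)

@[simp] lemma zero_m : (0 : LatticeTriangle).m = 0 := rfl
@[simp] lemma zero_n : (0 : LatticeTriangle).n = 0 := rfl
@[simp] lemma zero_k : (0 : LatticeTriangle).k = 0 := rfl
@[simp] lemma zero_l : (0 : LatticeTriangle).l = 0 := rfl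
@[simp] lemma one_m : (1 : LatticeTriangle).m = 1 := rfl
@[simp] lemma one_n : (1 : LatticeTriangle).n = 0 := rfl
@[simp] lemma one_k : (1 : LatticeTriangle).k = 1 := rfl
@[simp] lemma one_l : (1 : LatticeTriangle).l = 0 := rfl
@[simp] lemma add_m : (a + b).m = a.m + b.m := rfl
@[simp] lemma add_n : (a + b).n = a.n + b.n := rfl
@[simp] lemma add_k : (a + b).k = a.k + b.k := rfl
@[simp] lemma add_l : (a + b).l = a.l + b.l := rfl
@[simp] lemma neg_m : (-a).m = -a.m := rfl
@[simp] lemma neg_n : (-a).n = -a.n := rfl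
@[simp] lemma neg_k : (-a).k = -a.k := rfl
@[simp] lemma neg_l : (-a).l = -a.l := rfl
@[simp] lemma sub_m : (a - b).m = a.m - b.m := rfl
@[simp] lemma sub_n : (a - b).n = a.n - b.n := rfl
@[simp] lemma sub_k : (a - b).k = a.k - b.k := rfl
@[simp] lemma sub_l : (a - b).l = a.l - b.l := rfl
@[simp] lemma mul_m : (a * b).m =
    a.m * b.k - a.n * b.l + (b.m * a.k - b.n * a.l) - (a.k * b.k - a.l * b.l) := rfl
@[simp] lemma mul_n : (a * b).n =
    a.m * b.l + a.n * b.k + (b.m * a.l + b.n * a.k) - (a.k * b.l + a.l * b.k) := rfl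
@[simp] lemma mul_k : (a * b).k =
    a.m * b.k - a.n * b.l + (b.m * a.k - b.n * a.l) - (a.m * b.m - a.n * b.n) := rfl
@[simp] lemma mul_l : (a * b).l =
    a.m * b.l + a.n * b.k + (b.m * a.l + b.n * a.k) - (a.m * b.n + a.n * b.m) := rfl
@[simp] lemma natCast_m (c : ℕ) : (c : LatticeTriangle).m = c := rfl
@[simp] lemma natCast_n (c : ℕ) : (c : LatticeTriangle).n = 0 := rfl
@[simp] lemma natCast_k (c : ℕ) : (c : LatticeTriangle).k = c := rfl
@[simp] lemma natCast_l (c : ℕ) : (c : LatticeTriangle).l = 0 := rfl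
@[simp] lemma intCast_m (c : ℤ) : (c : LatticeTriangle).m = c := rfl
@[simp] lemma intCast_n (c : ℤ) : (c : LatticeTriangle).n = 0 := rfl
@[simp] lemma intCast_k (c : ℤ) : (c : LatticeTriangle).k = c := rfl
@[simp] lemma intCast_l (c : ℤ) : (c : LatticeTriangle).l = 0 := rfl

end coordinates

instance : CommRing LatticeTriangle where
  add_assoc a b c := by ext <;> simp <;> ring
  zero_add a := by ext <;> simp
  add_zero a := by ext <;> simp
  add_comm a b := by ext <;> simp <;> ring
  mul_assoc a b c := by ext <;> simp <;> ring
  one_mul a := by ext <;> simp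
  mul_one a := by ext <;> simp
  mul_comm a b := by ext <;> simp <;> ring
  left_distrib a b c := by ext <;> simp <;> ring
  right_distrib a b c := by ext <;> simp <;> ring
  zero_mul a := by ext <;> simp
  mul_zero a := by ext <;> simp
  neg_add_cancel a := by ext <;> simp
  sub_eq_add_neg a b := by ext <;> simp <;> ring
  nsmul := nsmulRec
  zsmul := zsmulRec
  natCast_zero := by ext <;> simp
  natCast_succ c := by ext <;> simp
  intCast_ofNat c := by ext <;> simp
  intCast_negSucc c := by ext <;> simp [Int.negSucc_eq]

@[simp] lemma ofNat_m (c : ℕ) [c.AtLeastTwo] :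
    (ofNat(c) : LatticeTriangle).m = ofNat(c) := rfl
@[simp] lemma ofNat_n (c : ℕ) [c.AtLeastTwo] : (ofNat(c) : LatticeTriangle).n = 0 := rfl
@[simp] lemma ofNat_k (c : ℕ) [c.AtLeastTwo] :
    (ofNat(c) : LatticeTriangle).k = ofNat(c) := rfl
@[simp] lemma ofNat_l (c : ℕ) [c.AtLeastTwo] : (ofNat(c) : LatticeTriangle).l = 0 := rfl

/-- The automorphism `ζ ↦ ζ⁵`, which fixes `i`; it exchanges two vertices of the triangle. -/
def sigma5 : LatticeTriangle ≃+* LatticeTriangle where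
  toFun a := ⟨a.k, a.l, a.m, a.n⟩
  invFun a := ⟨a.k, a.l, a.m, a.n⟩
  left_inv _ := rfl
  right_inv _ := rfl
  map_add' _ _ := rfl
  map_mul' a b := by ext <;> simp <;> ring

/-- The automorphism `ζ ↦ ζ⁷`, which fixes `√-3`; it reflects the triangle. -/
def sigma7 : LatticeTriangle ≃+* LatticeTriangle where
  toFun a := ⟨a.m, -a.n, a.k, -a.l⟩
  invFun a := ⟨a.m, -a.n, a.k, -a.l⟩
  left_inv _ := by ext <;> simp
  right_inv _ := by ext <;> simp
  map_add' a b := by ext <;> simp <;> ring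
  map_mul' a b := by ext <;> simp <;> ring

/-- Complex conjugation `ζ ↦ ζ⁻¹`. -/
def conj : LatticeTriangle ≃+* LatticeTriangle where
  toFun a := ⟨a.k, -a.l, a.m, -a.n⟩
  invFun a := ⟨a.k, -a.l, a.m, -a.n⟩
  left_inv _ := by ext <;> simp
  right_inv _ := by ext <;> simp
  map_add' a b := by ext <;> simp <;> ring
  map_mul' a b := by ext <;> simp <;> ring

section automorphisms

variable (a : LatticeTriangle)

@[simp] lemma sigma5_m : (sigma5 a).m = a.k := rfl
@[simp] lemma sigma5_n : (sigma5 a).n = a.l := rfl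
@[simp] lemma sigma5_k : (sigma5 a).k = a.m := rfl
@[simp] lemma sigma5_l : (sigma5 a).l = a.n := rfl
@[simp] lemma sigma7_m : (sigma7 a).m = a.m := rfl
@[simp] lemma sigma7_n : (sigma7 a).n = -a.n := rfl
@[simp] lemma sigma7_k : (sigma7 a).k = a.k := rfl
@[simp] lemma sigma7_l : (sigma7 a).l = -a.l := rfl
@[simp] lemma conj_m : (conj a).m = a.k := rfl
@[simp] lemma conj_n : (conj a).n = -a.l := rfl
@[simp] lemma conj_k : (conj a).k = a.m := rfl
@[simp] lemma conj_l : (conj a).l = -a.n := rfl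

@[simp] lemma sigma5_sigma5 : sigma5 (sigma5 a) = a := rfl
@[simp] lemma sigma7_sigma7 : sigma7 (sigma7 a) = a := by ext <;> simp
@[simp] lemma conj_conj : conj (conj a) = a := by ext <;> simp
@[simp] lemma sigma7_conj : sigma7 (conj a) = sigma5 a := by ext <;> simp
@[simp] lemma sigma5_conj : sigma5 (conj a) = sigma7 a := by ext <;> simp
@[simp] lemma conj_sigma7 : conj (sigma7 a) = sigma5 a := by ext <;> simp
@[simp] lemma conj_sigma5 : conj (sigma5 a) = sigma7 a := by ext <;> simp
@[simp] lemma sigma5_sigma7 : sigma5 (sigma7 a) = conj a := by ext <;> simp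
@[simp] lemma sigma7_sigma5 : sigma7 (sigma5 a) = conj a := by ext <;> simp

end automorphisms

/-- Half of the sum of the squared side-lengths. -/
def halfSides (a : LatticeTriangle) : ℤ :=
  a.m ^ 2 + a.k ^ 2 - a.m * a.k + (a.n ^ 2 + a.l ^ 2 - a.n * a.l)

/-- The signed doubled area. -/
def signedArea (a : LatticeTriangle) : ℤ := a.n * a.k - a.m * a.l

/-- The norm of `ℤ[ζ]` over `ℤ`. -/
def normZ (a : LatticeTriangle) : ℤ := a.halfSides ^ 2 - 3 * a.signedArea ^ 2

/-- The relative norm from `ℤ[ζ]` to `ℤ[√3]`. -/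
def realNorm (a : LatticeTriangle) : LatticeTriangle := a * conj a

/-- The relative norm from `ℤ[ζ]` to `ℤ[√-3]`. -/
def eisNorm (a : LatticeTriangle) : LatticeTriangle := a * sigma7 a

lemma realNorm_eq (a : LatticeTriangle) :
    realNorm a = ⟨a.halfSides, a.signedArea, a.halfSides, -a.signedArea⟩ := by
  ext <;> simp [realNorm, halfSides, signedArea] <;> ring

lemma doubledArea_eq (a : LatticeTriangle) : a.doubledArea = |a.signedArea| := rfl

lemma realNorm_eq_iff {a b : LatticeTriangle} :
    realNorm a = realNorm b ↔ a.halfSides = b.halfSides ∧ a.signedArea = b.signedArea := by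
  simp only [realNorm_eq, LatticeTriangle.mk.injEq]
  omega

/-- The right side is the product of the four Galois conjugates. It supplies inverses of units and
the divisibility of the norm by the element. -/
lemma normZ_cast (a : LatticeTriangle) :
    ((normZ a : ℤ) : LatticeTriangle) = a * conj a * (sigma5 a * sigma7 a) := by
  ext
  · rw [intCast_m]; simp [normZ, halfSides, signedArea]; ring
  · rw [intCast_n]; simp; ring
  · rw [intCast_k]; simp [normZ, halfSides, signedArea]; ring
  · rw [intCast_l]; simp; ring

lemma normZ_mul (a b : LatticeTriangle) : normZ (a * b) = normZ a * normZ b := by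
  simp [normZ, halfSides, signedArea]; ring

lemma realNorm_mul (a b : LatticeTriangle) : realNorm (a * b) = realNorm a * realNorm b := by
  simp [realNorm]; ring

lemma eisNorm_mul (a b : LatticeTriangle) : eisNorm (a * b) = eisNorm a * eisNorm b := by
  simp [eisNorm]; ring

@[simp] lemma normZ_one : normZ 1 = 1 := by decide
@[simp] lemma normZ_zero : normZ 0 = 0 := by decide
@[simp] lemma normZ_conj (a : LatticeTriangle) : normZ (conj a) = normZ a := by
  simp [normZ, halfSides, signedArea]; ring
@[simp] lemma normZ_sigma5 (a : LatticeTriangle) : normZ (sigma5 a) = normZ a := by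
  simp [normZ, halfSides, signedArea]; ring
@[simp] lemma normZ_sigma7 (a : LatticeTriangle) : normZ (sigma7 a) = normZ a := by
  simp [normZ, halfSides, signedArea]; ring
lemma normZ_intCast (c : ℤ) : normZ (c : LatticeTriangle) = c ^ 4 := by
  simp [normZ, halfSides, signedArea]; ring
lemma normZ_natCast (c : ℕ) : normZ (c : LatticeTriangle) = c ^ 4 := by
  simp [normZ, halfSides, signedArea]; ring

lemma halfSides_nonneg (a : LatticeTriangle) : 0 ≤ a.halfSides := by
  unfold halfSides
  nlinarith [sq_nonneg (a.m - a.k), sq_nonneg (a.n - a.l), sq_nonneg a.m, sq_nonneg a.k,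
    sq_nonneg a.n, sq_nonneg a.l]

lemma eq_zero_of_halfSides {a : LatticeTriangle} (h : a.halfSides = 0) : a = 0 := by
  unfold halfSides at h
  have h1 : a.m ^ 2 + a.k ^ 2 + a.n ^ 2 + a.l ^ 2 ≤ 0 := by
    nlinarith [sq_nonneg (a.m - a.k), sq_nonneg (a.n - a.l)]
  have hm := sq_nonneg a.m
  have hk := sq_nonneg a.k
  have hn := sq_nonneg a.n
  have hl := sq_nonneg a.l
  ext <;> simp <;> rw [← sq_eq_zero_iff] <;> linarith

/-- The norm is a sum of two squares (a norm from `ℤ[i]`). -/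
lemma normZ_eq_sq_add_sq (a : LatticeTriangle) : normZ a =
    (a.m ^ 2 - a.n ^ 2 + a.k ^ 2 - a.l ^ 2 - a.m * a.k + a.n * a.l) ^ 2 +
      (2 * a.m * a.n + 2 * a.k * a.l - a.m * a.l - a.n * a.k) ^ 2 := by
  simp [normZ, halfSides, signedArea]; ring

lemma normZ_nonneg (a : LatticeTriangle) : 0 ≤ normZ a := by
  rw [normZ_eq_sq_add_sq]; positivity

/-- The 3-adic valuations of the two sides have different parity. This makes the norm vanish only at
0. -/
lemma int_sq_eq_three_mul_sq {x y : ℤ} (h : x ^ 2 = 3 * y ^ 2) : x = 0 := by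
  by_contra hx
  have hy : y ≠ 0 := by
    rintro rfl
    simp at h
    exact hx h
  have h3 : Prime (3 : ℤ) := Int.prime_three
  have := congrArg (emultiplicity 3) h
  rw [emultiplicity_pow h3, emultiplicity_mul h3, emultiplicity_pow h3,
    (Int.finiteMultiplicity_iff.2 ⟨by decide, hx⟩).emultiplicity_eq_multiplicity,
    (Int.finiteMultiplicity_iff.2 ⟨by decide, hy⟩).emultiplicity_eq_multiplicity,
    (Int.finiteMultiplicity_iff.2 ⟨by decide, by decide⟩ :
      FiniteMultiplicity (3 : ℤ) 3).emultiplicity_eq_multiplicity, multiplicity_self] at this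
  norm_cast at this
  omega

lemma normZ_eq_zero_iff {a : LatticeTriangle} : normZ a = 0 ↔ a = 0 := by
  refine ⟨fun h => eq_zero_of_halfSides (int_sq_eq_three_mul_sq (y := a.signedArea) ?_), ?_⟩
  · unfold normZ at h; linarith
  · rintro rfl; simp

lemma normZ_pos {a : LatticeTriangle} (h : a ≠ 0) : 0 < normZ a :=
  lt_of_le_of_ne (normZ_nonneg a) fun h' => h (normZ_eq_zero_iff.1 h'.symm)

instance : Nontrivial LatticeTriangle := ⟨0, 1, by simp [LatticeTriangle.ext_iff]⟩

instance : NoZeroDivisors LatticeTriangle where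
  eq_zero_or_eq_zero_of_mul_eq_zero {a b} h := by
    rw [← normZ_eq_zero_iff, ← normZ_eq_zero_iff (a := b)]
    rw [← normZ_eq_zero_iff, normZ_mul] at h
    exact mul_eq_zero.1 h

instance : IsDomain LatticeTriangle := NoZeroDivisors.to_isDomain _

lemma isUnit_iff_normZ {a : LatticeTriangle} : IsUnit a ↔ normZ a = 1 := by
  constructor
  · rintro ⟨u, rfl⟩
    have h : normZ (u : LatticeTriangle) * normZ (↑u⁻¹ : LatticeTriangle) = 1 := by
      rw [← normZ_mul]; simp
    exact (Int.eq_one_or_neg_one_of_mul_eq_one h).resolve_right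
      (by linarith [normZ_nonneg (u : LatticeTriangle)])
  · intro h
    refine IsUnit.of_mul_eq_one (conj a * (sigma5 a * sigma7 a)) ?_
    rw [← mul_assoc, ← normZ_cast, h, Int.cast_one]

lemma associated_of_dvd_of_normZ {a b : LatticeTriangle} (hb : b ≠ 0) (h : a ∣ b)
    (hn : normZ a = normZ b) : Associated a b := by
  obtain ⟨c, rfl⟩ := h
  have hc : IsUnit c := by
    rw [isUnit_iff_normZ]
    rw [normZ_mul] at hn
    have := normZ_pos (left_ne_zero_of_mul hb)
    nlinarith
  exact (associated_mul_unit_right a c hc)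

lemma normZ_eq_of_associated {a b : LatticeTriangle} (h : Associated a b) :
    normZ a = normZ b := by
  obtain ⟨u, rfl⟩ := h
  rw [normZ_mul, isUnit_iff_normZ.1 u.isUnit, mul_one]

lemma normZ_dvd {a b : LatticeTriangle} (h : a ∣ b) : normZ a ∣ normZ b := by
  obtain ⟨c, rfl⟩ := h
  exact ⟨_, normZ_mul a c⟩

lemma intCast_dvd_intCast {c d : ℤ} : (c : LatticeTriangle) ∣ d ↔ c ∣ d := by
  constructor
  · rintro ⟨e, he⟩
    have := congrArg LatticeTriangle.m he
    have h2 := congrArg LatticeTriangle.k he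
    simp at this h2
    refine ⟨e.k, ?_⟩
    have h3 : c * e.k = c * e.m := by linarith
    linarith
  · rintro ⟨e, rfl⟩
    exact ⟨e, by simp⟩

/-! ### Euclidean division -/

/-- The form x² + y² - xy belongs to the hexagonal lattice, whose squared covering radius is 1/3. A
diagonal cuts the cell containing the point into two equilateral triangles, and some vertex of the
triangle around the point is close enough. -/
lemma exists_round (m k N : ℤ) (hN : 0 < N) : ∃ s t : ℤ,
    3 * ((m - N * s) ^ 2 + (k - N * t) ^ 2 - (m - N * s) * (k - N * t)) ≤ N ^ 2 := by
  have hm := Int.emod_add_mul_ediv m N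
  have hk := Int.emod_add_mul_ediv k N
  have hm0 := Int.emod_nonneg m hN.ne'
  have hm1 := Int.emod_lt_of_pos m hN
  have hk0 := Int.emod_nonneg k hN.ne'
  have hk1 := Int.emod_lt_of_pos k hN
  set a := m % N
  set b := k % N
  set s := m / N
  set t := k / N
  by_contra! hcon
  have h00 := hcon s t
  have h11 := hcon (s + 1) (t + 1)
  rw [show m - N * s = a by linarith, show k - N * t = b by linarith] at h00
  rw [show m - N * (s + 1) = a - N by linarith, show k - N * (t + 1) = b - N by linarith] at h11
  rcases le_total a b with hab | hab
  · have h01 := hcon s (t + 1)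
    rw [show m - N * s = a by linarith, show k - N * (t + 1) = b - N by linarith] at h01
    -- The weights a, b - a, N - b are the barycentric coordinates (times N) of the point in its
    -- triangle. The weighted sum of the three squared distances is N times the sum of the pairwise
    -- products of the weights, hence at most N³/3; the squares of the differences of the weights
    -- express this.
    linarith [mul_nonneg hm0 (sub_nonneg.2 h11.le),
      mul_nonneg (sub_nonneg.2 hab) (sub_nonneg.2 h01.le), mul_pos (sub_pos.2 hk1) (sub_pos.2 h00),
      mul_nonneg hN.le (sq_nonneg (N - b - (b - a))), mul_nonneg hN.le (sq_nonneg (N - b - a)),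
      mul_nonneg hN.le (sq_nonneg (b - a - a))]
  · have h10 := hcon (s + 1) t
    rw [show m - N * (s + 1) = a - N by linarith, show k - N * t = b by linarith] at h10
    linarith [mul_nonneg hk0 (sub_nonneg.2 h11.le),
      mul_nonneg (sub_nonneg.2 hab) (sub_nonneg.2 h10.le), mul_pos (sub_pos.2 hm1) (sub_pos.2 h00),
      mul_nonneg hN.le (sq_nonneg (N - a - (a - b))), mul_nonneg hN.le (sq_nonneg (N - a - b)),
      mul_nonneg hN.le (sq_nonneg (a - b - b))]

/-- Multiplying by the product c of the other conjugates of b makes the divisor a rational integer,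
so that the quotient is found by rounding the pairs (m, k) and (n, l) of ac separately. -/
lemma exists_quotient (a : LatticeTriangle) {b : LatticeTriangle} (hb : b ≠ 0) :
    ∃ q, normZ (a - b * q) < normZ b := by
  have hN := normZ_pos hb
  set c := conj b * (sigma5 b * sigma7 b) with hc
  have hbc : b * c = (normZ b : LatticeTriangle) := by rw [normZ_cast, hc]; ring
  have hnc : normZ b * normZ c = normZ b ^ 4 := by rw [← normZ_mul, hbc, normZ_intCast]
  obtain ⟨s, t, h1⟩ := exists_round (a * c).m (a * c).k _ hN
  obtain ⟨u, v, h2⟩ := exists_round (a * c).n (a * c).l _ hN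
  refine ⟨⟨s, u, t, v⟩, ?_⟩
  set q : LatticeTriangle := ⟨s, u, t, v⟩
  set d := a * c - (normZ b : LatticeTriangle) * q with hd
  have hdm : d.m = (a * c).m - normZ b * s := by
    rw [hd, sub_m, mul_m (normZ b : LatticeTriangle)]; simp [q]; ring
  have hdn : d.n = (a * c).n - normZ b * u := by
    rw [hd, sub_n, mul_n (normZ b : LatticeTriangle)]; simp [q]; ring
  have hdk : d.k = (a * c).k - normZ b * t := by
    rw [hd, sub_k, mul_k (normZ b : LatticeTriangle)]; simp [q]; ring
  have hdl : d.l = (a * c).l - normZ b * v := by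
    rw [hd, sub_l, mul_l (normZ b : LatticeTriangle)]; simp [q]; ring
  -- Each rounding contributes a third, so X(d) ≤ 2N(b)²/3 and N(d) ≤ X(d)² ≤ 4N(b)⁴/9, whereas N(a
  -- - bq) ≥ N(b) would give N(d) ≥ N(b)⁴.
  have hhalf : 3 * d.halfSides ≤ 2 * normZ b ^ 2 := by
    rw [halfSides, hdm, hdn, hdk, hdl]; linarith
  have hnd : normZ d ≤ d.halfSides ^ 2 := by
    unfold normZ; linarith [sq_nonneg d.signedArea]
  have hd2 : normZ d = normZ (a - b * q) * normZ c := by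
    rw [← normZ_mul]; congr 1; rw [hd, ← hbc]; ring
  have h0 := halfSides_nonneg d
  have h3 : 9 * d.halfSides ^ 2 ≤ 4 * normZ b ^ 4 := by nlinarith
  by_contra! hcon
  have hc0 : 0 ≤ normZ c := normZ_nonneg c
  have h4 : normZ b ^ 4 ≤ normZ d := by
    rw [hd2, ← hnc]; exact mul_le_mul_of_nonneg_right hcon hc0
  have : 0 < normZ b ^ 4 := by positivity
  linarith

open Classical in
noncomputable instance : EuclideanDomain LatticeTriangle where
  quotient a b := if hb : b = 0 then 0 else (exists_quotient a hb).choose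
  quotient_zero a := by simp
  remainder a b := a - b * (if hb : b = 0 then 0 else (exists_quotient a hb).choose)
  quotient_mul_add_remainder_eq a b := by ring
  r a b := (normZ a).toNat < (normZ b).toNat
  r_wellFounded := (measure fun a => (normZ a).toNat).wf
  remainder_lt a b hb := by
    rw [dif_neg hb]
    have := (exists_quotient a hb).choose_spec
    have := normZ_pos hb
    omega
  mul_left_not_lt a b hb := by
    rw [normZ_mul]
    have h1 := normZ_pos hb
    have h2 := normZ_nonneg a
    have : normZ a ≤ normZ a * normZ b := by nlinarith
    omega

open NumberField

/-! ### The embedding into the cyclotomic field -/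

lemma zeta12_spec : IsPrimitiveRoot zeta12 12 := IsCyclotomicExtension.zeta_spec 12 ℚ K12

lemma zeta12_pow_four : zeta12 ^ 4 - zeta12 ^ 2 + 1 = 0 := by
  have h12 := zeta12_spec.pow_eq_one
  have h6 : zeta12 ^ 6 ≠ 1 := zeta12_spec.pow_ne_one_of_pos_of_lt (by norm_num) (by norm_num)
  have h4 : zeta12 ^ 4 ≠ 1 := zeta12_spec.pow_ne_one_of_pos_of_lt (by norm_num) (by norm_num)
  have h6' : zeta12 ^ 6 + 1 = 0 := by
    have : (zeta12 ^ 6 - 1) * (zeta12 ^ 6 + 1) = 0 := by linear_combination h12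
    exact (mul_eq_zero.1 this).resolve_left (sub_ne_zero.2 h6)
  have h2 : zeta12 ^ 2 + 1 ≠ 0 := fun h => h4 (by linear_combination (zeta12 ^ 2 - 1) * h)
  have : (zeta12 ^ 2 + 1) * (zeta12 ^ 4 - zeta12 ^ 2 + 1) = 0 := by linear_combination h6'
  exact (mul_eq_zero.1 this).resolve_left h2

lemma toField_eq (a : LatticeTriangle) : a.toField =
    a.m + (a.n - a.l) * zeta12 + (a.k - a.m) * zeta12 ^ 2 + a.l * zeta12 ^ 3 := by
  have h := zeta12_pow_four
  unfold toField
  linear_combination (a.m * (zeta12 ^ 6 + zeta12 ^ 4 - 1) + a.l * zeta12) * h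

/-- The identification of triangles with elements of `ℚ(ζ)`, as a ring homomorphism. -/
noncomputable def toFieldHom : LatticeTriangle →+* K12 where
  toFun := toField
  map_zero' := by simp [toField]
  map_one' := by simp [toField_eq]
  map_add' a b := by simp [toField]; ring
  map_mul' a b := by
    have h := zeta12_pow_four
    simp only [toField_eq, mul_m, mul_n, mul_k, mul_l]
    push_cast
    -- Up to sign the coefficient is the quotient in the division of the product of two cubics in ζ
    -- by ζ⁴ - ζ² + 1.
    linear_combination (-(((a.n : K12) - a.l) * b.l + (a.k - a.m) * (b.k - b.m) +
      a.l * (b.n - b.l) + ((a.k - a.m) * b.l + a.l * (b.k - b.m)) * zeta12 +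
      a.l * b.l * (zeta12 ^ 2 + 1))) * h

@[simp] lemma toFieldHom_apply (a : LatticeTriangle) : toFieldHom a = a.toField := rfl

lemma toFieldHom_injective : Function.Injective toFieldHom := by
  rw [injective_iff_map_eq_zero]
  intro a ha
  have h : toFieldHom (normZ a : LatticeTriangle) = 0 := by
    rw [normZ_cast, mul_assoc, map_mul, ha, zero_mul]
  rw [map_intCast] at h
  exact normZ_eq_zero_iff.1 (by exact_mod_cast h)

lemma toField_injective : Function.Injective toField := toFieldHom_injective

/-- The elements `ζ¹⁰, ζ, ζ², ζ⁵`. -/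
def basisTriangle : Fin 4 → LatticeTriangle :=
  ![⟨1, 0, 0, 0⟩, ⟨0, 1, 0, 0⟩, ⟨0, 0, 1, 0⟩, ⟨0, 0, 0, 1⟩]

/-- Rational relations reduce to integral ones, and an integral relation is a triangle mapped to 0.
-/
lemma linearIndependent_basisTriangle :
    LinearIndependent ℚ fun i => toFieldHom (basisTriangle i) := by
  rw [← LinearIndependent.iff_fractionRing ℤ ℚ, Fintype.linearIndependent_iff]
  intro g hg
  have h : toFieldHom ⟨g 0, g 1, g 2, g 3⟩ = 0 := by
    rw [← hg]
    simp [Fin.sum_univ_four, basisTriangle, toField]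
  rw [map_eq_zero_iff _ toFieldHom_injective, LatticeTriangle.ext_iff] at h
  simp at h
  intro i
  fin_cases i <;> simp [h]

lemma finrank_K12 : Module.finrank ℚ K12 = 4 := by
  rw [IsCyclotomicExtension.finrank (n := 12) K12
    (Polynomial.cyclotomic.irreducible_rat (by norm_num))]
  decide

/-- The basis `ζ¹⁰, ζ, ζ², ζ⁵` of `ℚ(ζ)`. -/
noncomputable def fieldBasis : Module.Basis (Fin 4) ℚ K12 :=
  basisOfLinearIndependentOfCardEqFinrank linearIndependent_basisTriangle
    (by simp [finrank_K12])

lemma fieldBasis_apply (i : Fin 4) : fieldBasis i = toField (basisTriangle i) := by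
  simp [fieldBasis]

lemma fieldBasis_repr (a : LatticeTriangle) (i : Fin 4) :
    fieldBasis.repr a.toField i = ![(a.m : ℚ), a.n, a.k, a.l] i := by
  have h := congrFun (fieldBasis.repr_sum_self ![(a.m : ℚ), a.n, a.k, a.l]) i
  rw [← h]
  congr 2
  simp only [Fin.sum_univ_four, fieldBasis_apply, Algebra.smul_def]
  simp [basisTriangle, toField]

theorem norm_toField (a : LatticeTriangle) : Algebra.norm ℚ a.toField = normZ a := by
  rw [Algebra.norm_eq_matrix_det fieldBasis]
  have h : Algebra.leftMulMatrix fieldBasis a.toField =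
      !![(a.k : ℚ), -a.l, a.m - a.k, a.l - a.n;
         a.l, a.k, a.n - a.l, a.m - a.k;
         a.k - a.m, a.n - a.l, a.m, -a.n;
         a.l - a.n, a.k - a.m, a.n, a.m] := by
    ext i j
    rw [Algebra.leftMulMatrix_eq_repr_mul, fieldBasis_apply, ← toFieldHom_apply,
      ← toFieldHom_apply, ← map_mul, toFieldHom_apply, fieldBasis_repr]
    fin_cases i <;> fin_cases j <;> simp [basisTriangle] <;> ring
  rw [h]
  simp [Matrix.det_succ_row_zero, Fin.sum_univ_succ, Fin.succAbove, normZ, halfSides, signedArea]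
  ring

lemma isIntegral_toField (a : LatticeTriangle) : IsIntegral ℤ a.toField := by
  have hz : IsIntegral ℤ zeta12 := zeta12_spec.isIntegral (by norm_num)
  have hc (c : ℤ) : IsIntegral ℤ (c : K12) := isIntegral_algebraMap (R := ℤ) (x := c)
  exact ((((hc _).mul (hz.pow _)).add ((hc _).mul hz)).add ((hc _).mul (hz.pow _))).add
    ((hc _).mul (hz.pow _))

/-- The integral closure of ℤ in ℚ(ζ) is generated by ζ, and ζ is the image of ⟨0, 1, 0, 0⟩. -/
lemma exists_toField_of_isIntegral {x : K12} (hx : IsIntegral ℤ x) :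
    ∃ a : LatticeTriangle, a.toField = x := by
  have hcl := IsCyclotomicExtension.Rat.isIntegralClosure_adjoin_singleton zeta12_spec
  obtain ⟨⟨y, hy⟩, hyx⟩ :=
    hcl.isIntegral_iff.1 hx
  have hle : Algebra.adjoin ℤ ({zeta12} : Set K12) ≤ toFieldHom.toIntAlgHom.range := by
    refine Algebra.adjoin_le (Set.singleton_subset_iff.2 ⟨⟨0, 1, 0, 0⟩, ?_⟩)
    simp [toField]
  obtain ⟨a, ha⟩ := hle hy
  exact ⟨a, ha.trans hyx⟩

lemma exists_unit_toField (u : (𝓞 K12)ˣ) :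
    ∃ v : LatticeTriangleˣ, toField v = ((u : 𝓞 K12) : K12) := by
  obtain ⟨a, ha⟩ := exists_toField_of_isIntegral (u : 𝓞 K12).isIntegral_coe
  obtain ⟨b, hb⟩ := exists_toField_of_isIntegral (↑u⁻¹ : 𝓞 K12).isIntegral_coe
  have hab : a * b = 1 := toFieldHom_injective (by
    rw [map_mul, map_one, toFieldHom_apply, toFieldHom_apply, ha, hb]
    norm_cast
    simp)
  exact ⟨⟨a, b, hab, by rw [mul_comm, hab]⟩, ha⟩

lemma exists_unit_of_unit (v : LatticeTriangleˣ) :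
    ∃ u : (𝓞 K12)ˣ, ((u : 𝓞 K12) : K12) = toField v :=
  ⟨Units.map (RingOfIntegers.restrict_monoidHom toFieldHom.toMonoidHom isIntegral_toField) v, rfl⟩

lemma isLeader_iff (a : LatticeTriangle) :
    IsLeader a ↔ ∀ v : LatticeTriangleˣ, a.doubledArea ≤ (a * v).doubledArea := by
  constructor
  · intro h v
    obtain ⟨u, hu⟩ := exists_unit_of_unit v
    exact h u _ (by rw [hu, ← toFieldHom_apply, map_mul]; rfl)
  · intro h u b hb
    obtain ⟨v, hv⟩ := exists_unit_toField u
    have : b = a * v := toFieldHom_injective (by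
      rw [map_mul, toFieldHom_apply, hb, toFieldHom_apply, toFieldHom_apply, hv])
    rw [this]
    exact h v

/-- The unit `1 + ζ`. -/
def eta : LatticeTriangleˣ where
  val := ⟨1, 1, 1, 0⟩
  inv := ⟨0, -1, 1, -1⟩
  val_inv := by ext <;> simp
  inv_val := by ext <;> simp

lemma toField_mul_eta_zpow (a : LatticeTriangle) (j : ℤ) :
    (a * ↑(eta ^ j)).toField = a.toField * (1 + zeta12) ^ j := by
  have h1 : toFieldHom (eta : LatticeTriangle) = 1 + zeta12 := by simp [toField_eq, eta]
  have h2 : toFieldHom ((eta ^ j : LatticeTriangleˣ) : LatticeTriangle) = (1 + zeta12) ^ j := by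
    have h := congrArg Units.val (map_zpow (Units.map toFieldHom.toMonoidHom) eta j)
    rw [Units.val_zpow_eq_zpow_val] at h
    rw [← h1]
    exact h
  rw [← toFieldHom_apply, map_mul, h2, toFieldHom_apply]

/-- The sequence of classes of triangles in the coset of `a`, with `a` labelled by `0`. -/
def cosetSeq (a : LatticeTriangle) : TriangleSequence :=
  fun j => {T | (a * ↑(eta ^ j)).LatticeCongruent T}

lemma isSolutionCoset_iff (r : ℕ) (C : TriangleSequence) :
    IsSolutionCoset r C ↔ ∃ a, normZ a = r ∧ IsLeader a ∧ C = cosetSeq a := by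
  constructor
  · rintro ⟨T, h1, h2, h3, h4⟩
    refine ⟨T 0, ?_, h2, funext fun j => ?_⟩
    · rw [norm_toField] at h1
      exact_mod_cast h1
    · have h : T 0 * ↑(eta ^ j) = T j := by
        apply toField_injective
        rw [toField_mul_eta_zpow, h3 j]
      rw [h4 j, ← h]
      rfl
  · rintro ⟨a, h1, h2, rfl⟩
    have h0 : a * ↑(eta ^ (0 : ℤ)) = a := by rw [zpow_zero, Units.val_one, mul_one]
    refine ⟨fun j => a * ↑(eta ^ j), ?_, ?_, fun j => ?_, fun j => ?_⟩
    · beta_reduce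
      rw [h0, norm_toField, h1, Int.cast_natCast]
    · beta_reduce
      rwa [h0]
    · beta_reduce
      rw [h0, toField_mul_eta_zpow]
    · simp only [cosetSeq]

instance : DecidableEq LatticeTriangle := fun a b =>
  decidable_of_iff (a.m = b.m ∧ a.n = b.n ∧ a.k = b.k ∧ a.l = b.l) LatticeTriangle.ext_iff.symm

/-! ### Roots of unity and congruence of triangles -/

/-- The root of unity `ζ`. -/
def zeta : LatticeTriangle := ⟨0, 1, 0, 0⟩

@[simp] lemma realNorm_one : realNorm 1 = 1 := by decide
lemma realNorm_eq_one_iff {u : LatticeTriangle} :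
    realNorm u = 1 ↔ u.halfSides = 1 ∧ u.signedArea = 0 := by
  rw [← realNorm_one, realNorm_eq_iff]
  rfl

lemma isUnit_of_realNorm {u : LatticeTriangle} (hu : realNorm u = 1) : IsUnit u :=
  IsUnit.of_mul_eq_one _ hu

lemma normZ_of_realNorm {a b : LatticeTriangle} (h : realNorm a = realNorm b) :
    normZ a = normZ b := by
  rw [realNorm_eq_iff] at h
  simp [normZ, h]

/-- The form X is positive definite, and X = 1 confines all coordinates to -1, 0, 1. Among the
finitely many candidates with S = 0 only twelve remain, listed in the order ζ⁰, …, ζ¹¹. -/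
lemma exists_pow_zeta {u : LatticeTriangle} (hu : realNorm u = 1) : ∃ j : ℕ, u = zeta ^ j := by
  rw [realNorm_eq_one_iff] at hu
  obtain ⟨h1, h2⟩ := hu
  obtain ⟨m, n, k, l⟩ := u
  simp only [halfSides, signedArea] at h1 h2
  have hm : -1 ≤ m ∧ m ≤ 1 := by
      constructor <;> nlinarith [sq_nonneg (2 * k - m), sq_nonneg (2 * n - l), sq_nonneg l]
  have hk : -1 ≤ k ∧ k ≤ 1 := by
      constructor <;> nlinarith [sq_nonneg (2 * m - k), sq_nonneg (2 * n - l), sq_nonneg l]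
  have hn : -1 ≤ n ∧ n ≤ 1 := by
      constructor <;> nlinarith [sq_nonneg (2 * l - n), sq_nonneg (2 * m - k), sq_nonneg k]
  have hl : -1 ≤ l ∧ l ≤ 1 := by
      constructor <;> nlinarith [sq_nonneg (2 * n - l), sq_nonneg (2 * m - k), sq_nonneg k]
  have key : ∀ m ∈ Finset.Icc (-1 : ℤ) 1, ∀ n ∈ Finset.Icc (-1 : ℤ) 1,
      ∀ k ∈ Finset.Icc (-1 : ℤ) 1, ∀ l ∈ Finset.Icc (-1 : ℤ) 1,
      m ^ 2 + k ^ 2 - m * k + (n ^ 2 + l ^ 2 - n * l) = 1 → n * k - m * l = 0 →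
      (m, n, k, l) ∈ [(1, 0, 1, 0), (0, 1, 0, 0), (0, 0, 1, 0), (0, 1, 0, 1), (-1, 0, 0, 0),
        (0, 0, 0, 1), (-1, 0, -1, 0), (0, -1, 0, 0), (0, 0, -1, 0), (0, -1, 0, -1), (1, 0, 0, 0),
        (0, 0, 0, -1)] := by decide
  have hd := key m (by simpa using hm) n (by simpa using hn) k (by simpa using hk) l
    (by simpa using hl) h1 h2
  simp only [List.mem_cons, Prod.mk.injEq, List.not_mem_nil, or_false] at hd
  rcases hd with h | h | h | h | h | h | h | h | h | h | h | h <;>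
    obtain ⟨rfl, rfl, rfl, rfl⟩ := h
  exacts [⟨0, by simp [LatticeTriangle.ext_iff]⟩, ⟨1, by simp [zeta]⟩, ⟨2, by decide⟩,
    ⟨3, by decide⟩, ⟨4, by decide⟩, ⟨5, by decide⟩, ⟨6, by decide⟩, ⟨7, by decide⟩,
    ⟨8, by decide⟩, ⟨9, by decide⟩, ⟨10, by decide⟩, ⟨11, by decide⟩]

/-- `b` is obtained from `a` by an automorphism of `ℤ[ζ]` and a multiplication by a root of
unity. -/
def Related (a b : LatticeTriangle) : Prop :=
  ∃ u, realNorm u = 1 ∧ (b = u * a ∨ b = u * conj a ∨ b = u * sigma5 a ∨ b = u * sigma7 a)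

@[simp] lemma realNorm_conj (a : LatticeTriangle) : realNorm (conj a) = realNorm a := by
  simp [realNorm, mul_comm]

lemma realNorm_sigma5_eq (a : LatticeTriangle) : realNorm (sigma5 a) = sigma5 (realNorm a) := by
  simp [realNorm]

lemma realNorm_sigma7_eq (a : LatticeTriangle) : realNorm (sigma7 a) = sigma7 (realNorm a) := by
  simp [realNorm]

lemma Related.trans {a b c : LatticeTriangle} (h : Related a b) (h' : Related b c) :
    Related a c := by
  obtain ⟨u, hu, h⟩ := h
  obtain ⟨v, hv, h'⟩ := h'
  rcases h' with rfl | rfl | rfl | rfl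
  · exact ⟨v * u, by rw [realNorm_mul, hu, hv, one_mul],
      by rcases h with rfl | rfl | rfl | rfl <;> simp [mul_assoc]⟩
  · exact ⟨v * conj u, by rw [realNorm_mul, realNorm_conj, hu, hv, one_mul],
      by rcases h with rfl | rfl | rfl | rfl <;> simp [mul_assoc]⟩
  · exact ⟨v * sigma5 u, by rw [realNorm_mul, realNorm_sigma5_eq, hu, hv, map_one, one_mul],
      by rcases h with rfl | rfl | rfl | rfl <;> simp [mul_assoc]⟩
  · exact ⟨v * sigma7 u, by rw [realNorm_mul, realNorm_sigma7_eq, hu, hv, map_one, one_mul],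
      by rcases h with rfl | rfl | rfl | rfl <;> simp [mul_assoc]⟩

lemma LatticeCongruent.trans {a b c : LatticeTriangle} (h : a.LatticeCongruent b)
    (h' : b.LatticeCongruent c) : a.LatticeCongruent c := by
  obtain ⟨M, hM, v, π, h⟩ := h
  obtain ⟨M', hM', v', π', h'⟩ := h'
  refine ⟨M' * M, mul_mem hM' hM, M'.mulVec v + v', π.trans π', fun i => ?_⟩
  rw [Equiv.trans_apply, ← h', ← h, Matrix.mulVec_add, Matrix.mulVec_mulVec, add_assoc]

lemma latticeCongruent_refl (a : LatticeTriangle) : a.LatticeCongruent a :=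
  ⟨1, one_mem _, 0, Equiv.refl _, fun i => by simp⟩

lemma latticeCongruent_sigma5 (a : LatticeTriangle) : a.LatticeCongruent (sigma5 a) := by
  refine ⟨1, one_mem _, 0, Equiv.swap 1 2, fun i => ?_⟩
  fin_cases i <;> simp [vertex, Equiv.swap_apply_def]

lemma latticeCongruent_sigma7 (a : LatticeTriangle) : a.LatticeCongruent (sigma7 a) := by
  refine ⟨!![1, 0; 0, -1], ?_, 0, Equiv.refl _, fun i => ?_⟩
  · rw [Matrix.mem_orthogonalGroup_iff]
    decide
  · fin_cases i <;> ext j <;> fin_cases j <;> simp [vertex, Matrix.vecHead, Matrix.vecTail]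

/-- Multiplication by ζ turns the triangle through a right angle, permutes its vertices cyclically
and shifts the new first vertex back to the origin. -/
lemma latticeCongruent_zeta_mul (a : LatticeTriangle) : a.LatticeCongruent (zeta * a) := by
  refine ⟨!![0, 1; -1, 0], ?_, ![-a.l, a.k], finRotate 3, fun i => ?_⟩
  · rw [Matrix.mem_orthogonalGroup_iff]
    decide
  · fin_cases i <;> ext j <;> fin_cases j <;>
      simp [vertex, zeta, Matrix.vecHead, Matrix.vecTail, finRotate_apply] <;> ring

lemma Related.latticeCongruent {a b : LatticeTriangle} (h : Related a b) :
    a.LatticeCongruent b := by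
  obtain ⟨u, hu, h⟩ := h
  obtain ⟨j, rfl⟩ := exists_pow_zeta hu
  have key (c : LatticeTriangle) (j : ℕ) : c.LatticeCongruent (zeta ^ j * c) := by
    induction j with
    | zero => simpa using latticeCongruent_refl c
    | succ j ih =>
      rw [pow_succ', mul_assoc]
      exact ih.trans (latticeCongruent_zeta_mul _)
  rcases h with rfl | rfl | rfl | rfl
  · exact key a j
  · refine LatticeCongruent.trans ?_ (key _ j)
    rw [← sigma5_sigma7]
    exact (latticeCongruent_sigma7 a).trans (latticeCongruent_sigma5 _)
  · exact (latticeCongruent_sigma5 a).trans (key _ j)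
  · exact (latticeCongruent_sigma7 a).trans (key _ j)

lemma perm_fin_three (π : Equiv.Perm (Fin 3)) :
    (π 0 = 0 ∧ π 1 = 1 ∧ π 2 = 2) ∨ (π 0 = 0 ∧ π 1 = 2 ∧ π 2 = 1) ∨
    (π 0 = 1 ∧ π 1 = 0 ∧ π 2 = 2) ∨ (π 0 = 1 ∧ π 1 = 2 ∧ π 2 = 0) ∨
    (π 0 = 2 ∧ π 1 = 0 ∧ π 2 = 1) ∨ (π 0 = 2 ∧ π 1 = 1 ∧ π 2 = 0) := by
  revert π
  decide

lemma orthogonal_entries {p q s t : ℤ} (h1 : p * p + q * q = 1) (h2 : s * s + t * t = 1)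
    (h3 : p * s + q * t = 0) :
    (p = 1 ∧ q = 0 ∧ s = 0 ∧ t = 1) ∨ (p = 1 ∧ q = 0 ∧ s = 0 ∧ t = -1) ∨
    (p = -1 ∧ q = 0 ∧ s = 0 ∧ t = 1) ∨ (p = -1 ∧ q = 0 ∧ s = 0 ∧ t = -1) ∨
    (p = 0 ∧ q = 1 ∧ s = 1 ∧ t = 0) ∨ (p = 0 ∧ q = 1 ∧ s = -1 ∧ t = 0) ∨
    (p = 0 ∧ q = -1 ∧ s = 1 ∧ t = 0) ∨ (p = 0 ∧ q = -1 ∧ s = -1 ∧ t = 0) := by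
  have hp : -1 ≤ p ∧ p ≤ 1 := by constructor <;> nlinarith
  have hq : -1 ≤ q ∧ q ≤ 1 := by constructor <;> nlinarith
  have hs : -1 ≤ s ∧ s ≤ 1 := by constructor <;> nlinarith
  have ht : -1 ≤ t ∧ t ≤ 1 := by constructor <;> nlinarith
  have key : ∀ p ∈ Finset.Icc (-1 : ℤ) 1, ∀ q ∈ Finset.Icc (-1 : ℤ) 1,
      ∀ s ∈ Finset.Icc (-1 : ℤ) 1, ∀ t ∈ Finset.Icc (-1 : ℤ) 1,
      p * p + q * q = 1 → s * s + t * t = 1 → p * s + q * t = 0 →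
      (p, q, s, t) ∈ [(1, 0, 0, 1), (1, 0, 0, -1), (-1, 0, 0, 1), (-1, 0, 0, -1), (0, 1, 1, 0),
        (0, 1, -1, 0), (0, -1, 1, 0), (0, -1, -1, 0)] := by decide
  simpa using key p (by simpa using hp) q (by simpa using hq) s (by simpa using hs) t
    (by simpa using ht) h1 h2 h3

/-- The isometry splits into its linear part, leading from a to c, and the relabelling of the
vertices, leading from c to b. The former accounts for the units ±1, ±i and for ζ ↦ ζ⁷, the latter
for the cube roots of unity and for ζ ↦ ζ⁵. -/
lemma LatticeCongruent.related {a b : LatticeTriangle} (h : a.LatticeCongruent b) :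
    Related a b := by
  obtain ⟨M, hM, v, π, h⟩ := h
  rw [Matrix.mem_orthogonalGroup_iff, ← Matrix.ext_iff] at hM
  have e00 := hM 0 0
  have e01 := hM 0 1
  have e11 := hM 1 1
  simp [Matrix.mul_apply, Fin.sum_univ_two] at e00 e01 e11
  have hx (i : Fin 3) := congrFun (h i) 0
  have hy (i : Fin 3) := congrFun (h i) 1
  have x0 := hx 0
  have x1 := hx 1
  have x2 := hx 2
  have y0 := hy 0
  have y1 := hy 1
  have y2 := hy 2
  simp only [Matrix.mulVec, dotProduct, Fin.sum_univ_two, Pi.add_apply] at x0 x1 x2 y0 y1 y2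
  set p := M 0 0
  set q := M 0 1
  set s := M 1 0
  set t := M 1 1
  let c : LatticeTriangle := ⟨p * a.m + q * a.n, s * a.m + t * a.n, p * a.k + q * a.l,
    s * a.k + t * a.l⟩
  have hac : Related a c := by
    rcases orthogonal_entries e00 e11 e01 with h | h | h | h | h | h | h | h <;>
      obtain ⟨hp, hq, hs, ht⟩ := h <;> simp only [c, hp, hq, hs, ht]
    · exact ⟨1, by decide, Or.inl (by ext <;> simp)⟩
    · exact ⟨1, by decide, Or.inr (Or.inr (Or.inr (by ext <;> simp)))⟩
    · exact ⟨-1, by decide, Or.inr (Or.inr (Or.inr (by ext <;> simp)))⟩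
    · exact ⟨-1, by decide, Or.inl (by ext <;> simp)⟩
    · exact ⟨⟨0, 1, 0, 1⟩, by decide, Or.inr (Or.inr (Or.inr (by ext <;> simp)))⟩
    · exact ⟨⟨0, -1, 0, -1⟩, by decide, Or.inl (by ext <;> simp)⟩
    · exact ⟨⟨0, 1, 0, 1⟩, by decide, Or.inl (by ext <;> simp)⟩
    · exact ⟨⟨0, -1, 0, -1⟩, by decide, Or.inr (Or.inr (Or.inr (by ext <;> simp)))⟩
  have hcb : Related c b := by
    rcases perm_fin_three π with h | h | h | h | h | h <;> obtain ⟨h0, h1, h2⟩ := h <;>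
      rw [h0] at x0 y0 <;> rw [h1] at x1 y1 <;> rw [h2] at x2 y2 <;>
      simp [vertex] at x0 y0 x1 y1 x2 y2
    · exact ⟨1, by decide, Or.inl (by ext <;> simp [c] <;> linarith)⟩
    · exact ⟨1, by decide, Or.inr (Or.inr (Or.inl (by ext <;> simp [c] <;> linarith)))⟩
    · exact ⟨⟨-1, 0, 0, 0⟩, by decide,
        Or.inr (Or.inr (Or.inl (by ext <;> simp [c] <;> linarith)))⟩
    · exact ⟨⟨-1, 0, 0, 0⟩, by decide, Or.inl (by ext <;> simp [c] <;> linarith)⟩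
    · exact ⟨⟨0, 0, -1, 0⟩, by decide, Or.inl (by ext <;> simp [c] <;> linarith)⟩
    · exact ⟨⟨0, 0, -1, 0⟩, by decide,
        Or.inr (Or.inr (Or.inl (by ext <;> simp [c] <;> linarith)))⟩
  exact hac.trans hcb

lemma latticeCongruent_iff {a b : LatticeTriangle} : a.LatticeCongruent b ↔ Related a b :=
  ⟨LatticeCongruent.related, Related.latticeCongruent⟩

lemma mul_conj_cancel {u a b : LatticeTriangle} (hu : realNorm u = 1) (h : b = u * a) :
    a = conj u * b := by
  rw [h, ← mul_assoc, mul_comm (conj u) u]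
  unfold realNorm at hu
  rw [hu, one_mul]

lemma Related.symm {a b : LatticeTriangle} (h : Related a b) : Related b a := by
  obtain ⟨u, hu, h⟩ := h
  rcases h with h | h | h | h
  · exact ⟨conj u, by simpa using hu, Or.inl (mul_conj_cancel hu h)⟩
  · refine ⟨u, hu, Or.inr (Or.inl ?_)⟩
    have := congrArg conj (mul_conj_cancel hu h)
    simpa using this
  · refine ⟨sigma7 u, by rw [realNorm_sigma7_eq, hu, map_one], Or.inr (Or.inr (Or.inl ?_))⟩
    have := congrArg sigma5 (mul_conj_cancel hu h)
    simpa using this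
  · refine ⟨sigma5 u, by rw [realNorm_sigma5_eq, hu, map_one], Or.inr (Or.inr (Or.inr ?_))⟩
    have := congrArg sigma7 (mul_conj_cancel hu h)
    simpa using this

lemma squaredSides_zeta_mul (a : LatticeTriangle) :
    (zeta * a).squaredSides = a.squaredSides := by
  have h1 : ((zeta * a).m - (zeta * a).k) ^ 2 + ((zeta * a).n - (zeta * a).l) ^ 2 =
      a.m ^ 2 + a.n ^ 2 := by simp [zeta]; ring
  have h2 : (zeta * a).k ^ 2 + (zeta * a).l ^ 2 = (a.m - a.k) ^ 2 + (a.n - a.l) ^ 2 := by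
    simp [zeta]; ring
  have h3 : (zeta * a).m ^ 2 + (zeta * a).n ^ 2 = a.k ^ 2 + a.l ^ 2 := by simp [zeta]; ring
  rw [squaredSides, squaredSides, h1, h2, h3, Multiset.insert_eq_cons, Multiset.insert_eq_cons,
    Multiset.insert_eq_cons, Multiset.insert_eq_cons, Multiset.cons_swap]
  congr 1
  exact Multiset.pair_comm _ _

lemma squaredSides_sigma5 (a : LatticeTriangle) : (sigma5 a).squaredSides = a.squaredSides := by
  simp only [squaredSides, sigma5_m, sigma5_n, sigma5_k, sigma5_l, Multiset.insert_eq_cons]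
  rw [show (a.k - a.m) ^ 2 + (a.l - a.n) ^ 2 = (a.m - a.k) ^ 2 + (a.n - a.l) ^ 2 by ring]
  congr 1
  exact Multiset.pair_comm _ _

lemma squaredSides_sigma7 (a : LatticeTriangle) : (sigma7 a).squaredSides = a.squaredSides := by
  simp only [squaredSides, sigma7_m, sigma7_n, sigma7_k, sigma7_l, neg_sq]
  rw [show (a.m - a.k) ^ 2 + (-a.n - -a.l) ^ 2 = (a.m - a.k) ^ 2 + (a.n - a.l) ^ 2 by ring]

lemma squaredSides_conj (a : LatticeTriangle) : (conj a).squaredSides = a.squaredSides := by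
  rw [← sigma5_sigma7, squaredSides_sigma5, squaredSides_sigma7]

lemma Related.squaredSides_eq {a b : LatticeTriangle} (h : Related a b) :
    a.squaredSides = b.squaredSides := by
  obtain ⟨u, hu, h⟩ := h
  obtain ⟨j, rfl⟩ := exists_pow_zeta hu
  have key (c : LatticeTriangle) (j : ℕ) : (zeta ^ j * c).squaredSides = c.squaredSides := by
    induction j with
    | zero => simp
    | succ j ih => rw [pow_succ', mul_assoc, squaredSides_zeta_mul, ih]
  rcases h with rfl | rfl | rfl | rfl <;>
    simp only [key, squaredSides_conj, squaredSides_sigma5, squaredSides_sigma7]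

lemma doubledArea_eq_of_realNorm {a b : LatticeTriangle} (h : realNorm a = realNorm b) :
    a.doubledArea = b.doubledArea := by
  rw [doubledArea_eq, doubledArea_eq, (realNorm_eq_iff.1 h).2]

lemma signedArea_of_realNorm_sigma5 {a b : LatticeTriangle}
    (h : realNorm b = sigma5 (realNorm a)) : b.signedArea = -a.signedArea := by
  rw [realNorm_eq, realNorm_eq] at h
  exact congrArg LatticeTriangle.n h

lemma Related.doubledArea_eq {a b : LatticeTriangle} (h : Related a b) :
    a.doubledArea = b.doubledArea := by
  obtain ⟨u, hu, h⟩ := h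
  rcases h with rfl | rfl | rfl | rfl
  · exact doubledArea_eq_of_realNorm (by rw [realNorm_mul, hu, one_mul])
  · exact doubledArea_eq_of_realNorm (by rw [realNorm_mul, hu, one_mul, realNorm_conj])
  · rw [LatticeTriangle.doubledArea_eq, LatticeTriangle.doubledArea_eq,
      signedArea_of_realNorm_sigma5 (b := u * sigma5 a) (a := a), abs_neg]
    rw [realNorm_mul, hu, one_mul, realNorm_sigma5_eq]
  · rw [LatticeTriangle.doubledArea_eq, LatticeTriangle.doubledArea_eq,
      signedArea_of_realNorm_sigma5 (b := u * sigma7 a) (a := a), abs_neg]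
    rw [realNorm_mul, hu, one_mul, realNorm_sigma7_eq, realNorm_eq]
    ext <;> simp

/-! ### Sequences of triangles -/

/-- Complex conjugation on units. -/
def conjUnit : LatticeTriangleˣ →* LatticeTriangleˣ :=
  Units.map (conj : LatticeTriangle →* LatticeTriangle)

@[simp] lemma coe_conjUnit (u : LatticeTriangleˣ) :
    (conjUnit u : LatticeTriangle) = conj u := rfl

lemma realNorm_ne_zero {a : LatticeTriangle} (ha : a ≠ 0) : realNorm a ≠ 0 := by
  simp [realNorm, ha]

lemma conj_ne_zero {a : LatticeTriangle} (ha : a ≠ 0) : conj a ≠ 0 := by simpa using ha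

lemma eisNorm_ne_zero {a : LatticeTriangle} (ha : a ≠ 0) : eisNorm a ≠ 0 := by
  simp [eisNorm, ha]

lemma realNorm_unit_of_eq {a b u : LatticeTriangle} (ha : a ≠ 0) (hb : b = a * u)
    (h : realNorm a = realNorm b) : realNorm u = 1 := by
  rw [hb, realNorm_mul] at h
  exact (mul_right_eq_self₀.1 h.symm).resolve_right (realNorm_ne_zero ha)

lemma latticeCongruent_equivalence {a b : LatticeTriangle} (h : a.LatticeCongruent b) :
    {T | a.LatticeCongruent T} = {T | b.LatticeCongruent T} := by
  ext T
  exact ⟨fun h' => (latticeCongruent_iff.1 h).symm.latticeCongruent.trans h',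
    fun h' => h.trans h'⟩

/-- Association together with equal norms to ℤ[√3] means that the unit factor is a root of unity.
For conjugates one also uses that e = (1 + ζ)^j and its conjugate differ by a factor of relative
norm 1, so that conjugation preserves the labels. -/
lemma cosetSeq_eq_of_associated {a b : LatticeTriangle} (ha : a ≠ 0)
    (h : realNorm a = realNorm b) (h' : Associated a b ∨ Associated (conj a) b) :
    cosetSeq a = cosetSeq b := by
  funext j
  refine latticeCongruent_equivalence (Related.latticeCongruent ?_)
  rcases h' with ⟨u, hu⟩ | ⟨u, hu⟩
  · exact ⟨u, realNorm_unit_of_eq ha hu.symm h, Or.inl (by rw [← hu]; ring)⟩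
  · have hu1 := realNorm_unit_of_eq (conj_ne_zero ha) hu.symm (by rw [realNorm_conj, h])
    set e := eta ^ j
    have he : (e : LatticeTriangle) = ↑(e * (conjUnit e)⁻¹) * conj (e : LatticeTriangle) := by
      rw [← coe_conjUnit, ← Units.val_mul, inv_mul_cancel_right]
    refine ⟨u * ↑(e * (conjUnit e)⁻¹), ?_, Or.inr (Or.inl ?_)⟩
    · rw [realNorm_mul, hu1, one_mul, realNorm, ← coe_conjUnit, ← Units.val_mul]
      have : conjUnit (conjUnit e) = e := by ext1; simp
      rw [map_mul, map_inv, this, show e * (conjUnit e)⁻¹ * (conjUnit e * e⁻¹) = 1 by group,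
        Units.val_one]
    · rw [← hu, map_mul]
      nth_rw 1 [he]
      ring

/-- The norm of 1 + ζ to ℤ[√3] is 2 + √3, and (X + S√3)(2 + √3) has √3-coefficient 2S + X. -/
lemma signedArea_mul_eta (a : LatticeTriangle) :
    (a * eta).signedArea = 2 * a.signedArea + a.halfSides := by
  simp [halfSides, signedArea, eta]; ring

lemma halfSides_pos {a : LatticeTriangle} (ha : a ≠ 0) : 0 < a.halfSides :=
  lt_of_le_of_ne (halfSides_nonneg a) fun h => ha (eq_zero_of_halfSides h.symm)

lemma abs_signedArea_lt {a : LatticeTriangle} (ha : a ≠ 0) : |a.signedArea| < a.halfSides := by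
  have h1 := halfSides_pos ha
  have h2 := normZ_pos ha
  unfold normZ at h2
  refine abs_lt_of_sq_lt_sq ?_ h1.le
  nlinarith [sq_nonneg a.signedArea]

lemma mul_unit_ne_zero {a : LatticeTriangle} (ha : a ≠ 0) (u : LatticeTriangleˣ) :
    a * u ≠ 0 := mul_ne_zero ha u.ne_zero

lemma mul_eta_pow_succ (a : LatticeTriangle) (j : ℕ) :
    a * ↑(eta ^ (j + 1)) = a * ↑(eta ^ j) * eta := by
  rw [pow_succ, Units.val_mul, mul_assoc]

/-- Positivity of the norm gives -S < X, so every step from S to 2S + X is an increase by at least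
1. -/
lemma le_signedArea_mul_eta_pow {a : LatticeTriangle} (ha : a ≠ 0) (j : ℕ) :
    a.signedArea + j ≤ (a * ↑(eta ^ j)).signedArea := by
  induction j with
  | zero => simp
  | succ j ih =>
    rw [mul_eta_pow_succ, signedArea_mul_eta]
    have := (abs_lt.1 (abs_signedArea_lt (mul_unit_ne_zero ha (eta ^ j)))).1
    rw [Nat.cast_succ]
    linarith

lemma exists_signedArea_pos {a b : LatticeTriangle} (ha : a ≠ 0) (hb : b ≠ 0) :
    ∃ J : ℕ, ∀ j, J ≤ j →
      0 < (a * ↑(eta ^ j)).signedArea ∧ 0 < (b * ↑(eta ^ j)).signedArea := by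
  refine ⟨(|a.signedArea| + |b.signedArea|).toNat + 1, fun j hj => ?_⟩
  have h1 := le_signedArea_mul_eta_pow ha j
  have h2 := le_signedArea_mul_eta_pow hb j
  have h3 := neg_abs_le a.signedArea
  have h4 := neg_abs_le b.signedArea
  have h5 := abs_nonneg a.signedArea
  have h6 := abs_nonneg b.signedArea
  omega

/-- Areas lose the sign of S, but for large labels S is positive in both sequences. Two consecutive
areas S and 2S + X then recover X + S√3 at that label, and the unit is cancelled. -/
lemma realNorm_eq_of_doubledArea {a b : LatticeTriangle} (ha : a ≠ 0) (hb : b ≠ 0)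
    (h : ∀ j : ℕ, (a * ↑(eta ^ j)).doubledArea = (b * ↑(eta ^ j)).doubledArea) :
    realNorm a = realNorm b := by
  obtain ⟨J, hJ⟩ := exists_signedArea_pos ha hb
  have key (j : ℕ) (hj : J ≤ j) :
      (a * ↑(eta ^ j)).signedArea = (b * ↑(eta ^ j)).signedArea := by
    have := h j
    rwa [doubledArea_eq, doubledArea_eq, abs_of_pos (hJ j hj).1, abs_of_pos (hJ j hj).2] at this
  have h0 := key J le_rfl
  have h1 := key (J + 1) (by omega)
  rw [mul_eta_pow_succ, mul_eta_pow_succ, signedArea_mul_eta, signedArea_mul_eta] at h1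
  have h2 : realNorm (a * ↑(eta ^ J)) = realNorm (b * ↑(eta ^ J)) :=
    realNorm_eq_iff.2 ⟨by linarith, h0⟩
  rw [realNorm_mul, realNorm_mul] at h2
  exact mul_right_cancel₀ (realNorm_ne_zero (eta ^ J).ne_zero) h2

lemma sameAreas_cosetSeq_iff {a b : LatticeTriangle} (ha : a ≠ 0) (hb : b ≠ 0) :
    SameAreas (cosetSeq a) (cosetSeq b) ↔ realNorm a = realNorm b := by
  constructor
  · intro h
    exact realNorm_eq_of_doubledArea ha hb fun j =>
      h j _ (latticeCongruent_refl _) _ (latticeCongruent_refl _)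
  · intro h j T hT T' hT'
    rw [← (LatticeCongruent.related hT).doubledArea_eq,
      ← (LatticeCongruent.related hT').doubledArea_eq]
    exact doubledArea_eq_of_realNorm (by rw [realNorm_mul, realNorm_mul, h])

/-- At a label where both signed areas are positive, the automorphisms ζ ↦ ζ⁵ and ζ ↦ ζ⁷ are
excluded because they change the sign of S; the identity and complex conjugation remain. -/
lemma cosetSeq_eq_iff {a b : LatticeTriangle} (ha : a ≠ 0) (hb : b ≠ 0) :
    cosetSeq a = cosetSeq b ↔
      realNorm a = realNorm b ∧ (Associated a b ∨ Associated (conj a) b) := by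
  refine ⟨fun h => ?_, fun h => cosetSeq_eq_of_associated ha h.1 h.2⟩
  have hn : realNorm a = realNorm b := by
    rw [← sameAreas_cosetSeq_iff ha hb, h, sameAreas_cosetSeq_iff hb hb]
  refine ⟨hn, ?_⟩
  obtain ⟨J, hJ⟩ := exists_signedArea_pos ha hb
  obtain ⟨hJa, hJb⟩ := hJ J le_rfl
  set e := eta ^ J
  have hmem : b * ↑(eta ^ (J : ℤ)) ∈ cosetSeq a J := by
    rw [h]
    exact latticeCongruent_refl _
  obtain ⟨u, hu, hR⟩ := LatticeCongruent.related hmem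
  rw [zpow_natCast] at hR
  rcases hR with hR | hR | hR | hR
  · left
    have : b = u * a := mul_right_cancel₀ e.ne_zero (by rw [hR, mul_assoc])
    rw [this]
    exact (associated_unit_mul_right a u (isUnit_of_realNorm hu))
  · right
    have h1 : Associated b (b * e) := associated_mul_unit_right _ _ e.isUnit
    have h2 : Associated (conj a) (conj a * ↑(conjUnit e)) :=
      associated_mul_unit_right _ _ (conjUnit e).isUnit
    refine h2.trans (Associated.trans ?_ h1.symm)
    rw [hR, map_mul, coe_conjUnit]
    exact associated_unit_mul_right _ _ (isUnit_of_realNorm hu)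
  · exfalso
    have := signedArea_of_realNorm_sigma5 (a := a * e) (b := b * e)
      (by rw [hR, realNorm_mul, hu, one_mul, realNorm_sigma5_eq])
    omega
  · exfalso
    have := signedArea_of_realNorm_sigma5 (a := a * e) (b := b * e)
      (by rw [hR, realNorm_mul, hu, one_mul, realNorm_sigma7_eq, realNorm_eq]; ext <;> simp)
    omega

/-! ### Leading triangles -/

lemma isLeader_of_realNorm {a b : LatticeTriangle} (h : realNorm a = realNorm b)
    (ha : IsLeader a) : IsLeader b := by
  rw [isLeader_iff] at ha ⊢
  intro v
  rw [← doubledArea_eq_of_realNorm h,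
    ← doubledArea_eq_of_realNorm (a := a * v) (b := b * v)
      (by rw [realNorm_mul, realNorm_mul, h])]
  exact ha v

lemma exists_isLeader (a : LatticeTriangle) : ∃ v : LatticeTriangleˣ, IsLeader (a * v) := by
  let f : LatticeTriangleˣ → ℕ := fun v => (a * v).doubledArea.toNat
  refine ⟨Function.argmin f, ?_⟩
  rw [isLeader_iff]
  intro v
  have h := Function.argmin_le f (Function.argmin f * v)
  have h1 : 0 ≤ (a * ↑(Function.argmin f)).doubledArea := abs_nonneg _
  have h2 : 0 ≤ (a * ↑(Function.argmin f) * v).doubledArea := abs_nonneg _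
  simp only [f, Units.val_mul, ← mul_assoc] at h
  simp only [f] at h1 h2 ⊢
  omega

/-- Comparison with the two neighbours, of signed areas 2S ± X, gives 3|S| ≤ X. Leaders of a given
norm thus have boundedly many pairs (X, S), which makes the number of families finite. -/
lemma six_mul_sq_le_of_isLeader {a : LatticeTriangle} (ha : IsLeader a) :
    6 * a.signedArea ^ 2 ≤ normZ a := by
  rw [isLeader_iff] at ha
  have h1 := ha eta
  have h2 := ha eta⁻¹
  rw [doubledArea_eq, doubledArea_eq, signedArea_mul_eta] at h1
  have h3 : (a * ↑eta⁻¹).signedArea = 2 * a.signedArea - a.halfSides := by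
    simp [halfSides, signedArea, eta]; ring
  rw [doubledArea_eq, doubledArea_eq, h3] at h2
  have hx := halfSides_nonneg a
  rcases eq_or_ne a 0 with rfl | h0
  · simp [signedArea]
  have hlt := abs_signedArea_lt h0
  have : 3 * |a.signedArea| ≤ a.halfSides := by
    rcases abs_cases a.signedArea with h | h <;>
    rcases abs_cases (2 * a.signedArea + a.halfSides) with h' | h' <;>
    rcases abs_cases (2 * a.signedArea - a.halfSides) with h'' | h'' <;> omega
  have h4 : (3 * |a.signedArea|) ^ 2 ≤ a.halfSides ^ 2 := by gcongr
  rw [mul_pow, sq_abs] at h4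
  unfold normZ
  linarith

/-! ### Congruence and the relative norm to `ℤ[√-3]` -/

lemma eisNorm_eq (a : LatticeTriangle) : eisNorm a =
    ⟨a.m ^ 2 + a.n ^ 2 - ((a.m - a.k) ^ 2 + (a.n - a.l) ^ 2), 0,
      a.k ^ 2 + a.l ^ 2 - ((a.m - a.k) ^ 2 + (a.n - a.l) ^ 2), 0⟩ := by
  ext <;> simp [eisNorm] <;> ring

lemma two_mul_halfSides (a : LatticeTriangle) : 2 * a.halfSides =
    (a.m - a.k) ^ 2 + (a.n - a.l) ^ 2 + (a.k ^ 2 + a.l ^ 2) + (a.m ^ 2 + a.n ^ 2) := by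
  unfold halfSides; ring

lemma insert_insert_singleton_eq {a b c d e f : ℤ}
    (h : ({a, b, c} : Multiset ℤ) = {d, e, f}) :
    (a = d ∧ b = e ∧ c = f) ∨ (a = d ∧ b = f ∧ c = e) ∨ (a = e ∧ b = d ∧ c = f) ∨
    (a = e ∧ b = f ∧ c = d) ∨ (a = f ∧ b = d ∧ c = e) ∨ (a = f ∧ b = e ∧ c = d) := by
  have pair {a b c d : ℤ} (h : ({a, b} : Multiset ℤ) = {c, d}) :
      (a = c ∧ b = d) ∨ (a = d ∧ b = c) := by
    have ha : a ∈ ({c, d} : Multiset ℤ) := by rw [← h]; simp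
    simp at ha
    rcases ha with rfl | rfl
    · rw [Multiset.insert_eq_cons, Multiset.insert_eq_cons, Multiset.cons_inj_right,
        Multiset.singleton_inj] at h
      exact Or.inl ⟨rfl, h⟩
    · have h' := h.trans (Multiset.pair_comm _ _)
      rw [Multiset.insert_eq_cons, Multiset.insert_eq_cons, Multiset.cons_inj_right,
        Multiset.singleton_inj] at h'
      exact Or.inr ⟨rfl, h'⟩
  have ha : a ∈ ({d, e, f} : Multiset ℤ) := by rw [← h]; simp
  simp only [Multiset.insert_eq_cons] at h
  simp at ha
  rcases ha with rfl | rfl | rfl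
  · rw [Multiset.cons_inj_right] at h
    rcases pair h with h | h <;> simp [h]
  · rw [Multiset.cons_swap d, Multiset.cons_inj_right] at h
    rcases pair h with h | h <;> simp [h]
  · have h' : (a ::ₘ b ::ₘ {c} : Multiset ℤ) = a ::ₘ d ::ₘ {e} := by
      rw [h, Multiset.cons_swap a]
      congr 1
      exact Multiset.pair_comm _ _
    rw [Multiset.cons_inj_right] at h'
    rcases pair h' with h | h <;> simp [h]

lemma associated_of_realNorm_one {a b u : LatticeTriangle} (hu : realNorm u = 1)
    (h : b = a * u) : Associated a b := by
  rw [h]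
  exact associated_mul_unit_right _ _ (isUnit_of_realNorm hu)

/-- A cyclic permutation of the squared sides multiplies the norm to ℤ[√-3] by a cube root of unity;
a transposition involves a conjugation as well. -/
lemma Congruent.associated_eisNorm {a b : LatticeTriangle} (h : a.Congruent b) :
    Associated (eisNorm a) (eisNorm b) ∨ Associated (eisNorm (conj a)) (eisNorm b) := by
  rw [eisNorm_eq a, eisNorm_eq b, eisNorm_eq (conj a)]
  simp only [conj_m, conj_n, conj_k, conj_l, neg_sq,
    show (a.k - a.m) ^ 2 + (-a.l - -a.n) ^ 2 = (a.m - a.k) ^ 2 + (a.n - a.l) ^ 2 by ring]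
  have h' := insert_insert_singleton_eq h
  generalize (a.m - a.k) ^ 2 + (a.n - a.l) ^ 2 = p at *
  generalize a.k ^ 2 + a.l ^ 2 = q at *
  generalize a.m ^ 2 + a.n ^ 2 = r at *
  generalize (b.m - b.k) ^ 2 + (b.n - b.l) ^ 2 = p' at *
  generalize b.k ^ 2 + b.l ^ 2 = q' at *
  generalize b.m ^ 2 + b.n ^ 2 = r' at *
  rcases h' with h | h | h | h | h | h <;> obtain ⟨rfl, rfl, rfl⟩ := h
  · exact Or.inl (associated_of_realNorm_one (u := 1) (by decide) (by ext <;> simp))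
  · exact Or.inr (associated_of_realNorm_one (u := 1) (by decide) (by ext <;> simp))
  · exact Or.inr (associated_of_realNorm_one (u := ⟨0, 0, -1, 0⟩) (by decide)
      (by ext <;> simp))
  · exact Or.inl (associated_of_realNorm_one (u := ⟨0, 0, -1, 0⟩) (by decide)
      (by ext <;> simp))
  · exact Or.inl (associated_of_realNorm_one (u := ⟨-1, 0, 0, 0⟩) (by decide)
      (by ext <;> simp))
  · exact Or.inr (associated_of_realNorm_one (u := ⟨-1, 0, 0, 0⟩) (by decide)
      (by ext <;> simp))

/-- The element `√-3`. -/
def sqrtNegThree : LatticeTriangle := ⟨-1, 0, 1, 0⟩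

/-- Modulo 3, X is (m + k)² + (n + l)², and -1 is not a square modulo 3, so both sums are divisible
by 3. -/
lemma sqrtNegThree_dvd {a : LatticeTriangle} (h : 3 ∣ a.halfSides) : sqrtNegThree ∣ a := by
  unfold halfSides at h
  have key : ∀ m k n l : ZMod 3, m ^ 2 + k ^ 2 - m * k + (n ^ 2 + l ^ 2 - n * l) = 0 →
      m + k = 0 ∧ n + l = 0 := by decide
  replace h := (ZMod.intCast_zmod_eq_zero_iff_dvd _ 3).2 (by exact_mod_cast h)
  push_cast at h
  obtain ⟨h1, h2⟩ := key _ _ _ _ h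
  have h1' : (3 : ℤ) ∣ a.m + a.k :=
    (ZMod.intCast_zmod_eq_zero_iff_dvd _ 3).1 (by push_cast; exact h1)
  have h2' : (3 : ℤ) ∣ a.n + a.l :=
    (ZMod.intCast_zmod_eq_zero_iff_dvd _ 3).1 (by push_cast; exact h2)
  obtain ⟨c, hc⟩ := h1'
  obtain ⟨d, hd⟩ := h2'
  refine ⟨⟨2 * c - a.m, 2 * d - a.n, c - a.m, d - a.n⟩, ?_⟩
  ext <;> simp [sqrtNegThree] <;> linarith

/-- A root of unity in `ℤ[√-3]` relating the norms to `ℤ[√-3]` of two elements with the same norm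
to `ℤ[√3]` is a cube root of unity. -/
lemma eisNorm_ne_neg_mul {a b : LatticeTriangle} (ha : a ≠ 0) (h : realNorm a = realNorm b)
    {u : LatticeTriangle} (hu : u ∈ ({1, ⟨-1, 0, 0, 0⟩, ⟨0, 0, -1, 0⟩} : Set LatticeTriangle)) :
    eisNorm b ≠ -u * eisNorm a := by
  induction hN : (normZ a).toNat using Nat.strong_induction_on generalizing a b with
  | _ N ih =>
  intro he
  have hx := (realNorm_eq_iff.1 h).1
  -- The sums of the squared sides agree while their differences are negated and permuted. Solving
  -- for one squared side forces 3 ∣ X; then √-3 divides both elements, and an infinite descent on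
  -- the norm starts.
  have h3 : 3 ∣ a.halfSides := by
    have ha2 := two_mul_halfSides a
    have hb2 := two_mul_halfSides b
    rw [eisNorm_eq, eisNorm_eq, LatticeTriangle.ext_iff] at he
    simp only [Set.mem_insert_iff, Set.mem_singleton_iff] at hu
    rcases hu with rfl | rfl | rfl <;> simp at he <;> omega
  obtain ⟨a', rfl⟩ := sqrtNegThree_dvd h3
  obtain ⟨b', rfl⟩ := sqrtNegThree_dvd (hx ▸ h3)
  have ha' := right_ne_zero_of_mul ha
  have hs : sqrtNegThree ≠ 0 := left_ne_zero_of_mul ha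
  refine ih _ ?_ ha' (b := b') ?_ rfl ?_
  · rw [← hN, normZ_mul, show normZ sqrtNegThree = 9 by decide]
    have := normZ_pos ha'
    omega
  · rw [realNorm_mul, realNorm_mul] at h
    exact mul_left_cancel₀ (realNorm_ne_zero hs) h
  · rw [eisNorm_mul, eisNorm_mul] at he
    refine mul_left_cancel₀ (eisNorm_ne_zero hs) (he.trans ?_)
    ring

lemma realNorm_eisNorm (a : LatticeTriangle) :
    realNorm (eisNorm a) = (normZ a : LatticeTriangle) := by
  rw [normZ_cast]
  simp [realNorm, eisNorm]
  ring

/-- The connecting unit has relative norm 1 and is fixed by ζ ↦ ζ⁷, hence is one of the six units of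
ℤ[ζ²]. The cube roots of unity permute the sides cyclically, and their negatives are excluded by
`eisNorm_ne_neg_mul`. -/
lemma congruent_of_associated {a b : LatticeTriangle} (ha : a ≠ 0)
    (h : realNorm a = realNorm b) (h' : Associated (eisNorm a) (eisNorm b)) :
    a.Congruent b := by
  obtain ⟨u, hu⟩ := h'
  have hu1 : realNorm (u : LatticeTriangle) = 1 :=
    realNorm_unit_of_eq (eisNorm_ne_zero ha) hu.symm
      (by rw [realNorm_eisNorm, realNorm_eisNorm, normZ_of_realNorm h])
  have hE := eisNorm_ne_zero ha
  have hx := (realNorm_eq_iff.1 h).1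
  have ha2 := two_mul_halfSides a
  have hb2 := two_mul_halfSides b
  have h7 : sigma7 (u : LatticeTriangle) = u := by
    have h1 := congrArg sigma7 hu
    have h2 (c : LatticeTriangle) : sigma7 (eisNorm c) = eisNorm c := by
      simp [eisNorm, mul_comm]
    rw [map_mul, h2, h2, ← hu] at h1
    exact mul_left_cancel₀ hE h1
  have hn : (u : LatticeTriangle).n = 0 := by
    have := congrArg LatticeTriangle.n h7
    simp at this
    omega
  have hl : (u : LatticeTriangle).l = 0 := by
    have := congrArg LatticeTriangle.l h7
    simp at this
    omega
  have hsix : (u : LatticeTriangle) ∈ ([1, ⟨-1, 0, 0, 0⟩, ⟨0, 0, -1, 0⟩, -1, -⟨-1, 0, 0, 0⟩,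
      -⟨0, 0, -1, 0⟩] : List LatticeTriangle) := by
    rw [realNorm_eq_one_iff] at hu1
    obtain ⟨h1, -⟩ := hu1
    generalize (u : LatticeTriangle) = v at *
    obtain ⟨m, n, k, l⟩ := v
    simp only at hn hl
    subst hn hl
    simp only [halfSides] at h1
    have hm : -1 ≤ m ∧ m ≤ 1 := by
      constructor <;> nlinarith [sq_nonneg (2 * k - m)]
    have hk : -1 ≤ k ∧ k ≤ 1 := by
      constructor <;> nlinarith [sq_nonneg (2 * m - k)]
    obtain ⟨hm1, hm2⟩ := hm
    obtain ⟨hk1, hk2⟩ := hk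
    interval_cases m <;> interval_cases k <;> revert h1 <;> decide
  simp only [List.mem_cons, List.not_mem_nil, or_false] at hsix
  rw [mul_comm] at hu
  unfold Congruent squaredSides
  have key {p q r p' q' r' : ℤ} (h : (p = p' ∧ q = q' ∧ r = r') ∨ (p = q' ∧ q = r' ∧ r = p') ∨
      (p = r' ∧ q = p' ∧ r = q')) : ({p, q, r} : Multiset ℤ) = {p', q', r'} := by
    rcases h with ⟨rfl, rfl, rfl⟩ | ⟨rfl, rfl, rfl⟩ | ⟨rfl, rfl, rfl⟩
    · rfl
    · simp only [Multiset.insert_eq_cons]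
      rw [Multiset.cons_swap r p]
      congr 1
      exact Multiset.pair_comm _ _
    · simp only [Multiset.insert_eq_cons]
      rw [Multiset.cons_swap p q]
      congr 1
      exact Multiset.pair_comm _ _
  rcases hsix with h6 | h6 | h6 | h6 | h6 | h6
  · rw [h6, eisNorm_eq, eisNorm_eq, LatticeTriangle.ext_iff] at hu
    simp at hu
    exact key (by omega)
  · rw [h6, eisNorm_eq, eisNorm_eq, LatticeTriangle.ext_iff] at hu
    simp at hu
    exact key (by omega)
  · rw [h6, eisNorm_eq, eisNorm_eq, LatticeTriangle.ext_iff] at hu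
    simp at hu
    exact key (by omega)
  · exact absurd (by rw [← hu, h6]) (eisNorm_ne_neg_mul ha h (u := 1) (by simp))
  · exact absurd (by rw [← hu, h6]) (eisNorm_ne_neg_mul ha h (u := ⟨-1, 0, 0, 0⟩) (by simp))
  · exact absurd (by rw [← hu, h6]) (eisNorm_ne_neg_mul ha h (u := ⟨0, 0, -1, 0⟩) (by simp))

lemma congruent_iff {a b : LatticeTriangle} (ha : a ≠ 0) (h : realNorm a = realNorm b) :
    a.Congruent b ↔
      Associated (eisNorm a) (eisNorm b) ∨ Associated (eisNorm (conj a)) (eisNorm b) := by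
  refine ⟨Congruent.associated_eisNorm, fun h' => ?_⟩
  rcases h' with h' | h'
  · exact congruent_of_associated ha h h'
  · have := congruent_of_associated (conj_ne_zero ha) (by rwa [realNorm_conj]) h'
    unfold Congruent at *
    rwa [squaredSides_conj] at this

lemma mem_cosetSeq_zero (a : LatticeTriangle) : a ∈ cosetSeq a 0 := by
  simp only [cosetSeq, Set.mem_ofPred_eq]
  have h : a * ↑(eta ^ (0 : ℤ)) = a := by rw [zpow_zero, Units.val_one, mul_one]
  rw [h]
  exact latticeCongruent_refl a

/-- `a` and `b` have the same norm to `ℤ[√3]`, and all their triangles are congruent. -/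
lemma sameTriangles_cosetSeq_iff {a b : LatticeTriangle} (ha : a ≠ 0)
    (h : realNorm a = realNorm b) :
    SameTriangles (cosetSeq a) (cosetSeq b) ↔
      Associated (eisNorm a) (eisNorm b) ∨ Associated (eisNorm (conj a)) (eisNorm b) := by
  constructor
  · intro h'
    rw [← congruent_iff ha h]
    exact h' 0 a (mem_cosetSeq_zero a) b (mem_cosetSeq_zero b)
  · intro h' j T hT T' hT'
    unfold Congruent
    rw [← (LatticeCongruent.related hT).squaredSides_eq,
      ← (LatticeCongruent.related hT').squaredSides_eq]
    refine (congruent_iff (mul_unit_ne_zero ha _) (by rw [realNorm_mul, realNorm_mul, h])).2 ?_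
    have hu : IsUnit (eisNorm ((eta ^ j : LatticeTriangleˣ) : LatticeTriangle)) :=
      (eta ^ j).isUnit.mul ((eta ^ j).isUnit.map sigma7)
    have hu' : IsUnit (eisNorm (conj ((eta ^ j : LatticeTriangleˣ) : LatticeTriangle))) :=
      ((eta ^ j).isUnit.map conj).mul (((eta ^ j).isUnit.map conj).map sigma7)
    rw [map_mul, eisNorm_mul, eisNorm_mul, eisNorm_mul]
    refine h'.imp (fun h1 => ?_) (fun h1 => ?_)
    · exact h1.mul_right _
    · exact (associated_mul_unit_right _ _ hu').symm.trans
        (h1.trans (associated_mul_unit_right _ _ hu))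

/-! ### Primes of `ℤ[ζ]` over rational primes -/

/-- The norm as a natural number. -/
def normN (a : LatticeTriangle) : ℕ := (normZ a).natAbs

lemma coe_normN (a : LatticeTriangle) : (normN a : ℤ) = normZ a :=
  Int.natAbs_of_nonneg (normZ_nonneg a)

lemma normN_mul (a b : LatticeTriangle) : normN (a * b) = normN a * normN b := by
  rw [normN, normZ_mul, Int.natAbs_mul]; rfl

@[simp] lemma normN_one : normN 1 = 1 := by simp [normN]

lemma normN_natCast (c : ℕ) : normN (c : LatticeTriangle) = c ^ 4 := by
  simp [normN, normZ_natCast, Int.natAbs_pow]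

lemma normN_ne_zero {a : LatticeTriangle} (ha : a ≠ 0) : normN a ≠ 0 := by
  have := normZ_pos ha
  unfold normN
  omega

lemma normN_dvd {a b : LatticeTriangle} (h : a ∣ b) : normN a ∣ normN b :=
  Int.natAbs_dvd_natAbs.2 (normZ_dvd h)

lemma isUnit_iff_normN {a : LatticeTriangle} : IsUnit a ↔ normN a = 1 := by
  rw [isUnit_iff_normZ, ← coe_normN]
  norm_cast

lemma natCast_normN (a : LatticeTriangle) :
    (normN a : LatticeTriangle) = a * conj a * (sigma5 a * sigma7 a) := by
  rw [← normZ_cast, ← coe_normN, Int.cast_natCast]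

lemma dvd_normN (a : LatticeTriangle) : a ∣ (normN a : LatticeTriangle) := by
  rw [natCast_normN, mul_assoc]
  exact dvd_mul_right _ _

lemma normN_sigma5 (a : LatticeTriangle) : normN (sigma5 a) = normN a := by simp [normN]
lemma normN_sigma7 (a : LatticeTriangle) : normN (sigma7 a) = normN a := by simp [normN]

lemma associated_of_dvd_of_normN {a b : LatticeTriangle} (hb : b ≠ 0) (h : a ∣ b)
    (hn : normN a = normN b) : Associated a b :=
  associated_of_dvd_of_normZ hb h (by rw [← coe_normN, ← coe_normN, hn])

lemma natCast_dvd_natCast {c d : ℕ} : (c : LatticeTriangle) ∣ d ↔ c ∣ d := by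
  have := intCast_dvd_intCast (c := c) (d := d)
  rw [Int.natCast_dvd_natCast] at this
  rw [← this]
  simp

lemma natCast_ne_zero {c : ℕ} (hc : c ≠ 0) : (c : LatticeTriangle) ≠ 0 := by
  intro h
  have := congrArg LatticeTriangle.m h
  simp at this
  exact hc this

lemma exists_prime_dvd_natCast {l : ℕ} (hl : l.Prime) :
    ∃ π : LatticeTriangle, Prime π ∧ π ∣ (l : LatticeTriangle) := by
  obtain ⟨π, h1, h2⟩ := WfDvdMonoid.exists_irreducible_factor (a := (l : LatticeTriangle))
    (by
      rw [isUnit_iff_normN, normN_natCast]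
      exact (Nat.one_lt_pow (by norm_num) hl.one_lt).ne')
    (natCast_ne_zero hl.ne_zero)
  exact ⟨π, h1.prime, h2⟩

lemma exists_natPrime_of_prime {π : LatticeTriangle} (hπ : Prime π) :
    ∃ l : ℕ, l.Prime ∧ π ∣ (l : LatticeTriangle) := by
  have h := dvd_normN π
  rw [← Nat.prod_primeFactorsList (normN_ne_zero hπ.ne_zero), Nat.cast_list_prod,
    hπ.dvd_prod_iff] at h
  obtain ⟨a, ha, h⟩ := h
  rw [List.mem_map] at ha
  obtain ⟨l, hl, rfl⟩ := ha
  exact ⟨l, Nat.prime_of_mem_primeFactorsList hl, h⟩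

lemma associated_of_prime_dvd {π π' : LatticeTriangle} (h : Prime π) (h' : Prime π')
    (hd : π ∣ π') : Associated π π' :=
  h.associated_of_dvd h' hd

lemma prime_map (σ : LatticeTriangle ≃+* LatticeTriangle) {π : LatticeTriangle}
    (h : Prime π) : Prime (σ π) :=
  (MulEquiv.prime_iff (σ : LatticeTriangle ≃* LatticeTriangle)).2 h

lemma map_dvd_natCast (σ : LatticeTriangle ≃+* LatticeTriangle) {π : LatticeTriangle} {l : ℕ}
    (h : π ∣ (l : LatticeTriangle)) : σ π ∣ (l : LatticeTriangle) := by
  simpa using map_dvd σ h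

/-! ### Splitting of a rational prime in a quadratic subfield -/

section quadratic

variable {l : ℕ} {c d : ℤ} {δ π : LatticeTriangle}

/-- The prime π divides (c - δ)(c + δ). If it were stable under an automorphism negating δ, it would
divide both factors, hence 2c, which is coprime to l. -/
lemma not_associated_of_neg (hl : l.Prime) (hδ : δ ^ 2 = (d : LatticeTriangle))
    (hc : (l : ℤ) ∣ c ^ 2 - d) (hlc : ¬ (l : ℤ) ∣ 2 * c) (hπ : Prime π)
    (hπl : π ∣ (l : LatticeTriangle)) (τ : LatticeTriangle ≃+* LatticeTriangle)
    (hτ : τ δ = -δ) : ¬ Associated (τ π) π := by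
  intro has
  have h1 : π ∣ ((c : LatticeTriangle) - δ) * (c + δ) := by
    have : ((c : LatticeTriangle) - δ) * (c + δ) = ((c ^ 2 - d : ℤ) : LatticeTriangle) := by
      push_cast; rw [← hδ]; ring
    rw [this]
    refine hπl.trans ?_
    rw [← Int.cast_natCast, intCast_dvd_intCast]
    exact hc
  have h2 : π ∣ (c : LatticeTriangle) - δ ∧ π ∣ (c : LatticeTriangle) + δ := by
    rcases hπ.dvd_or_dvd h1 with h | h
    · refine ⟨h, has.symm.dvd.trans ?_⟩
      simpa [hτ] using map_dvd τ h
    · refine ⟨has.symm.dvd.trans ?_, h⟩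
      simpa [hτ, sub_eq_add_neg] using map_dvd τ h
  have h3 : π ∣ ((2 * c : ℤ) : LatticeTriangle) := by
    have := dvd_add h2.1 h2.2
    have he : ((2 * c : ℤ) : LatticeTriangle) = (c : LatticeTriangle) - δ + (c + δ) := by
      push_cast; ring
    rwa [he]
  have hcop : IsCoprime (l : ℤ) (2 * c) :=
    (Nat.prime_iff_prime_int.1 hl).coprime_iff_not_dvd.2 hlc
  obtain ⟨x, y, hxy⟩ := hcop
  refine hπ.not_isUnit (isUnit_of_dvd_one ?_)
  have he : (1 : LatticeTriangle) =
      (x : LatticeTriangle) * (l : LatticeTriangle) + y * ((2 * c : ℤ) : LatticeTriangle) := by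
    have := congrArg (Int.cast : ℤ → LatticeTriangle) hxy
    push_cast at this ⊢
    exact this.symm
  rw [he]
  exact dvd_add (hπl.mul_left _) (h3.mul_left _)

/-- As π and τπ are not associated, their product divides l, so N(π)² divides l⁴. If N(π) = l², then
l is associated to π · τπ, and σπ divides it; σπ cannot be associated to τπ, since applying τ would
make π stable under τ'. -/
lemma normN_eq_or_of_quadratic (hl : l.Prime) (hδ : δ ^ 2 = (d : LatticeTriangle))
    (hc : (l : ℤ) ∣ c ^ 2 - d) (hlc : ¬ (l : ℤ) ∣ 2 * c) (hπ : Prime π)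
    (hπl : π ∣ (l : LatticeTriangle)) (σ τ τ' : LatticeTriangle ≃+* LatticeTriangle)
    (hτ : τ δ = -δ) (hτ' : τ' δ = -δ) (hττ : ∀ a, τ (τ a) = a) (hτσ : ∀ a, τ (σ a) = τ' a)
    (hτn : ∀ a, normN (τ a) = normN a) :
    normN π = l ∨ (normN π = l ^ 2 ∧ Associated (σ π) π) := by
  have h1 := not_associated_of_neg hl hδ hc hlc hπ hπl τ hτ
  have h2 := not_associated_of_neg hl hδ hc hlc hπ hπl τ' hτ'
  have hπτ := prime_map τ hπ
  have hl0 := natCast_ne_zero hl.ne_zero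
  have hmul : π * τ π ∣ (l : LatticeTriangle) := by
    obtain ⟨e, he⟩ := hπl
    rw [he]
    refine mul_dvd_mul_left π ?_
    have := map_dvd_natCast τ ⟨e, he⟩
    rw [he] at this
    exact (hπτ.dvd_or_dvd this).resolve_left
      fun h => h1 (associated_of_prime_dvd hπτ hπ h)
  have hn := normN_dvd hmul
  rw [normN_mul, hτn, normN_natCast, ← pow_two, show l ^ 4 = (l ^ 2) ^ 2 by ring,
    Nat.pow_dvd_pow_iff (by norm_num), Nat.dvd_prime_pow hl] at hn
  obtain ⟨i, hi, hn⟩ := hn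
  interval_cases i
  · exact absurd (isUnit_iff_normN.2 (by simpa using hn)) hπ.not_isUnit
  · left; simpa using hn
  · right
    refine ⟨hn, ?_⟩
    have has : Associated (π * τ π) l := associated_of_dvd_of_normN hl0 hmul
      (by rw [normN_mul, hτn, hn, normN_natCast]; ring)
    have hσ := prime_map σ hπ
    have h3 := (map_dvd_natCast σ hπl).trans has.symm.dvd
    rcases hσ.dvd_or_dvd h3 with h | h
    · exact associated_of_prime_dvd hσ hπ h
    · exfalso
      have h4 := (associated_of_prime_dvd hσ hπτ h).map (τ : LatticeTriangle →* LatticeTriangle)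
      simp only [MonoidHom.coe_coe, hτσ, hττ] at h4
      exact h2 h4

end quadratic

/-- The norm is X² - 3S². With the analogue modulo 4 this excludes the norm l for primes l ≡ 5, 7,
11 modulo 12, and also for l = 2, 3. -/
lemma normN_mod_three {a : LatticeTriangle} : normN a % 3 ≠ 2 := by
  have h := coe_normN a
  unfold normZ at h
  have key : ∀ x : ZMod 3, x ^ 2 ≠ 2 := by decide
  intro h3
  apply key (a.halfSides : ZMod 3)
  have h5 := congrArg (Int.cast : ℤ → ZMod 3) h
  push_cast at h5
  have h6 : (normN a : ZMod 3) = 2 := by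
    rw [← Nat.mod_add_div (normN a) 3, h3]
    push_cast
    rw [show (3 : ZMod 3) = 0 by decide]
    ring
  rw [h6, show (3 : ZMod 3) = 0 by decide] at h5
  linear_combination -h5

lemma normN_mod_four {a : LatticeTriangle} : normN a % 4 ≠ 3 := by
  have h := coe_normN a
  rw [normZ_eq_sq_add_sq] at h
  have key : ∀ x y : ZMod 4, x ^ 2 + y ^ 2 ≠ 3 := by decide
  intro h3
  have h5 := congrArg (Int.cast : ℤ → ZMod 4) h
  have h6 : (normN a : ZMod 4) = 3 := by
    rw [← Nat.mod_add_div (normN a) 4, h3]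
    push_cast
    rw [show (4 : ZMod 4) = 0 by decide]
    ring
  rw [Int.cast_natCast, h6, Int.cast_add, Int.cast_pow, Int.cast_pow] at h5
  exact key _ _ h5.symm

lemma exists_sq_sub {l : ℕ} (hl : l.Prime) (h2 : l ≠ 2) {d : ℤ}
    (hd : ¬ (l : ℤ) ∣ d) (h : IsSquare (d : ZMod l)) :
    ∃ c : ℤ, (l : ℤ) ∣ c ^ 2 - d ∧ ¬ (l : ℤ) ∣ 2 * c := by
  obtain ⟨x, hx⟩ := h
  obtain ⟨c, rfl⟩ := ZMod.intCast_surjective x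
  have hc : (l : ℤ) ∣ c ^ 2 - d := by
    rw [← ZMod.intCast_zmod_eq_zero_iff_dvd]
    push_cast
    rw [hx]
    ring
  refine ⟨c, hc, fun h' => ?_⟩
  have hp := Nat.prime_iff_prime_int.1 hl
  rcases hp.dvd_or_dvd h' with h' | h'
  · have h'' : l ∣ 2 := by exact_mod_cast h'
    exact h2 ((Nat.prime_dvd_prime_iff_eq hl Nat.prime_two).1 h'')
  · refine hd ?_
    have := dvd_sub (dvd_pow h' two_ne_zero) hc
    simpa using this

/-- The element `i`. -/
def imag : LatticeTriangle := ⟨0, 1, 0, 1⟩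
/-- The element `√3`. -/
def sqrtThree : LatticeTriangle := ⟨0, 1, 0, -1⟩

/-! ### Decomposition of rational primes according to their class modulo 12 -/

section classes

variable {l : ℕ} {π : LatticeTriangle}

lemma isSquare_one_zmod_three : IsSquare ((1 : ℕ) : ZMod 3) := by decide

lemma not_isSquare_two_zmod_three : ¬ IsSquare ((2 : ℕ) : ZMod 3) := by decide

lemma isSquare_three_of_mod {l : ℕ} [Fact l.Prime] (h : l % 12 = 1 ∨ l % 12 = 11) :
    IsSquare ((3 : ℤ) : ZMod l) := by
  have : Fact (Nat.Prime 3) := ⟨Nat.prime_three⟩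
  have h0 : (((3 : ℤ) : ZMod l)) = ((3 : ℕ) : ZMod l) := by push_cast; rfl
  rw [h0]
  have hl3 : (l : ZMod 3) = ((l % 3 : ℕ) : ZMod 3) := (ZMod.natCast_mod l 3).symm
  rcases h with h | h
  · rw [ZMod.exists_sq_eq_prime_iff_of_mod_four_eq_one (p := l) (q := 3) (by omega)
      (by norm_num), hl3, show l % 3 = 1 by omega]
    exact isSquare_one_zmod_three
  · rw [ZMod.exists_sq_eq_prime_iff_of_mod_four_eq_three (p := l) (q := 3) (by omega) (by norm_num)
      (by rintro rfl; omega), hl3, show l % 3 = 2 by omega]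
    exact not_isSquare_two_zmod_three

lemma isSquare_neg_three_of_mod {l : ℕ} [Fact l.Prime] (h : l % 12 = 7) :
    IsSquare ((-3 : ℤ) : ZMod l) := by
  have : Fact (Nat.Prime 3) := ⟨Nat.prime_three⟩
  have h3 : ¬ IsSquare ((3 : ℕ) : ZMod l) := by
    rw [ZMod.exists_sq_eq_prime_iff_of_mod_four_eq_three (p := l) (q := 3) (by omega) (by norm_num)
      (by rintro rfl; omega), ← ZMod.natCast_mod l 3, show l % 3 = 1 by omega, not_not]
    exact isSquare_one_zmod_three
  have h1 : ¬ IsSquare (-1 : ZMod l) := by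
    rw [ZMod.exists_sq_eq_neg_one_iff]
    omega
  have hne : ((3 : ℕ) : ZMod l) ≠ 0 := fun h => h3 (h ▸ ⟨0, by simp⟩)
  have hne' : (((-3 : ℤ)) : ZMod l) ≠ 0 := by
    push_cast at hne ⊢
    exact neg_ne_zero.2 hne
  rw [← legendreSym.eq_one_iff l hne', show (-3 : ℤ) = -1 * 3 by norm_num, legendreSym.mul,
    (legendreSym.eq_neg_one_iff l).2 (by simpa using h1),
    (legendreSym.eq_neg_one_iff l).2 (by simpa using h3)]
  norm_num

/-- Each class is governed by the quadratic subfield where l splits: ℚ(i) for 5, ℚ(√-3) for 7, ℚ(√3)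
for 11, and both ℚ(i) and ℚ(√3) for 1. -/
lemma prime_class_split (hl : l.Prime) (hπ : Prime π) (hπl : π ∣ (l : LatticeTriangle)) :
    (l % 12 = 1 → normN π = l ∧ ¬ Associated (conj π) π ∧ ¬ Associated (sigma5 π) π) ∧
    (l % 12 = 5 → normN π = l ^ 2 ∧ ¬ Associated (conj π) π ∧ Associated (sigma5 π) π) ∧
    (l % 12 = 7 → normN π = l ^ 2 ∧ ¬ Associated (conj π) π ∧ ¬ Associated (sigma5 π) π) ∧
    (l % 12 = 11 → normN π = l ^ 2 ∧ Associated (conj π) π) := by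
  have : Fact l.Prime := ⟨hl⟩
  have hne (h : l % 12 ≠ 1) (h2 : l % 12 = 5 ∨ l % 12 = 7 ∨ l % 12 = 11) : normN π ≠ l := by
    intro h'
    have h3 := normN_mod_three (a := π)
    have h4 := normN_mod_four (a := π)
    omega
  have hl2 (h : l % 12 = 1 ∨ l % 12 = 5 ∨ l % 12 = 7 ∨ l % 12 = 11) : l ≠ 2 := by
    rintro rfl; omega
  have hl3 (h : l % 12 = 1 ∨ l % 12 = 5 ∨ l % 12 = 7 ∨ l % 12 = 11) : ¬ (l : ℤ) ∣ 3 := by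
    intro h'
    have h'' : l ∣ 3 := by exact_mod_cast h'
    rw [Nat.prime_dvd_prime_iff_eq hl Nat.prime_three] at h''
    omega
  have hl1 : ¬ (l : ℤ) ∣ -1 := by
    intro h'
    rw [dvd_neg] at h'
    have h'' : l ∣ 1 := by exact_mod_cast h'
    exact hl.one_lt.ne' (Nat.dvd_one.1 h'')
  refine ⟨fun h => ?_, fun h => ?_, fun h => ?_, fun h => ?_⟩
  · obtain ⟨c, hc, hlc⟩ := exists_sq_sub hl (hl2 (by omega)) hl1 (by
      push_cast; rw [ZMod.exists_sq_eq_neg_one_iff]; omega)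
    have hδ : imag ^ 2 = ((-1 : ℤ) : LatticeTriangle) := by decide
    obtain ⟨c', hc', hlc'⟩ := exists_sq_sub hl (hl2 (by omega)) (hl3 (by omega))
      (isSquare_three_of_mod (by omega))
    have hδ' : sqrtThree ^ 2 = ((3 : ℤ) : LatticeTriangle) := by decide
    have h1 := not_associated_of_neg hl hδ hc hlc hπ hπl conj (by decide)
    have h2 := not_associated_of_neg hl hδ' hc' hlc' hπ hπl sigma5 (by decide)
    refine ⟨?_, h1, h2⟩
    exact (normN_eq_or_of_quadratic hl hδ hc hlc hπ hπl sigma5 sigma7 conj (by decide) (by decide)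
      sigma7_sigma7 sigma7_sigma5 normN_sigma7).resolve_right fun h' => h2 h'.2
  · obtain ⟨c, hc, hlc⟩ := exists_sq_sub hl (hl2 (by omega)) hl1 (by
      push_cast; rw [ZMod.exists_sq_eq_neg_one_iff]; omega)
    have hδ : imag ^ 2 = ((-1 : ℤ) : LatticeTriangle) := by decide
    obtain ⟨h1, h2⟩ := (normN_eq_or_of_quadratic hl hδ hc hlc hπ hπl sigma5 sigma7 conj (by decide)
      (by decide) sigma7_sigma7 sigma7_sigma5 normN_sigma7).resolve_left (hne (by omega) (by omega))
    exact ⟨h1, not_associated_of_neg hl hδ hc hlc hπ hπl conj (by decide), h2⟩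
  · obtain ⟨c, hc, hlc⟩ := exists_sq_sub hl (hl2 (by omega))
      (by rw [dvd_neg]; exact hl3 (by omega)) (isSquare_neg_three_of_mod h)
    have hδ : sqrtNegThree ^ 2 = ((-3 : ℤ) : LatticeTriangle) := by decide
    obtain ⟨h1, -⟩ := (normN_eq_or_of_quadratic hl hδ hc hlc hπ hπl sigma7 sigma5 conj (by decide)
      (by decide) sigma5_sigma5 sigma5_sigma7 normN_sigma5).resolve_left (hne (by omega) (by omega))
    exact ⟨h1, not_associated_of_neg hl hδ hc hlc hπ hπl conj (by decide),
      not_associated_of_neg hl hδ hc hlc hπ hπl sigma5 (by decide)⟩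
  · obtain ⟨c, hc, hlc⟩ := exists_sq_sub hl (hl2 (by omega)) (hl3 (by omega))
      (isSquare_three_of_mod (by omega))
    have hδ : sqrtThree ^ 2 = ((3 : ℤ) : LatticeTriangle) := by decide
    exact (normN_eq_or_of_quadratic hl hδ hc hlc hπ hπl conj sigma5 sigma7 (by decide)
      (by decide) sigma5_sigma5 sigma5_conj normN_sigma5).resolve_left (hne (by omega) (by omega))

lemma prime_class_ramified (hl : l.Prime) (hπ : Prime π) (hπl : π ∣ (l : LatticeTriangle))
    (h : l = 2 ∨ l = 3) : normN π = l ^ 2 ∧ Associated (conj π) π := by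
  have hb : ∃ b v w : LatticeTriangle, (l : LatticeTriangle) = b ^ 2 * v ∧ normN b = l ^ 2 ∧
      conj b = b * w ∧ IsUnit w ∧ IsUnit v := by
    rcases h with rfl | rfl
    -- Here 2 = (1 + i)² · (-i), and below 3 = -(√-3)².
    · exact ⟨⟨1, 1, 1, 1⟩, -imag, -imag, by decide, by decide, by decide,
        isUnit_iff_normZ.2 (by decide), isUnit_iff_normZ.2 (by decide)⟩
    · exact ⟨sqrtNegThree, -1, -1, by decide, by decide, by decide,
        isUnit_iff_normZ.2 (by decide), isUnit_iff_normZ.2 (by decide)⟩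
  obtain ⟨b, v, w, h1, h2, h3, hw, hv⟩ := hb
  have hb0 : b ≠ 0 := by
    rintro rfl
    simp [normN] at h2
    exact pow_ne_zero 2 hl.ne_zero h2.symm
  rw [h1, hv.dvd_mul_right] at hπl
  have hπb := hπ.dvd_of_dvd_pow hπl
  have hn := normN_dvd hπb
  rw [h2, Nat.dvd_prime_pow hl] at hn
  obtain ⟨i, hi, hn⟩ := hn
  have h4 := normN_mod_three (a := π)
  have h5 := normN_mod_four (a := π)
  have hn2 : normN π = l ^ 2 := by
    interval_cases i
    · exact absurd (isUnit_iff_normN.2 (by simpa using hn)) hπ.not_isUnit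
    · rcases h with rfl | rfl <;> simp [hn] at h4 h5
    · exact hn
  refine ⟨hn2, ?_⟩
  have has := associated_of_dvd_of_normN hb0 hπb (hn2.trans h2.symm)
  have hc := has.map (conj : LatticeTriangle →* LatticeTriangle)
  simp only [MonoidHom.coe_coe, h3] at hc
  exact hc.trans ((associated_mul_unit_right b w hw).symm.trans has.symm)

end classes

/-! ### Elements with a given norm to `ℤ[√3]` -/

/-- All prime factors of `γ` are associated to their complex conjugates. -/
def SelfConj (γ : LatticeTriangle) : Prop :=
  ∀ π, Prime π → π ∣ γ → Associated (conj π) π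

/-- A multiset of primes that are not associated to their complex conjugates, such that no two
different members are associated up to complex conjugation. -/
structure Reduced (L : Multiset LatticeTriangle) : Prop where
  prime : ∀ t ∈ L, Prime t
  split : ∀ t ∈ L, ¬ Associated (conj t) t
  inj : ∀ t ∈ L, ∀ t' ∈ L, (Associated t t' ∨ Associated (conj t) t') → t = t'

/-- The element obtained from `γ * (f + g).prod` by conjugating the factors in `g`. -/
def combine (γ : LatticeTriangle) (f g : Multiset LatticeTriangle) : LatticeTriangle :=
  γ * f.prod * (g.map conj).prod

lemma prod_map_conj (g : Multiset LatticeTriangle) : (g.map conj).prod = conj g.prod :=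
  (map_multiset_prod conj g).symm

lemma realNorm_combine (γ : LatticeTriangle) (f g : Multiset LatticeTriangle) :
    realNorm (combine γ f g) = realNorm (γ * (f + g).prod) := by
  rw [combine, prod_map_conj, realNorm_mul, realNorm_conj, ← realNorm_mul, Multiset.prod_add,
    mul_assoc]

lemma dvd_or_dvd_of_dvd_realNorm {t b : LatticeTriangle} (ht : Prime t)
    (h : t ∣ realNorm b) : t ∣ b ∨ conj t ∣ b := by
  refine (ht.dvd_or_dvd h).imp_right fun h' => ?_
  simpa using map_dvd conj h'

lemma SelfConj.of_mul_left {a b : LatticeTriangle} (h : SelfConj (a * b)) : SelfConj b :=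
  fun π hπ hd => h π hπ (hd.mul_left a)

lemma associated_map_conj {a b : LatticeTriangle} (h : Associated a b) :
    Associated (conj a) (conj b) := h.map (conj : LatticeTriangle →* LatticeTriangle)

/-- A prime factor of γ divides b or its conjugate, hence b because it is self-conjugate; it is
cancelled on both sides, and induction applies. -/
lemma SelfConj.associated_of_realNorm {γ : LatticeTriangle} (hγ : SelfConj γ) (h0 : γ ≠ 0)
    {b : LatticeTriangle} (h : realNorm b = realNorm γ) : Associated b γ := by
  induction γ using UniqueFactorizationMonoid.induction_on_prime generalizing b with
  | h₁ => exact absurd rfl h0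
  | h₂ x hx =>
    refine associated_of_dvd_dvd ?_ ((isUnit_iff_dvd_one.1 hx).trans (one_dvd _))
    refine (dvd_mul_right b (conj b)).trans ?_
    rw [show b * conj b = realNorm b from rfl, h]
    exact (isUnit_iff_dvd_one.1 (hx.mul (hx.map conj))).trans (one_dvd _)
  | h₃ a p ha hp ih =>
    have hpb : p ∣ b := by
      have hd : p ∣ realNorm b := by
        rw [h]; exact (dvd_mul_right p a).trans (dvd_mul_right _ _)
      exact (dvd_or_dvd_of_dvd_realNorm hp hd).elim id
        fun h' => (hγ p hp (dvd_mul_right p a)).symm.dvd.trans h'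
    obtain ⟨c, rfl⟩ := hpb
    rw [realNorm_mul, realNorm_mul] at h
    exact (ih hγ.of_mul_left ha (mul_left_cancel₀ (realNorm_ne_zero hp.ne_zero) h)).mul_left p

lemma SelfConj.associated_conj {γ : LatticeTriangle} (hγ : SelfConj γ) (h0 : γ ≠ 0) :
    Associated (conj γ) γ := hγ.associated_of_realNorm h0 (realNorm_conj γ)

/-- Every t in L, or its conjugate, divides b. Splitting it off sorts the members of L into f and g,
one at a time. -/
lemma exists_combine {γ : LatticeTriangle} (hγ : SelfConj γ) (h0 : γ ≠ 0)
    (L : Multiset LatticeTriangle) (hL : ∀ t ∈ L, Prime t) {b : LatticeTriangle}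
    (h : realNorm b = realNorm (γ * L.prod)) :
    ∃ f g, f + g = L ∧ Associated b (combine γ f g) := by
  induction L using Multiset.induction_on generalizing b with
  | empty =>
    refine ⟨0, 0, rfl, ?_⟩
    simpa [combine] using hγ.associated_of_realNorm h0 (by simpa using h)
  | cons t L ih =>
    have ht := hL t (Multiset.mem_cons_self t L)
    have hL' : ∀ t ∈ L, Prime t := fun s hs => hL s (Multiset.mem_cons_of_mem hs)
    rw [Multiset.prod_cons] at h
    have hd : t ∣ realNorm b := by
      rw [h, realNorm_mul, realNorm_mul]
      exact ((dvd_mul_right t (conj t)).mul_right _).mul_left _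
    have hn := realNorm_ne_zero ht.ne_zero
    rcases dvd_or_dvd_of_dvd_realNorm ht hd with ⟨c, rfl⟩ | ⟨c, rfl⟩
    · obtain ⟨f, g, rfl, hfg⟩ := ih hL' (b := c) (mul_left_cancel₀ hn (by
        rw [← realNorm_mul, h, realNorm_mul, realNorm_mul, realNorm_mul]; ring))
      refine ⟨t ::ₘ f, g, by simp, (hfg.mul_left t).trans ?_⟩
      rw [combine, combine, Multiset.prod_cons]
      exact Associated.of_eq (by ring)
    · obtain ⟨f, g, rfl, hfg⟩ := ih hL' (b := c) (mul_left_cancel₀ hn (by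
        rw [← realNorm_conj t, ← realNorm_mul, h, realNorm_mul, realNorm_mul, realNorm_mul,
          realNorm_conj]; ring))
      refine ⟨f, t ::ₘ g, by simp, (hfg.mul_left (conj t)).trans ?_⟩
      rw [combine, combine, Multiset.map_cons, Multiset.prod_cons]
      exact Associated.of_eq (by ring)

open Classical in
-- No conjugate of a member of L is associated to a member of L, so counting the associates of t
-- recovers its multiplicity in f.
lemma Reduced.countP_associated {L f g : Multiset LatticeTriangle} (hL : Reduced L)
    (hfg : f + g = L) {t : LatticeTriangle} (ht : t ∈ L) :
    (f + g.map conj).countP (Associated t) = f.count t := by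
  have hf : ∀ x ∈ f, x ∈ L := fun x hx => hfg ▸ Multiset.mem_add.2 (Or.inl hx)
  have hg : ∀ x ∈ g, x ∈ L := fun x hx => hfg ▸ Multiset.mem_add.2 (Or.inr hx)
  have h1 : (g.map conj).countP (Associated t) = 0 := by
    rw [Multiset.countP_eq_zero]
    intro y hy hty
    obtain ⟨x, hx, rfl⟩ := Multiset.mem_map.1 hy
    have hxt := hL.inj x (hg x hx) t ht (Or.inr hty.symm)
    subst hxt
    exact hL.split x ht hty.symm
  rw [Multiset.countP_add, h1, add_zero, Multiset.count]
  refine Multiset.countP_congr rfl fun x hx => ?_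
  exact propext ⟨fun h => hL.inj t ht x (hf x hx) (Or.inl h), fun h => h ▸ Associated.refl _⟩

lemma Reduced.eq_of_associated_combine {L f g f' g' : Multiset LatticeTriangle} (hL : Reduced L)
    {γ : LatticeTriangle} (h0 : γ ≠ 0) (hfg : f + g = L) (hfg' : f' + g' = L)
    (h : Associated (combine γ f g) (combine γ f' g')) : f = f' := by
  classical
  have hprime (f g : Multiset LatticeTriangle) (hfg : f + g = L) :
      ∀ x ∈ f + g.map conj, Prime x := by
    intro x hx
    rcases Multiset.mem_add.1 hx with hx | hx
    · exact hL.prime x (hfg ▸ Multiset.mem_add.2 (Or.inl hx))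
    · obtain ⟨y, hy, rfl⟩ := Multiset.mem_map.1 hx
      exact prime_map conj (hL.prime y (hfg ▸ Multiset.mem_add.2 (Or.inr hy)))
  have hrel : Multiset.Rel Associated (f + g.map conj) (f' + g'.map conj) := by
    refine prime_factors_unique (hprime f g hfg) (hprime f' g' hfg') ?_
    rw [Multiset.prod_add, Multiset.prod_add]
    refine Associated.of_mul_left ?_ (Associated.refl γ) h0
    simpa [combine, mul_assoc] using h
  have hstd : Std.Symm (Associated : LatticeTriangle → LatticeTriangle → Prop) :=
    ⟨fun _ _ h => h.symm⟩
  have htr : IsTrans LatticeTriangle Associated := ⟨fun _ _ _ h h' => h.trans h'⟩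
  refine Multiset.ext.2 fun t => ?_
  by_cases ht : t ∈ L
  · have := Multiset.Rel.countP_eq Associated t hrel
    rwa [hL.countP_associated hfg ht, hL.countP_associated hfg' ht] at this
  · rw [Multiset.count_eq_zero_of_notMem fun h => ht (hfg ▸ Multiset.mem_add.2 (Or.inl h)),
      Multiset.count_eq_zero_of_notMem fun h => ht (hfg' ▸ Multiset.mem_add.2 (Or.inl h))]

lemma conj_combine {γ : LatticeTriangle} (hγ : SelfConj γ) (h0 : γ ≠ 0)
    (f g : Multiset LatticeTriangle) :
    Associated (conj (combine γ f g)) (combine γ g f) := by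
  have : conj (combine γ f g) = conj γ * (conj f.prod * g.prod) := by
    simp only [combine, prod_map_conj, map_mul, conj_conj, mul_assoc]
  rw [this, combine, prod_map_conj, mul_assoc, mul_comm (conj f.prod)]
  exact (hγ.associated_conj h0).mul_right _

/-- Equality of primes up to association and complex conjugation. -/
def conjSetoid : Setoid LatticeTriangle where
  r a b := Associated a b ∨ Associated (conj a) b
  iseqv := by
    refine ⟨fun a => Or.inl (Associated.refl a), fun {a b} h => ?_, fun {a b c} h h' => ?_⟩
    · rcases h with h | h
      · exact Or.inl h.symm
      · right
        simpa using associated_map_conj h.symm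
    · rcases h with h | h <;> rcases h' with h' | h'
      · exact Or.inl (h.trans h')
      · exact Or.inr ((associated_map_conj h).trans h')
      · exact Or.inr (h.trans h')
      · left
        have := associated_map_conj h
        rw [conj_conj] at this
        exact this.trans h'

/-- A representative of the class of `a` up to association and complex conjugation. -/
noncomputable def representative (a : LatticeTriangle) : LatticeTriangle :=
  (Quotient.mk conjSetoid a).out

lemma representative_spec (a : LatticeTriangle) :
    Associated (representative a) a ∨ Associated (conj (representative a)) a :=
  Quotient.exact (s := conjSetoid) (Quotient.out_eq (Quotient.mk conjSetoid a))

lemma representative_eq {a b : LatticeTriangle} (h : Associated a b ∨ Associated (conj a) b) :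
    representative a = representative b := by
  have : Quotient.mk conjSetoid a = Quotient.mk conjSetoid b := Quotient.sound h
  unfold representative
  rw [this]

lemma representative_representative (a : LatticeTriangle) :
    representative (representative a) = representative a :=
  representative_eq (representative_spec a)

/-- Every prime factor that is not self-conjugate is replaced by the fixed representative of its
class up to association and conjugation. A conjugation is invisible in the norm to ℤ[√3], and the
unit that appears is absorbed in γ. -/
lemma exists_reduced {a : LatticeTriangle} (ha : a ≠ 0) : ∃ γ L, SelfConj γ ∧ γ ≠ 0 ∧
    Reduced L ∧ realNorm a = realNorm (γ * L.prod) := by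
  suffices h : ∃ γ L, SelfConj γ ∧ γ ≠ 0 ∧ (∀ t ∈ L, Prime t ∧ ¬ Associated (conj t) t ∧
      representative t = t) ∧ realNorm a = realNorm (γ * Multiset.prod L) by
    obtain ⟨γ, L, h1, h2, h3, h4⟩ := h
    refine ⟨γ, L, h1, h2, ⟨fun t ht => (h3 t ht).1, fun t ht => (h3 t ht).2.1,
      fun t ht t' ht' h => ?_⟩, h4⟩
    rw [← (h3 t ht).2.2, ← (h3 t' ht').2.2, representative_eq h]
  induction a using UniqueFactorizationMonoid.induction_on_prime with
  | h₁ => exact absurd rfl ha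
  | h₂ x hx =>
    refine ⟨x, 0, fun π hπ hd => absurd (isUnit_of_dvd_unit hd hx) hπ.not_isUnit, ha, by simp,
      by simp⟩
  | h₃ a p ha' hp ih =>
    obtain ⟨γ, L, h1, h2, h3, h4⟩ := ih ha'
    by_cases hsp : Associated (conj p) p
    · refine ⟨p * γ, L, fun π hπ hd => ?_, mul_ne_zero hp.ne_zero h2, h3, ?_⟩
      · rcases hπ.dvd_or_dvd hd with hd | hd
        · have := hπ.associated_of_dvd hp hd
          exact (associated_map_conj this).trans (hsp.trans this.symm)
        · exact h1 π hπ hd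
      · rw [realNorm_mul, h4, mul_assoc, realNorm_mul p]
    · obtain ⟨t, ht, htt, u, hu⟩ : ∃ t, representative t = t ∧ (Associated t p ∨
          Associated (conj t) p) ∧ ∃ u : LatticeTriangleˣ, realNorm t * realNorm u =
            realNorm p := by
        refine ⟨representative p, representative_representative p, representative_spec p, ?_⟩
        rcases representative_spec p with ⟨u, hu⟩ | ⟨u, hu⟩
        · exact ⟨u, by rw [← realNorm_mul, hu]⟩
        · exact ⟨u, by rw [← realNorm_conj (representative p), ← realNorm_mul, hu]⟩
      refine ⟨u * γ, t ::ₘ L, fun π hπ hd => h1 π hπ ((u.isUnit.dvd_mul_left).1 hd),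
        mul_ne_zero u.ne_zero h2, fun s hs => ?_, ?_⟩
      · rcases Multiset.mem_cons.1 hs with rfl | hs
        · refine ⟨?_, ?_, ht⟩
          · rcases htt with h | h
            · exact h.symm.prime hp
            · have := prime_map conj (h.symm.prime hp)
              rwa [conj_conj] at this
          · intro hc
            rcases htt with h | h
            · exact hsp ((associated_map_conj h.symm).trans (hc.trans h))
            · have h' := associated_map_conj h.symm
              rw [conj_conj] at h'
              exact hsp (h'.trans (hc.symm.trans h))
        · exact h3 s hs
      · rw [realNorm_mul, h4, ← hu, Multiset.prod_cons]
        simp only [realNorm_mul]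
        ring

/-! ### Families of cosets -/

/-- The cosets of the elements with the same norm to `ℤ[√3]` as `a`. -/
def family (a : LatticeTriangle) : Set TriangleSequence :=
  {C | ∃ b, realNorm b = realNorm a ∧ C = cosetSeq b}

/-- The fibres of g are the orbits {x, σ x}, all of size 2 with at most one exception; rounding up
accounts for the fixed point. -/
lemma card_image_of_involution {α β : Type*} [DecidableEq α] [DecidableEq β] (X : Finset α)
    (g : α → β) (σ : α → α) (hσ : ∀ x ∈ X, σ x ∈ X)
    (hg : ∀ x ∈ X, ∀ y ∈ X, g x = g y ↔ (y = x ∨ y = σ x))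
    (hfix : ∀ x ∈ X, ∀ y ∈ X, σ x = x → σ y = y → x = y) :
    (X.image g).card = (X.card + 1) / 2 := by
  have h1 := Finset.card_eq_sum_card_image g X
  have hfib : ∀ x ∈ X, X.filter (fun y => g y = g x) = {x, σ x} := by
    intro x hx
    ext y
    simp only [Finset.mem_filter, Finset.mem_insert, Finset.mem_singleton]
    constructor
    · rintro ⟨hy, h⟩
      exact (hg x hx y hy).1 h.symm
    · intro h
      have hy : y ∈ X := by
        rcases h with rfl | rfl
        · exact hx
        · exact hσ x hx
      exact ⟨hy, ((hg x hx y hy).2 h).symm⟩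
  by_cases hf : ∃ x ∈ X, σ x = x
  · obtain ⟨x, hx, hxx⟩ := hf
    have hgx : g x ∈ X.image g := Finset.mem_image_of_mem g hx
    have h2 : ∀ b ∈ (X.image g).erase (g x), (X.filter (fun y => g y = b)).card = 2 := by
      intro b hb
      obtain ⟨hne, hb⟩ := Finset.mem_erase.1 hb
      obtain ⟨y, hy, rfl⟩ := Finset.mem_image.1 hb
      rw [hfib y hy, Finset.card_pair]
      intro h
      exact hne (by rw [hfix x hx y hy hxx h.symm])
    rw [← Finset.add_sum_erase _ _ hgx, Finset.sum_congr rfl h2, hfib x hx, hxx,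
      Finset.sum_const, Finset.card_erase_of_mem hgx] at h1
    have := Finset.card_pos.2 ⟨_, hgx⟩
    simp at h1
    omega
  · push Not at hf
    have h2 : ∀ b ∈ X.image g, (X.filter (fun y => g y = b)).card = 2 := by
      intro b hb
      obtain ⟨y, hy, rfl⟩ := Finset.mem_image.1 hb
      rw [hfib y hy, Finset.card_pair]
      exact fun h => hf y hy h.symm
    rw [Finset.sum_congr rfl h2, Finset.sum_const] at h1
    simp at h1
    omega

lemma ne_zero_of_realNorm {a b : LatticeTriangle} (ha : a ≠ 0) (h : realNorm b = realNorm a) :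
    b ≠ 0 := by
  rintro rfl
  exact realNorm_ne_zero ha (by rw [← h]; simp [realNorm])

lemma combine_ne_zero {a γ : LatticeTriangle} {f g : Multiset LatticeTriangle} (ha : a ≠ 0)
    (h : realNorm a = realNorm (γ * (f + g).prod)) : combine γ f g ≠ 0 :=
  ne_zero_of_realNorm ha (by rw [realNorm_combine, h])

/-- The members are parametrized by the sub-multisets f ≤ L of unconjugated factors, and complex
conjugation identifies f exactly with L - f. -/
theorem family_finite_and_ncard {a γ : LatticeTriangle} {L : Multiset LatticeTriangle} (ha : a ≠ 0)
    (hγ : SelfConj γ) (h0 : γ ≠ 0) (hL : Reduced L) (h : realNorm a = realNorm (γ * L.prod)) :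
    (family a).Finite ∧ (family a).ncard = (∏ t ∈ L.toFinset, (L.count t + 1) + 1) / 2 := by
  classical
  have hsub {f : Multiset LatticeTriangle} (hf : f ∈ Finset.Iic L) : f + (L - f) = L :=
    add_tsub_cancel_of_le (Finset.mem_Iic.1 hf)
  have hfam : family a = ↑((Finset.Iic L).image fun f => cosetSeq (combine γ f (L - f))) := by
    ext C
    simp only [family, Set.mem_ofPred_eq, Finset.coe_image, Set.mem_image, Finset.mem_coe]
    constructor
    · rintro ⟨b, hb, rfl⟩
      obtain ⟨f, g, rfl, hfg⟩ := exists_combine hγ h0 L hL.prime (hb.trans h)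
      refine ⟨f, Finset.mem_Iic.2 (Multiset.le_add_right f g), ?_⟩
      rw [add_tsub_cancel_left]
      refine (cosetSeq_eq_of_associated (ne_zero_of_realNorm ha hb) ?_ (Or.inl hfg)).symm
      rw [hb, h, realNorm_combine]
    · rintro ⟨f, hf, rfl⟩
      exact ⟨_, by rw [realNorm_combine, hsub hf, h], rfl⟩
  rw [hfam]
  refine ⟨Finset.finite_toSet _, ?_⟩
  rw [Set.ncard_coe_finset, ← Multiset.card_Iic]
  refine card_image_of_involution _ _ (fun f => L - f) (fun f hf => ?_) (fun f hf f' hf' => ?_)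
    fun f hf f' hf' h1 h2 => ?_
  · exact Finset.mem_Iic.2 tsub_le_self
  · have hr (f) (hf : f ∈ Finset.Iic L) : realNorm a = realNorm (γ * (f + (L - f)).prod) := by
      rw [hsub hf, h]
    rw [cosetSeq_eq_iff (combine_ne_zero ha (hr f hf)) (combine_ne_zero ha (hr f' hf')),
      realNorm_combine, realNorm_combine, hsub hf, hsub hf']
    have hsub' : L - f + f = L := by rw [add_comm, hsub hf]
    constructor
    · rintro ⟨-, h' | h'⟩
      · exact Or.inl (hL.eq_of_associated_combine h0 (hsub hf) (hsub hf') h').symm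
      · right
        exact (hL.eq_of_associated_combine h0 hsub' (hsub hf')
          ((conj_combine hγ h0 f (L - f)).symm.trans h')).symm
    · rintro (rfl | rfl)
      · exact ⟨rfl, Or.inl (Associated.refl _)⟩
      · refine ⟨rfl, Or.inr ?_⟩
        rw [tsub_tsub_cancel_of_le (Finset.mem_Iic.1 hf)]
        exact conj_combine hγ h0 f (L - f)
  -- A fixed point satisfies 2f = L, which determines f.
  · have e1 := hsub hf
    have e2 := hsub hf'
    rw [h1] at e1
    rw [h2] at e2
    refine Multiset.ext.2 fun t => ?_
    have := congrArg (Multiset.count t) (e1.trans e2.symm)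
    rw [Multiset.count_add, Multiset.count_add] at this
    omega

/-! ### The criterion for congruence of all triangles in a family -/

/-- All elements with the same norm to `ℤ[√3]` as `a` give triangles congruent to those of `a`. -/
def AllCongruent (a : LatticeTriangle) : Prop :=
  ∀ b, realNorm b = realNorm a →
    Associated (eisNorm a) (eisNorm b) ∨ Associated (eisNorm (conj a)) (eisNorm b)

lemma eisNorm_conj (a : LatticeTriangle) : eisNorm (conj a) = conj (eisNorm a) := by
  simp [eisNorm]

lemma eisNorm_associated {a b : LatticeTriangle} (h : Associated a b) :
    Associated (eisNorm a) (eisNorm b) :=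
  h.mul_mul (h.map (sigma7 : LatticeTriangle →* LatticeTriangle))

/-- The two norms to ℤ[√-3] factor as t · σ₇t and t̄ · σ₅t. As t is not associated to t̄, it divides
the second product only by being associated to σ₅t. -/
lemma eisNorm_conj_associated_iff {t : LatticeTriangle} (ht : Prime t)
    (hs : ¬ Associated (conj t) t) :
    Associated (conj (eisNorm t)) (eisNorm t) ↔ Associated (sigma5 t) t := by
  have he : conj (eisNorm t) = conj t * sigma5 t := by simp [eisNorm]
  constructor
  · intro h
    have hd : t ∣ conj t * sigma5 t := by
      rw [← he]
      exact (dvd_mul_right t (sigma7 t)).trans h.symm.dvd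
    rcases ht.dvd_or_dvd hd with h' | h'
    · exact absurd (ht.associated_of_dvd (prime_map conj ht) h').symm hs
    · exact (ht.associated_of_dvd (prime_map sigma5 ht) h').symm
  · intro h
    have h7 : Associated (sigma7 t) (conj t) := by
      simpa using associated_map_conj h
    rw [he, mul_comm]
    exact h.mul_mul h7.symm

lemma eisNorm_prod_conj_associated {g : Multiset LatticeTriangle}
    (hg : ∀ t ∈ g, Associated (conj (eisNorm t)) (eisNorm t)) :
    Associated (conj (eisNorm g.prod)) (eisNorm g.prod) := by
  induction g using Multiset.induction_on with
  | empty => simp [eisNorm]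
  | cons t g ih =>
    rw [Multiset.prod_cons, eisNorm_mul, map_mul]
    exact (hg t (Multiset.mem_cons_self t g)).mul_mul
      (ih fun s hs => hg s (Multiset.mem_cons_of_mem hs))

lemma eisNorm_combine (γ : LatticeTriangle) (f g : Multiset LatticeTriangle) :
    eisNorm (combine γ f g) = eisNorm γ * eisNorm f.prod * conj (eisNorm g.prod) := by
  rw [combine, prod_map_conj, eisNorm_mul, eisNorm_mul, eisNorm_conj]

lemma SelfConj.conj_eisNorm {γ : LatticeTriangle} (hγ : SelfConj γ) (h0 : γ ≠ 0) :
    Associated (conj (eisNorm γ)) (eisNorm γ) := by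
  rw [← eisNorm_conj]
  exact eisNorm_associated (hγ.associated_conj h0)

open Classical in
/-- The members of `L` whose norms to `ℤ[√-3]` change under conjugation. -/
noncomputable def mobile (L : Multiset LatticeTriangle) : Multiset LatticeTriangle :=
  L.filter fun t => ¬ Associated (sigma5 t) t

open Classical in
lemma mobile_le (L : Multiset LatticeTriangle) : mobile L ≤ L := Multiset.filter_le _ L

lemma mem_mobile {L : Multiset LatticeTriangle} {t : LatticeTriangle} :
    t ∈ mobile L ↔ t ∈ L ∧ ¬ Associated (sigma5 t) t := by
  simp [mobile]

/-- If b comes from the splitting f + g = L, at most one of f and g contains a mobile factor. The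
other part has a self-conjugate norm to ℤ[√-3], so b has that of γ∏L or its conjugate. -/
lemma allCongruent_of_card_le {a γ : LatticeTriangle} {L : Multiset LatticeTriangle}
    (hγ : SelfConj γ) (h0 : γ ≠ 0) (hL : Reduced L) (h : realNorm a = realNorm (γ * L.prod))
    (hc : (mobile L).card ≤ 1) : AllCongruent a := by
  classical
  set X := eisNorm (γ * L.prod) with hX
  have key (b : LatticeTriangle) (hb : realNorm b = realNorm (γ * L.prod)) :
      Associated (eisNorm b) X ∨ Associated (eisNorm b) (conj X) := by
    obtain ⟨f, g, rfl, hfg⟩ := exists_combine hγ h0 L hL.prime hb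
    have hadd : (mobile (f + g)).card = (mobile f).card + (mobile g).card := by
      simp [mobile, Multiset.filter_add]
    have hfix (g' : Multiset LatticeTriangle) (hg' : g' ≤ f + g) (hm : (mobile g').card = 0) :
        Associated (conj (eisNorm g'.prod)) (eisNorm g'.prod) := by
      refine eisNorm_prod_conj_associated fun t ht => ?_
      have ht' := Multiset.mem_of_le hg' ht
      rw [eisNorm_conj_associated_iff (hL.prime t ht') (hL.split t ht')]
      by_contra hn
      have := mem_mobile.2 ⟨ht, hn⟩
      rw [Multiset.card_eq_zero.1 hm] at this
      exact Multiset.notMem_zero t this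
    have hE := eisNorm_associated hfg
    rw [eisNorm_combine] at hE
    have : (mobile g).card = 0 ∨ (mobile f).card = 0 := by omega
    rcases this with hm | hm
    · left
      refine hE.trans ?_
      rw [hX, Multiset.prod_add, eisNorm_mul, eisNorm_mul, ← mul_assoc]
      exact (hfix g (Multiset.le_add_left g f) hm).mul_left _
    · right
      refine hE.trans ?_
      rw [hX, Multiset.prod_add, eisNorm_mul, eisNorm_mul, ← mul_assoc, map_mul, map_mul]
      exact ((hγ.conj_eisNorm h0).symm.mul_mul
        (hfix f (Multiset.le_add_right f g) hm).symm).mul_right _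
  intro b hb
  rw [eisNorm_conj]
  have h1 := key a h
  have h2 := key b (hb.trans h)
  rcases h1 with h1 | h1 <;> rcases h2 with h2 | h2
  · exact Or.inl (h1.trans h2.symm)
  · exact Or.inr ((associated_map_conj h1).trans h2.symm)
  · right
    have := associated_map_conj h1
    rw [conj_conj] at this
    exact this.trans h2.symm
  · exact Or.inl (h1.trans h2.symm)

lemma associated_of_sq {a b : LatticeTriangle} (h : Associated (a ^ 2) (b ^ 2)) :
    Associated a b :=
  associated_of_dvd_dvd ((UniqueFactorizationMonoid.pow_dvd_pow_iff_dvd two_ne_zero).1 h.dvd)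
    ((UniqueFactorizationMonoid.pow_dvd_pow_iff_dvd two_ne_zero).1 h.symm.dvd)

lemma associated_cancel_left {c a b : LatticeTriangle} (hc : c ≠ 0)
    (h : Associated (c * a) (c * b)) : Associated a b :=
  h.of_mul_left (Associated.refl c) hc

/-- Given two mobile factors, with norms X, Y to ℤ[√-3] and Z for the rest, each of the four choices
of conjugating X and Y would have to be XYZ or its conjugate up to units; comparing them gives a
contradiction. The two factors may coincide, so multiplicity counts. -/
lemma card_le_of_allCongruent {a γ : LatticeTriangle} {L : Multiset LatticeTriangle}
    (h0 : γ ≠ 0) (hL : Reduced L)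
    (h : realNorm a = realNorm (γ * L.prod)) (hall : AllCongruent a) : (mobile L).card ≤ 1 := by
  classical
  by_contra! hcard
  obtain ⟨t₁, t₂, h2⟩ : ∃ t₁ t₂, t₁ ::ₘ t₂ ::ₘ 0 ≤ mobile L := by
    obtain ⟨x, hx⟩ := Multiset.card_pos_iff_exists_mem.1 (by omega : 0 < (mobile L).card)
    obtain ⟨s, hs⟩ := Multiset.exists_cons_of_mem hx
    rw [hs, Multiset.card_cons] at hcard
    obtain ⟨y, hy⟩ := Multiset.card_pos_iff_exists_mem.1 (by omega : 0 < s.card)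
    obtain ⟨s', rfl⟩ := Multiset.exists_cons_of_mem hy
    rw [hs]
    exact ⟨x, y, Multiset.cons_le_cons x (Multiset.cons_le_cons y (Multiset.zero_le s'))⟩
  have hm : ∀ t ∈ t₁ ::ₘ t₂ ::ₘ 0, t ≠ 0 ∧ ¬ Associated (conj (eisNorm t)) (eisNorm t) := by
    intro t ht
    obtain ⟨htL, hn⟩ := mem_mobile.1 (Multiset.mem_of_le h2 ht)
    exact ⟨(hL.prime t htL).ne_zero,
      by rwa [eisNorm_conj_associated_iff (hL.prime t htL) (hL.split t htL)]⟩
  obtain ⟨ht1, hX⟩ := hm t₁ (by simp)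
  obtain ⟨ht2, hY⟩ := hm t₂ (by simp)
  obtain ⟨M, hM⟩ := Multiset.le_iff_exists_add.1 (h2.trans (mobile_le L))
  have hZ0 : eisNorm (γ * M.prod) ≠ 0 := by
    refine eisNorm_ne_zero (mul_ne_zero h0 (Multiset.prod_ne_zero fun h0' => ?_))
    exact (hL.prime 0 (by rw [hM]; exact Multiset.mem_add.2 (Or.inr h0'))).ne_zero rfl
  have hX0 := eisNorm_ne_zero ht1
  have hY0 := eisNorm_ne_zero ht2
  have hw (b : LatticeTriangle) (hb : realNorm b = realNorm (t₁ * t₂ * (γ * M.prod))) :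
      Associated (eisNorm b) (eisNorm a) ∨ Associated (eisNorm b) (conj (eisNorm a)) := by
    rw [← eisNorm_conj]
    refine (hall b ?_).imp Associated.symm Associated.symm
    rw [hb, h, hM]
    congr 1
    simp only [Multiset.cons_add, Multiset.prod_cons, zero_add]
    ring
  have e1 := hw (t₁ * t₂ * (γ * M.prod)) rfl
  have e2 := hw (conj t₁ * t₂ * (γ * M.prod)) (by simp only [realNorm_mul, realNorm_conj])
  have e3 := hw (t₁ * conj t₂ * (γ * M.prod)) (by simp only [realNorm_mul, realNorm_conj])
  have e4 := hw (conj t₁ * conj t₂ * (γ * M.prod)) (by simp only [realNorm_mul, realNorm_conj])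
  rw [eisNorm_mul, eisNorm_mul] at e1 e2 e3 e4
  rw [eisNorm_conj] at e2 e3 e4
  rw [eisNorm_conj] at e4
  set X := eisNorm t₁
  set Y := eisNorm t₂
  set Z := eisNorm (γ * M.prod)
  have hcX : conj X ≠ 0 := conj_ne_zero hX0
  have hcY : conj Y ≠ 0 := conj_ne_zero hY0
  have rel (b : LatticeTriangle)
      (hb : Associated b (eisNorm a) ∨ Associated b (conj (eisNorm a))) :
      Associated b (X * Y * Z) ∨ Associated b (conj X * conj Y * conj Z) := by
    have e1' := e1.imp associated_map_conj associated_map_conj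
    simp only [map_mul, conj_conj] at e1'
    rcases e1 with e | e <;> rcases hb with hb | hb
    · exact Or.inl (hb.trans e.symm)
    · right
      have := associated_map_conj e
      simp only [map_mul] at this
      exact hb.trans this.symm
    · right
      have := associated_map_conj e
      simp only [map_mul, conj_conj] at this
      exact hb.trans this.symm
    · exact Or.inl (hb.trans e.symm)
  -- Flipping X alone cannot reproduce XYZ, as X is not self-conjugate; hence it produces the full
  -- conjugate, and likewise for Y.
  have f2 := (rel _ e2).resolve_left fun hh => hX <| associated_cancel_left (mul_ne_zero hY0 hZ0)
    (by convert hh using 1 <;> ring)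
  have f3 := (rel _ e3).resolve_left fun hh => hY <| associated_cancel_left (mul_ne_zero hX0 hZ0)
    (by convert hh using 1 <;> ring)
  have g2 : Associated (Y * Z) (conj Y * conj Z) :=
    associated_cancel_left hcX (by convert f2 using 1 <;> ring)
  have g3 : Associated (X * Z) (conj X * conj Z) :=
    associated_cancel_left hcY (by convert f3 using 1 <;> ring)
  have hZne : ¬ Associated Z (conj Z) := by
    intro hZ
    refine hY (associated_cancel_left hZ0 ?_)
    have := g2.trans (hZ.symm.mul_left (conj Y))
    convert this.symm using 1 <;> ring
  have g4 : Associated (conj X * conj Y) (X * Y) := by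
    rcases rel _ e4 with hh | hh
    · exact associated_cancel_left hZ0 (by convert hh using 1 <;> ring)
    · exact absurd (associated_cancel_left (mul_ne_zero hcX hcY) hh) hZne
  -- Multiplying YZ ~ ȲZ̄ by XZ ~ X̄Z̄ and using XY ~ X̄Ȳ gives Z² ~ Z̄², hence Z ~ Z̄, which was
  -- excluded.
  refine hZne (associated_of_sq (associated_cancel_left (mul_ne_zero hcX hcY) ?_))
  refine (g4.mul_right (Z ^ 2)).trans ?_
  convert g3.mul_mul g2 using 1 <;> ring

/-! ### Class B0 families -/

lemma four_mul_sq_signedArea (a : LatticeTriangle) : 4 * a.signedArea ^ 2 =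
    4 * (a.k ^ 2 + a.l ^ 2) * (a.m ^ 2 + a.n ^ 2) -
      (a.k ^ 2 + a.l ^ 2 + (a.m ^ 2 + a.n ^ 2) - ((a.m - a.k) ^ 2 + (a.n - a.l) ^ 2)) ^ 2 := by
  unfold signedArea; ring

/-- Heron's formula in polynomial form: the squared area is symmetric in the three squared sides. -/
lemma Congruent.doubledArea_eq {a b : LatticeTriangle} (h : a.Congruent b) :
    a.doubledArea = b.doubledArea := by
  have ha := four_mul_sq_signedArea a
  have hb := four_mul_sq_signedArea b
  rw [LatticeTriangle.doubledArea_eq, LatticeTriangle.doubledArea_eq, ← sq_eq_sq_iff_abs_eq_abs]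
  rcases insert_insert_singleton_eq h with ⟨h1, h2, h3⟩ | ⟨h1, h2, h3⟩ | ⟨h1, h2, h3⟩ |
    ⟨h1, h2, h3⟩ | ⟨h1, h2, h3⟩ | ⟨h1, h2, h3⟩ <;> rw [h1, h2, h3] at ha <;> linarith

lemma sameAreas_of_sameTriangles {C C' : TriangleSequence} (h : SameTriangles C C') :
    SameAreas C C' := fun j T hT T' hT' => Congruent.doubledArea_eq (h j T hT T' hT')

lemma isSolutionCoset_cosetSeq {a b : LatticeTriangle} (ha : IsLeader a)
    (h : realNorm b = realNorm a) : IsSolutionCoset (normN a) (cosetSeq b) :=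
  (isSolutionCoset_iff _ _).2
    ⟨b, by rw [coe_normN, normZ_of_realNorm h], isLeader_of_realNorm h.symm ha, rfl⟩

lemma ne_zero_of_normN {a : LatticeTriangle} (h : normN a ≠ 0) : a ≠ 0 := by
  rintro rfl
  simp [normN] at h

lemma exists_eq_cosetSeq {r : ℕ} {C : TriangleSequence} (h : IsSolutionCoset r C) :
    ∃ a, normN a = r ∧ IsLeader a ∧ C = cosetSeq a := by
  obtain ⟨a, h1, h2, h3⟩ := (isSolutionCoset_iff r C).1 h
  exact ⟨a, by rw [← coe_normN] at h1; exact_mod_cast h1, h2, h3⟩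

/-- Maximality puts every coset with the same norm to ℤ[√3] into F. Conversely, congruent triangles
have equal areas, so no member of F has a different norm to ℤ[√3]. -/
theorem isB0Family_iff {F : Set TriangleSequence} : IsB0Family F ↔
    ∃ a, a ≠ 0 ∧ IsLeader a ∧ F = family a ∧ F.Nontrivial ∧ AllCongruent a := by
  constructor
  · intro h
    obtain ⟨C, hC⟩ := h.nontrivial.nonempty
    obtain ⟨r, hr, hCr⟩ := h.isSolutionCoset C hC
    obtain ⟨a, rfl, hlead, rfl⟩ := exists_eq_cosetSeq hCr
    have ha := ne_zero_of_normN hr.ne'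
    have hsub (b : LatticeTriangle) (hb : realNorm b = realNorm a) : cosetSeq b ∈ F :=
      h.maximal _ hC (normN a) _ hr (isSolutionCoset_cosetSeq hlead hb)
        ((sameAreas_cosetSeq_iff ha (ne_zero_of_realNorm ha hb)).2 hb.symm)
    refine ⟨a, ha, hlead, ?_, h.nontrivial, fun b hb => ?_⟩
    · ext C'
      constructor
      · intro hC'
        obtain ⟨r', hr', hC'r⟩ := h.isSolutionCoset C' hC'
        obtain ⟨b, rfl, -, rfl⟩ := exists_eq_cosetSeq hC'r
        have hb := ne_zero_of_normN hr'.ne'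
        exact ⟨b, ((sameAreas_cosetSeq_iff ha hb).1
          (sameAreas_of_sameTriangles (h.sameTriangles _ hC _ hC'))).symm, rfl⟩
      · rintro ⟨b, hb, rfl⟩
        exact hsub b hb
    · exact (sameTriangles_cosetSeq_iff ha hb.symm).1 (h.sameTriangles _ hC _ (hsub b hb))
  · rintro ⟨a, ha, hlead, rfl, hnt, hall⟩
    refine ⟨?_, hnt, ?_, ?_⟩
    · rintro C ⟨b, hb, rfl⟩
      exact ⟨normN a, Nat.pos_of_ne_zero (normN_ne_zero ha), isSolutionCoset_cosetSeq hlead hb⟩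
    · rintro C ⟨b, hb, rfl⟩ C' ⟨b', hb', rfl⟩ j T hT T' hT'
      have h1 := (sameTriangles_cosetSeq_iff ha hb.symm).2 (hall b hb) j _ (latticeCongruent_refl _)
        T hT
      have h2 := (sameTriangles_cosetSeq_iff ha hb'.symm).2 (hall b' hb') j _
        (latticeCongruent_refl _) T' hT'
      unfold Congruent at *
      rw [← h1, h2]
    · rintro C ⟨b, hb, rfl⟩ r C' hr hC' hs
      obtain ⟨b', rfl, -, rfl⟩ := exists_eq_cosetSeq hC'
      exact ⟨b', by rw [← hb, (sameAreas_cosetSeq_iff (ne_zero_of_realNorm ha hb)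
        (ne_zero_of_normN hr.ne')).1 hs], rfl⟩

lemma family_eq_of_realNorm {a b : LatticeTriangle} (h : realNorm a = realNorm b) :
    family a = family b := by
  unfold family
  rw [h]

lemma mem_family_self (a : LatticeTriangle) : cosetSeq a ∈ family a := ⟨a, rfl, rfl⟩

lemma family_subset_solutionCosets {a : LatticeTriangle} (hlead : IsLeader a) :
    family a ⊆ solutionCosets (normN a) := by
  rintro C ⟨b, hb, rfl⟩
  exact isSolutionCoset_cosetSeq hlead hb

lemma normN_of_cosetSeq_isSolutionCoset {a : LatticeTriangle} {r : ℕ} (ha : a ≠ 0) (hr : r ≠ 0)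
    (h : IsSolutionCoset r (cosetSeq a)) : normN a = r := by
  obtain ⟨b, rfl, -, hab⟩ := exists_eq_cosetSeq h
  have h1 := ((cosetSeq_eq_iff ha (ne_zero_of_normN hr)).1 hab).1
  have h2 := normZ_of_realNorm h1
  rw [← coe_normN, ← coe_normN] at h2
  exact_mod_cast h2

lemma mem_b0Families_iff {r : ℕ} (hr : r ≠ 0) {F : Set TriangleSequence} : F ∈ b0Families r ↔
    ∃ a, normN a = r ∧ IsLeader a ∧ F = family a ∧ F.Nontrivial ∧ AllCongruent a := by
  unfold b0Families
  simp only [Set.mem_ofPred_eq]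
  rw [isB0Family_iff]
  constructor
  · rintro ⟨⟨a, ha, hlead, rfl, h1, h2⟩, h3⟩
    exact ⟨a, normN_of_cosetSeq_isSolutionCoset ha hr (h3 (mem_family_self a)), hlead, rfl, h1, h2⟩
  · rintro ⟨a, rfl, hlead, rfl, h1, h2⟩
    exact ⟨⟨a, ne_zero_of_normN hr, hlead, rfl, h1, h2⟩, family_subset_solutionCosets hlead⟩

lemma finite_b0Families {r : ℕ} (hr : r ≠ 0) : (b0Families r).Finite := by
  have hfin : (realNorm '' {a | normN a = r ∧ IsLeader a}).Finite := by
    refine (Finset.finite_toSet ((Finset.Icc (-4 * (r : ℤ)) (4 * r) ×ˢ Finset.Icc (-(r : ℤ)) r).image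
        fun p : ℤ × ℤ => (⟨p.1, p.2, p.1, -p.2⟩ : LatticeTriangle))).subset ?_
    rintro A ⟨a, ⟨hn, hlead⟩, rfl⟩
    have h6 := six_mul_sq_le_of_isLeader hlead
    rw [← coe_normN, hn] at h6
    have hz : a.halfSides ^ 2 = r + 3 * a.signedArea ^ 2 := by
      have := coe_normN a
      rw [hn, normZ] at this
      linarith
    have hr1 : (1 : ℤ) ≤ r := by exact_mod_cast Nat.one_le_iff_ne_zero.2 hr
    simp only [Finset.coe_image, Set.mem_image, Finset.mem_coe, Finset.mem_product, Finset.mem_Icc]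
    refine ⟨(a.halfSides, a.signedArea), ⟨⟨?_, ?_⟩, ?_, ?_⟩, (realNorm_eq a).symm⟩ <;>
      simp only <;> nlinarith
  refine (hfin.image fun A => {C | ∃ b, realNorm b = A ∧ C = cosetSeq b}).subset fun F hF => ?_
  obtain ⟨a, h1, h2, rfl, -⟩ := (mem_b0Families_iff hr).1 hF
  exact ⟨realNorm a, ⟨a, ⟨h1, h2⟩, rfl⟩, rfl⟩

lemma pairwiseDisjoint_b0Families {r : ℕ} (hr : r ≠ 0) : (b0Families r).PairwiseDisjoint id := by
  intro F hF F' hF' hne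
  rw [Function.onFun, id, id, Set.disjoint_left]
  intro C hC hC'
  obtain ⟨a, h1, h2, rfl, -⟩ := (mem_b0Families_iff hr).1 hF
  obtain ⟨a', h1', h2', rfl, -⟩ := (mem_b0Families_iff hr).1 hF'
  obtain ⟨b, hb, rfl⟩ := hC
  obtain ⟨b', hb', hbb⟩ := hC'
  have ha : a ≠ 0 := ne_zero_of_normN (by rw [h1]; exact hr)
  have ha' : a' ≠ 0 := ne_zero_of_normN (by rw [h1']; exact hr)
  refine hne (family_eq_of_realNorm ?_)
  rw [← hb, ← hb', ((cosetSeq_eq_iff (ne_zero_of_realNorm ha hb)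
    (ne_zero_of_realNorm ha' hb')).1 hbb).1]

/-! ### Rational primes under the prime factors -/

/-- The degree of the primes over the rational prime `l`. -/
def residueDegree (l : ℕ) : ℕ := if l % 12 = 1 then 1 else 2

/-- The residue classes modulo 12 of the rational primes whose prime factors are not associated to
their complex conjugates. -/
def IsSplitClass (l : ℕ) : Prop := l % 12 = 1 ∨ l % 12 = 5 ∨ l % 12 = 7

lemma prime_mod_twelve {l : ℕ} (hl : l.Prime) :
    l = 2 ∨ l = 3 ∨ l % 12 = 1 ∨ l % 12 = 5 ∨ l % 12 = 7 ∨ l % 12 = 11 := by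
  by_cases h2 : l % 2 = 0
  · exact Or.inl ((Nat.prime_dvd_prime_iff_eq Nat.prime_two hl).1 (Nat.dvd_of_mod_eq_zero h2)).symm
  by_cases h3 : l % 3 = 0
  · exact Or.inr (Or.inl
      ((Nat.prime_dvd_prime_iff_eq Nat.prime_three hl).1 (Nat.dvd_of_mod_eq_zero h3)).symm)
  omega

section under

variable {l : ℕ} {π : LatticeTriangle}

lemma normN_of_prime_dvd (hl : l.Prime) (hπ : Prime π) (hπl : π ∣ (l : LatticeTriangle)) :
    normN π = l ^ residueDegree l := by
  obtain ⟨h1, h5, h7, h11⟩ := prime_class_split hl hπ hπl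
  unfold residueDegree
  rcases prime_mod_twelve hl with h | h | h | h | h | h
  · rw [if_neg (by omega), (prime_class_ramified hl hπ hπl (Or.inl h)).1]
  · rw [if_neg (by omega), (prime_class_ramified hl hπ hπl (Or.inr h)).1]
  · rw [if_pos h, (h1 h).1, pow_one]
  · rw [if_neg (by omega), (h5 h).1]
  · rw [if_neg (by omega), (h7 h).1]
  · rw [if_neg (by omega), (h11 h).1]

lemma associated_conj_iff (hl : l.Prime) (hπ : Prime π) (hπl : π ∣ (l : LatticeTriangle)) :
    ¬ Associated (conj π) π ↔ IsSplitClass l := by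
  obtain ⟨h1, h5, h7, h11⟩ := prime_class_split hl hπ hπl
  unfold IsSplitClass
  rcases prime_mod_twelve hl with h | h | h | h | h | h
  · simp [(prime_class_ramified hl hπ hπl (Or.inl h)).2, h]
  · simp [(prime_class_ramified hl hπ hπl (Or.inr h)).2, h]
  · simp [(h1 h).2, h]
  · simp [(h5 h).2, h]
  · simp [(h7 h).2, h]
  · simp [(h11 h).2, h]

lemma associated_sigma5_iff (hl : l.Prime) (hπ : Prime π) (hπl : π ∣ (l : LatticeTriangle))
    (hs : IsSplitClass l) : ¬ Associated (sigma5 π) π ↔ l % 12 = 1 ∨ l % 12 = 7 := by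
  obtain ⟨h1, h5, h7, h11⟩ := prime_class_split hl hπ hπl
  rcases hs with h | h | h
  · simp [(h1 h).2, h]
  · simp [(h5 h).2, h]
  · simp [(h7 h).2, h]

/-- The rational prime under a prime. -/
def under (π : LatticeTriangle) : ℕ := (normN π).minFac

lemma under_eq (hl : l.Prime) (hπ : Prime π) (hπl : π ∣ (l : LatticeTriangle)) : under π = l := by
  rw [under, normN_of_prime_dvd hl hπ hπl, Nat.Prime.pow_minFac hl]
  unfold residueDegree
  split_ifs <;> norm_num

lemma under_prime (hπ : Prime π) : (under π).Prime := by
  obtain ⟨l, hl, h⟩ := exists_natPrime_of_prime hπ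
  rwa [under_eq hl hπ h]

lemma dvd_under (hπ : Prime π) : π ∣ (under π : LatticeTriangle) := by
  obtain ⟨l, hl, h⟩ := exists_natPrime_of_prime hπ
  rwa [under_eq hl hπ h]

lemma normN_of_prime (hπ : Prime π) : normN π = under π ^ residueDegree (under π) :=
  normN_of_prime_dvd (under_prime hπ) hπ (dvd_under hπ)

lemma residueDegree_pos (l : ℕ) : 0 < residueDegree l := by
  unfold residueDegree; split_ifs <;> norm_num

end under

lemma factorization_prime_pow {q : ℕ} (hq : q.Prime) (c l : ℕ) :
    (q ^ c).factorization l = if l = q then c else 0 := by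
  rw [hq.factorization_pow, Finsupp.single_apply]
  simp only [eq_comm]

lemma factorization_normN_mul {a b : LatticeTriangle} (ha : a ≠ 0) (hb : b ≠ 0) (l : ℕ) :
    (normN (a * b)).factorization l = (normN a).factorization l + (normN b).factorization l := by
  rw [normN_mul, Nat.factorization_mul (normN_ne_zero ha) (normN_ne_zero hb), Finsupp.add_apply]

lemma factorization_normN_prime {π : LatticeTriangle} (hπ : Prime π) (l : ℕ) :
    (normN π).factorization l = if l = under π then residueDegree l else 0 := by
  rw [normN_of_prime hπ, factorization_prime_pow (under_prime hπ)]
  split_ifs with h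
  · rw [h]
  · rfl

/-- A prime factor over such an l would not be self-conjugate. The exponents of the norm at split
classes therefore count the members of L alone. -/
lemma SelfConj.factorization_normN {γ : LatticeTriangle} (hγ : SelfConj γ) (h0 : γ ≠ 0) {l : ℕ}
    (hl : IsSplitClass l) : (normN γ).factorization l = 0 := by
  induction γ using UniqueFactorizationMonoid.induction_on_prime with
  | h₁ => exact absurd rfl h0
  | h₂ x hx => simp [isUnit_iff_normN.1 hx]
  | h₃ a p ha hp ih =>
    rw [factorization_normN_mul hp.ne_zero ha, ih hγ.of_mul_left ha, factorization_normN_prime hp,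
      if_neg, add_zero]
    rintro rfl
    exact (associated_conj_iff (under_prime hp) hp (dvd_under hp)).2 hl
      (hγ p hp (dvd_mul_right p a))

lemma factorization_normN_prod {L : Multiset LatticeTriangle} (hL : ∀ t ∈ L, Prime t) (l : ℕ) :
    (normN L.prod).factorization l = residueDegree l * (L.map under).count l := by
  induction L using Multiset.induction_on with
  | empty => simp
  | cons t L ih =>
    have hL' : ∀ t ∈ L, Prime t := fun s hs => hL s (Multiset.mem_cons_of_mem hs)
    have ht := hL t (Multiset.mem_cons_self t L)
    rw [Multiset.prod_cons, factorization_normN_mul ht.ne_zero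
      (Multiset.prod_ne_zero fun h => (hL' 0 h).ne_zero rfl), ih hL', factorization_normN_prime ht,
      Multiset.map_cons, Multiset.count_cons]
    split_ifs <;> ring

lemma even_factorization_normN {a : LatticeTriangle} (ha : a ≠ 0) {l : ℕ} (hl : l % 12 ≠ 1) :
    2 ∣ (normN a).factorization l := by
  induction a using UniqueFactorizationMonoid.induction_on_prime with
  | h₁ => exact absurd rfl ha
  | h₂ x hx => simp [isUnit_iff_normN.1 hx]
  | h₃ a p ha' hp ih =>
    rw [factorization_normN_mul hp.ne_zero ha', factorization_normN_prime hp]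
    refine dvd_add ?_ (ih ha')
    split_ifs
    · rw [residueDegree, if_neg hl]
    · exact dvd_zero 2

/-! ### Exponents of rational primes in terms of a reduced factorization -/

section reduced

variable {a γ : LatticeTriangle} {L : Multiset LatticeTriangle}

lemma Reduced.isSplitClass_under (hL : Reduced L) {t : LatticeTriangle} (ht : t ∈ L) :
    IsSplitClass (under t) :=
  (associated_conj_iff (under_prime (hL.prime t ht)) (hL.prime t ht)
    (dvd_under (hL.prime t ht))).1 (hL.split t ht)

lemma Reduced.mem_mobile_iff (hL : Reduced L) {t : LatticeTriangle} :
    t ∈ mobile L ↔ t ∈ L ∧ (under t % 12 = 1 ∨ under t % 12 = 7) := by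
  rw [mem_mobile]
  refine and_congr_right fun ht => ?_
  exact associated_sigma5_iff (under_prime (hL.prime t ht)) (hL.prime t ht)
    (dvd_under (hL.prime t ht)) (hL.isSplitClass_under ht)

lemma Reduced.factorization_eq (hL : Reduced L) (hγ : SelfConj γ) (h0 : γ ≠ 0)
    (h : realNorm a = realNorm (γ * L.prod)) {l : ℕ} (hl : IsSplitClass l) :
    (normN a).factorization l = residueDegree l * (L.map under).count l := by
  have hn : normN a = normN (γ * L.prod) := by
    have := normZ_of_realNorm h
    rw [← coe_normN, ← coe_normN] at this
    exact_mod_cast this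
  rw [hn, factorization_normN_mul h0
      (Multiset.prod_ne_zero fun h => (hL.prime 0 h).ne_zero rfl), hγ.factorization_normN h0 hl,
    zero_add, factorization_normN_prod hL.prime]

/-- A mobile member is unique by assumption. For any other x the four conjugates reduce to x and x̄
up to units, so a member y over the same rational prime is associated to one of them and equals x.
-/
lemma Reduced.under_injOn (hL : Reduced L) (hc : (mobile L).card ≤ 1) :
    Set.InjOn under {t | t ∈ L} := by
  intro x hx y hy hxy
  simp only [Set.mem_ofPred_eq] at hx hy
  have hpx := hL.prime x hx
  have hpy := hL.prime y hy
  by_cases hm : x ∈ mobile L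
  · have hm' : y ∈ mobile L := by
      rw [hL.mem_mobile_iff] at hm ⊢
      exact ⟨hy, hxy ▸ hm.2⟩
    obtain ⟨s, hs⟩ := Multiset.exists_cons_of_mem hm
    rw [hs, Multiset.card_cons] at hc
    have hs0 : s = 0 := Multiset.card_eq_zero.1 (by omega)
    rw [hs, hs0, Multiset.mem_cons] at hm'
    simpa [eq_comm] using hm'
  · have h5 : Associated (sigma5 x) x := by
      by_contra h5
      exact hm (mem_mobile.2 ⟨hx, h5⟩)
    have h7 : Associated (sigma7 x) (conj x) := by simpa using associated_map_conj h5
    have hd : y ∣ (normN x : LatticeTriangle) := by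
      refine (dvd_under hpy).trans ?_
      rw [natCast_dvd_natCast, normN_of_prime hpx, hxy]
      exact dvd_pow_self _ (residueDegree_pos _).ne'
    rw [natCast_normN] at hd
    have hor : y ∣ x ∨ y ∣ conj x := by
      rcases hpy.dvd_or_dvd hd with hd | hd <;> rcases hpy.dvd_or_dvd hd with hd | hd
      · exact Or.inl hd
      · exact Or.inr hd
      · exact Or.inl (hd.trans h5.dvd)
      · exact Or.inr (hd.trans h7.dvd)
    refine hL.inj x hx y hy ?_
    exact hor.imp (fun h => (hpy.associated_of_dvd hpx h).symm)
      fun h => (hpy.associated_of_dvd (prime_map conj hpx) h).symm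

lemma Reduced.prod_count (hL : Reduced L) (hc : (mobile L).card ≤ 1) :
    ∏ t ∈ L.toFinset, (L.count t + 1) =
      ∏ l ∈ (L.map under).toFinset, ((L.map under).count l + 1) := by
  have hinj := hL.under_injOn hc
  rw [Multiset.toFinset_map, Finset.prod_image]
  · refine Finset.prod_congr rfl fun t ht => ?_
    rw [Multiset.count_map_eq_count under L hinj t (Multiset.mem_toFinset.1 ht)]
  · intro x hx y hy hxy
    exact hinj (by simpa using hx) (by simpa using hy) hxy

end reduced

/-! ### The norms of Class B0 -/

/-- The conditions of `IsB0Data` without the lower bound on the exponents. -/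
structure IsB0Shape (p z : ℕ) (Q W : Finset ℕ) (ρ : ℕ → ℕ) : Prop where
  prime_p : p.Prime
  p_mod : p % 12 = 1
  prime_z : z.Prime
  z_mod : z % 12 = 7
  prime_q : ∀ q ∈ Q, q.Prime
  q_mod : ∀ q ∈ Q, q % 12 = 11
  prime_w : ∀ w ∈ W, w.Prime
  w_mod : ∀ w ∈ W, w % 12 = 5
  p_add_z_le : ρ p + ρ z ≤ 1

/-- The number of members of the Class B0 families. -/
def b0Size (p z : ℕ) (W : Finset ℕ) (ρ : ℕ → ℕ) : ℕ :=
  ((ρ p + 1) * (ρ z + 1) * ∏ w ∈ W, (ρ w + 1) + 1) / 2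

lemma one_add_sum_le_prod (W : Finset ℕ) (ρ : ℕ → ℕ) :
    1 + ∑ w ∈ W, ρ w ≤ ∏ w ∈ W, (ρ w + 1) := by
  induction W using Finset.induction_on with
  | empty => simp
  | insert w W hw ih =>
    rw [Finset.sum_insert hw, Finset.prod_insert hw]
    nlinarith [Nat.zero_le (ρ w), Nat.zero_le (∑ w ∈ W, ρ w)]

lemma prod_le_two_pow_sum (W : Finset ℕ) (ρ : ℕ → ℕ) :
    ∏ w ∈ W, (ρ w + 1) ≤ 2 ^ ∑ w ∈ W, ρ w := by
  rw [← Finset.prod_pow_eq_pow_sum]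
  exact Finset.prod_le_prod' fun w _ => Nat.lt_two_pow_self

/-! ### Families of a given norm and the arithmetic of their size -/

section shape

variable {p z : ℕ} {Q W : Finset ℕ} {ρ : ℕ → ℕ}

lemma IsB0Data.shape (h : IsB0Data p z Q W ρ) : IsB0Shape p z Q W ρ :=
  ⟨h.prime_p, h.p_mod, h.prime_z, h.z_mod, h.prime_q, h.q_mod, h.prime_w, h.w_mod, h.p_add_z_le⟩

lemma factorization_prod_pow {S : Finset ℕ} (hS : ∀ q ∈ S, q.Prime) (e : ℕ → ℕ) (l : ℕ) :
    (∏ q ∈ S, q ^ e q).factorization l = if l ∈ S then e l else 0 := by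
  rw [Nat.factorization_prod fun q hq => pow_ne_zero _ (hS q hq).ne_zero, Finsupp.finsetSum_apply,
    Finset.sum_congr rfl fun q hq => factorization_prime_pow (hS q hq) (e q) l,
    Finset.sum_ite_eq]

lemma IsB0Shape.norm_ne_zero (h : IsB0Shape p z Q W ρ) : b0Norm p z Q W ρ ≠ 0 := by
  unfold b0Norm
  have hq := Finset.prod_ne_zero_iff.2 fun q hq => pow_ne_zero (2 * ρ q) (h.prime_q q hq).ne_zero
  have hw := Finset.prod_ne_zero_iff.2 fun w hw => pow_ne_zero (2 * ρ w) (h.prime_w w hw).ne_zero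
  have hp := pow_ne_zero (ρ p) h.prime_p.ne_zero
  have hz := pow_ne_zero (2 * ρ z) h.prime_z.ne_zero
  positivity

lemma IsB0Shape.factorization_norm (h : IsB0Shape p z Q W ρ) (l : ℕ) :
    (b0Norm p z Q W ρ).factorization l =
      (if l = 2 then 2 * ρ 2 else 0) + (if l = 3 then 2 * ρ 3 else 0) +
      (if l = p then ρ p else 0) + (if l ∈ Q then 2 * ρ l else 0) +
      (if l ∈ W then 2 * ρ l else 0) + (if l = z then 2 * ρ z else 0) := by
  have hq := Finset.prod_ne_zero_iff.2 fun q hq => pow_ne_zero (2 * ρ q) (h.prime_q q hq).ne_zero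
  have hw := Finset.prod_ne_zero_iff.2 fun w hw => pow_ne_zero (2 * ρ w) (h.prime_w w hw).ne_zero
  have hp := pow_ne_zero (ρ p) h.prime_p.ne_zero
  have hz := pow_ne_zero (2 * ρ z) h.prime_z.ne_zero
  have h2 : 2 ^ (2 * ρ 2) ≠ 0 := by positivity
  have h3 : 3 ^ (2 * ρ 3) ≠ 0 := by positivity
  unfold b0Norm
  rw [Nat.factorization_mul (mul_ne_zero (mul_ne_zero (mul_ne_zero (mul_ne_zero h2 h3) hp) hq) hw)
      hz, Nat.factorization_mul (mul_ne_zero (mul_ne_zero (mul_ne_zero h2 h3) hp) hq) hw,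
    Nat.factorization_mul (mul_ne_zero (mul_ne_zero h2 h3) hp) hq,
    Nat.factorization_mul (mul_ne_zero h2 h3) hp, Nat.factorization_mul h2 h3]
  simp only [Finsupp.add_apply, factorization_prod_pow h.prime_q, factorization_prod_pow h.prime_w,
    factorization_prime_pow h.prime_p, factorization_prime_pow h.prime_z,
    factorization_prime_pow Nat.prime_two, factorization_prime_pow Nat.prime_three]

lemma IsB0Shape.factorization_p (h : IsB0Shape p z Q W ρ) :
    (b0Norm p z Q W ρ).factorization p = ρ p := by
  have hp := h.p_mod
  have hz := h.z_mod
  have hQ : p ∉ Q := fun hp' => by have := h.q_mod p hp'; omega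
  have hW : p ∉ W := fun hp' => by have := h.w_mod p hp'; omega
  rw [h.factorization_norm, if_neg (by omega), if_neg (by omega), if_pos rfl, if_neg hQ, if_neg hW,
    if_neg (by rintro rfl; omega)]
  omega

lemma IsB0Shape.factorization_z (h : IsB0Shape p z Q W ρ) :
    (b0Norm p z Q W ρ).factorization z = 2 * ρ z := by
  have hp := h.p_mod
  have hz := h.z_mod
  have hQ : z ∉ Q := fun hz' => by have := h.q_mod z hz'; omega
  have hW : z ∉ W := fun hz' => by have := h.w_mod z hz'; omega
  rw [h.factorization_norm, if_neg (by omega), if_neg (by omega), if_neg (by rintro rfl; omega),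
    if_neg hQ, if_neg hW, if_pos rfl]
  omega

lemma IsB0Shape.factorization_w (h : IsB0Shape p z Q W ρ) {w : ℕ} (hw : w ∈ W) :
    (b0Norm p z Q W ρ).factorization w = 2 * ρ w := by
  have hp := h.p_mod
  have hz := h.z_mod
  have hw' := h.w_mod w hw
  have hQ : w ∉ Q := fun hw' => by have := h.q_mod w hw'; omega
  rw [h.factorization_norm, if_neg (by omega), if_neg (by omega), if_neg (by rintro rfl; omega),
    if_neg hQ, if_pos hw, if_neg (by rintro rfl; omega)]
  omega

lemma IsB0Shape.mem_of_factorization (h : IsB0Shape p z Q W ρ) {l : ℕ} (hl : IsSplitClass l)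
    (hf : (b0Norm p z Q W ρ).factorization l ≠ 0) : l = p ∨ l = z ∨ l ∈ W := by
  by_contra! hcon
  apply hf
  have hQ : l ∉ Q := fun hq => by have := h.q_mod l hq; unfold IsSplitClass at hl; omega
  unfold IsSplitClass at hl
  rw [h.factorization_norm, if_neg (by omega), if_neg (by omega), if_neg hcon.1, if_neg hQ,
    if_neg hcon.2.2, if_neg hcon.2.1]

lemma card_le_count_add_count {x y : ℕ} {s : Multiset ℕ} (h : ∀ t ∈ s, t = x ∨ t = y) :
    s.card ≤ s.count x + s.count y := by
  induction s using Multiset.induction_on with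
  | empty => simp
  | cons t s ih =>
    have h1 := ih fun u hu => h u (Multiset.mem_cons_of_mem hu)
    rw [Multiset.card_cons, Multiset.count_cons, Multiset.count_cons]
    rcases h t (Multiset.mem_cons_self t s) with rfl | rfl
    · rw [if_pos rfl]; omega
    · rw [if_pos rfl]; omega

lemma count_add_count_le_card {x y : ℕ} (hxy : x ≠ y) (s : Multiset ℕ) :
    s.count x + s.count y ≤ s.card := by
  induction s using Multiset.induction_on with
  | empty => simp
  | cons t s ih =>
    rw [Multiset.card_cons, Multiset.count_cons, Multiset.count_cons]
    split_ifs <;> omega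

/-- The members of L lie over p, z and the w, with multiplicities given by ρ, and the mobile ones
lie over p or z. Hence ρ(p) + ρ(z) ≤ 1 leaves at most one mobile member, and the count of
sub-multisets becomes a product over rational primes. -/
theorem IsB0Shape.family_spec (h : IsB0Shape p z Q W ρ) {a : LatticeTriangle}
    (hn : normN a = b0Norm p z Q W ρ) :
    AllCongruent a ∧ (family a).Finite ∧ (family a).ncard = b0Size p z W ρ := by
  have ha : a ≠ 0 := ne_zero_of_normN (by rw [hn]; exact h.norm_ne_zero)
  obtain ⟨γ, L, hγ, h0, hL, hrn⟩ := exists_reduced ha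
  have hf {l : ℕ} (hl : IsSplitClass l) := hL.factorization_eq hγ h0 hrn hl
  rw [hn] at hf
  set K := L.map under
  have hpm := h.p_mod
  have hzm := h.z_mod
  have hKp : K.count p = ρ p := by
    have := hf (Or.inl h.p_mod)
    rw [h.factorization_p, residueDegree, if_pos h.p_mod] at this
    omega
  have hKz : K.count z = ρ z := by
    have := hf (Or.inr (Or.inr h.z_mod))
    rw [h.factorization_z, residueDegree, if_neg (by omega)] at this
    omega
  have hKw (w : ℕ) (hw : w ∈ W) : K.count w = ρ w := by
    have hwm := h.w_mod w hw
    have := hf (Or.inr (Or.inl hwm))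
    rw [h.factorization_w hw, residueDegree, if_neg (by omega)] at this
    omega
  have hmem (l : ℕ) (hl : l ∈ K) : l = p ∨ l = z ∨ l ∈ W := by
    obtain ⟨t, ht, rfl⟩ := Multiset.mem_map.1 hl
    have hs := hL.isSplitClass_under ht
    refine h.mem_of_factorization hs ?_
    rw [hf hs]
    exact (Nat.mul_pos (residueDegree_pos _) (Multiset.count_pos.2 hl)).ne'
  have hc : (mobile L).card ≤ 1 := by
    have h1 : ((mobile L).map under).card ≤ ((mobile L).map under).count p +
        ((mobile L).map under).count z := by
      refine card_le_count_add_count fun l hl => ?_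
      obtain ⟨t, ht, rfl⟩ := Multiset.mem_map.1 hl
      obtain ⟨ht, htm⟩ := hL.mem_mobile_iff.1 ht
      rcases hmem _ (Multiset.mem_map_of_mem under ht) with h' | h' | h'
      · exact Or.inl h'
      · exact Or.inr h'
      · have := h.w_mod _ h'
        omega
    have hle : (mobile L).map under ≤ K := Multiset.map_le_map (mobile_le L)
    have h2 := Multiset.count_le_of_le p hle
    have h3 := Multiset.count_le_of_le z hle
    rw [Multiset.card_map] at h1
    have := h.p_add_z_le
    omega
  refine ⟨allCongruent_of_card_le hγ h0 hL hrn hc, ?_⟩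
  obtain ⟨hfin, hcard⟩ := family_finite_and_ncard ha hγ h0 hL hrn
  refine ⟨hfin, ?_⟩
  have hzW : z ∉ W := fun hz' => by have := h.w_mod z hz'; omega
  have hpW : p ∉ insert z W := by
    rw [Finset.mem_insert]
    rintro (hpz | hp')
    · omega
    · have := h.w_mod p hp'; omega
  have hsub : K.toFinset ⊆ insert p (insert z W) := by
    intro l hl
    simpa using hmem l (Multiset.mem_toFinset.1 hl)
  rw [hcard, hL.prod_count hc, b0Size, Finset.prod_subset hsub fun l _ hl => by
      rw [Multiset.count_eq_zero_of_notMem fun h' => hl (Multiset.mem_toFinset.2 h'), zero_add],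
    Finset.prod_insert hpW, Finset.prod_insert hzW, hKp, hKz,
    Finset.prod_congr rfl fun w hw => by rw [hKw w hw], mul_assoc]

/-- The norm as a monoid homomorphism to `ℕ`. -/
def normNHom : LatticeTriangle →* ℕ where
  toFun := normN
  map_one' := normN_one
  map_mul' := normN_mul

/-- A prime of ℤ[ζ] over l has norm l to its residue degree; its powers supply the factors from
which an element of norm r is assembled. -/
lemma prime_pow_mem_mrange {l : ℕ} (hl : l.Prime) (c : ℕ) :
    (l ^ residueDegree l) ^ c ∈ MonoidHom.mrange normNHom := by
  obtain ⟨π, hπ, hd⟩ := exists_prime_dvd_natCast hl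
  exact pow_mem (MonoidHom.mem_mrange.2 ⟨π, normN_of_prime_dvd hl hπ hd⟩) c

lemma prime_pow_two_mul_mem_mrange {l : ℕ} (hl : l.Prime) (hm : l % 12 ≠ 1) (c : ℕ) :
    l ^ (2 * c) ∈ MonoidHom.mrange normNHom := by
  have := prime_pow_mem_mrange hl c
  rwa [residueDegree, if_neg hm, ← pow_mul] at this

lemma IsB0Shape.exists_leader (h : IsB0Shape p z Q W ρ) :
    ∃ a, normN a = b0Norm p z Q W ρ ∧ IsLeader a := by
  have hmem : b0Norm p z Q W ρ ∈ MonoidHom.mrange normNHom := by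
    have hpm := h.p_mod
    have hzm := h.z_mod
    unfold b0Norm
    refine mul_mem (mul_mem (mul_mem (mul_mem (mul_mem ?_ ?_) ?_) ?_) ?_) ?_
    · exact prime_pow_two_mul_mem_mrange Nat.prime_two (by norm_num) _
    · exact prime_pow_two_mul_mem_mrange Nat.prime_three (by norm_num) _
    · have := prime_pow_mem_mrange h.prime_p (ρ p)
      rwa [residueDegree, if_pos hpm, pow_one] at this
    · exact prod_mem fun q hq => prime_pow_two_mul_mem_mrange (h.prime_q q hq)
        (by rw [h.q_mod q hq]; norm_num) _
    · exact prod_mem fun w hw => prime_pow_two_mul_mem_mrange (h.prime_w w hw)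
        (by rw [h.w_mod w hw]; norm_num) _
    · exact prime_pow_two_mul_mem_mrange h.prime_z (by omega) _
  obtain ⟨a, ha⟩ := hmem
  obtain ⟨v, hv⟩ := exists_isLeader a
  refine ⟨a * v, ?_, hv⟩
  rw [normN_mul, isUnit_iff_normN.1 v.isUnit, mul_one]
  exact ha

lemma IsB0Shape.finite_and_ncard (h : IsB0Shape p z Q W ρ) {F : Set TriangleSequence}
    (hF : F ∈ b0Families (b0Norm p z Q W ρ)) : F.Finite ∧ F.ncard = b0Size p z W ρ := by
  obtain ⟨a, hn, -, rfl, -⟩ := (mem_b0Families_iff h.norm_ne_zero).1 hF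
  exact (h.family_spec hn).2

lemma one_add_le_b0Prod : 1 + (ρ p + ρ z + ∑ w ∈ W, ρ w) ≤
    (ρ p + 1) * (ρ z + 1) * ∏ w ∈ W, (ρ w + 1) := by
  have h1 := one_add_sum_le_prod W ρ
  calc 1 + (ρ p + ρ z + ∑ w ∈ W, ρ w) ≤ (ρ p + 1) * (ρ z + 1) * (1 + ∑ w ∈ W, ρ w) := by
        nlinarith [Nat.zero_le (ρ p * ρ z), Nat.zero_le (ρ p * ∑ w ∈ W, ρ w),
          Nat.zero_le (ρ z * ∑ w ∈ W, ρ w), Nat.zero_le (ρ p * ρ z * ∑ w ∈ W, ρ w)]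
    _ ≤ _ := Nat.mul_le_mul_left _ h1

lemma IsB0Data.family_mem (h : IsB0Data p z Q W ρ) {a : LatticeTriangle}
    (hn : normN a = b0Norm p z Q W ρ) (hlead : IsLeader a) :
    family a ∈ b0Families (b0Norm p z Q W ρ) := by
  have hs := IsB0Data.shape h
  obtain ⟨hall, hfin, hcard⟩ := hs.family_spec hn
  refine (mem_b0Families_iff hs.norm_ne_zero).2 ⟨a, hn, hlead, rfl, ?_, hall⟩
  rw [← Set.one_lt_ncard_iff_nontrivial_and_finite.trans (and_iff_left hfin), hcard, b0Size]
  have h1 := one_add_le_b0Prod (p := p) (z := z) (W := W) (ρ := ρ)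
  have h2 := h.two_le
  omega

lemma b0Size_of_le_one (hpz : ρ p + ρ z ≤ 1) (h2 : 2 ≤ ρ p + ρ z + ∑ w ∈ W, ρ w)
    (hw : ∀ w ∈ W, ρ w ≤ 1) : b0Size p z W ρ = 2 ^ (ρ p + ρ z + ∑ w ∈ W, ρ w - 1) := by
  have h1 : (ρ p + 1) * (ρ z + 1) = 2 ^ (ρ p + ρ z) := by
    have : (ρ p = 0 ∧ ρ z = 0) ∨ (ρ p = 1 ∧ ρ z = 0) ∨ (ρ p = 0 ∧ ρ z = 1) := by omega
    rcases this with ⟨h, h'⟩ | ⟨h, h'⟩ | ⟨h, h'⟩ <;> simp [h, h']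
  have h3 : ∏ w ∈ W, (ρ w + 1) = 2 ^ ∑ w ∈ W, ρ w := by
    rw [← Finset.prod_pow_eq_pow_sum]
    refine Finset.prod_congr rfl fun w hw' => ?_
    have := hw w hw'
    interval_cases ρ w <;> rfl
  rw [b0Size, h1, h3, ← pow_add]
  obtain ⟨s, hs⟩ : ∃ s, ρ p + ρ z + ∑ w ∈ W, ρ w = s + 1 :=
    ⟨_, (Nat.sub_add_cancel (by omega)).symm⟩
  rw [hs, Nat.add_sub_cancel, pow_succ]
  omega

lemma b0Size_update (hp : p ∉ W) (hz : z ∉ W) {w₁ v : ℕ} (hw : w₁ ∈ W) (hv : ρ w₁ < v) :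
    b0Size p z W ρ ≤ b0Size p z W (Function.update ρ w₁ v) ∧
      ((ρ p + ρ z ≠ 0 ∨ ∃ w ∈ W, w ≠ w₁ ∧ ρ w ≠ 0) →
        b0Size p z W ρ < b0Size p z W (Function.update ρ w₁ v)) := by
  have hpw : p ≠ w₁ := fun h => hp (h ▸ hw)
  have hzw : z ≠ w₁ := fun h => hz (h ▸ hw)
  have e1 : ∏ w ∈ W, (ρ w + 1) = (ρ w₁ + 1) * ∏ w ∈ W.erase w₁, (ρ w + 1) :=
    (Finset.mul_prod_erase W (fun w => ρ w + 1) hw).symm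
  have e2 : ∏ w ∈ W, (Function.update ρ w₁ v w + 1) =
      (v + 1) * ∏ w ∈ W.erase w₁, (ρ w + 1) := by
    rw [← Finset.mul_prod_erase W (fun w => Function.update ρ w₁ v w + 1) hw,
      Function.update_self]
    congr 1
    refine Finset.prod_congr rfl fun w hw' => ?_
    rw [Function.update_of_ne (Finset.ne_of_mem_erase hw')]
  unfold b0Size
  rw [e1, e2, Function.update_of_ne hpw, Function.update_of_ne hzw]
  have hM := one_add_le_b0Prod (p := p) (z := z) (W := W.erase w₁) (ρ := ρ)
  set M := (ρ p + 1) * (ρ z + 1) * ∏ w ∈ W.erase w₁, (ρ w + 1) with hMdef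
  have r1 : (ρ p + 1) * (ρ z + 1) * ((ρ w₁ + 1) * ∏ w ∈ W.erase w₁, (ρ w + 1)) =
      M * (ρ w₁ + 1) := by rw [hMdef]; ring
  have r2 : (ρ p + 1) * (ρ z + 1) * ((v + 1) * ∏ w ∈ W.erase w₁, (ρ w + 1)) =
      M * (v + 1) := by rw [hMdef]; ring
  rw [r1, r2]
  have hle : M * (ρ w₁ + 1) + M ≤ M * (v + 1) := by
    rw [← Nat.mul_succ]
    exact Nat.mul_le_mul_left _ (by omega)
  refine ⟨by omega, fun hor => ?_⟩
  -- Raising the exponent adds at least M to the product. For M ≥ 2 this survives the halving as a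
  -- strict increase.
  have hM2 : 2 ≤ M := by
    have : 1 ≤ ρ p + ρ z + ∑ w ∈ W.erase w₁, ρ w := by
      rcases hor with h | ⟨w, hw', hne, h⟩
      · omega
      · have := Finset.single_le_sum (f := ρ) (fun i _ => Nat.zero_le _)
          (Finset.mem_erase.2 ⟨hne, hw'⟩)
        omega
    omega
  omega

lemma b0Size_single (hpz : ρ p + ρ z ≤ 1) {w₁ : ℕ} (hw : w₁ ∈ W)
    (h0 : ∀ w ∈ W, w ≠ w₁ → ρ w = 0) :
    b0Size p z W ρ = if ρ p + ρ z ≠ 0 then ρ w₁ + 1 else ρ w₁ / 2 + 1 := by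
  have e : ∏ w ∈ W, (ρ w + 1) = ρ w₁ + 1 :=
    Finset.prod_eq_single w₁ (fun w hw' hne => by rw [h0 w hw' hne, zero_add]) fun h => absurd hw h
  rw [b0Size, e]
  have : (ρ p = 0 ∧ ρ z = 0) ∨ (ρ p = 1 ∧ ρ z = 0) ∨ (ρ p = 0 ∧ ρ z = 1) := by omega
  rcases this with ⟨h, h'⟩ | ⟨h, h'⟩ | ⟨h, h'⟩ <;> rw [h, h'] <;> simp <;> omega

lemma IsB0Shape.update (h : IsB0Shape p z Q W ρ) {w₁ : ℕ} (hw : w₁ ∈ W) (v : ℕ) :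
    IsB0Shape p z Q W (Function.update ρ w₁ v) := by
  have hwm := h.w_mod w₁ hw
  have hpm := h.p_mod
  have hzm := h.z_mod
  refine ⟨h.prime_p, h.p_mod, h.prime_z, h.z_mod, h.prime_q, h.q_mod, h.prime_w, h.w_mod, ?_⟩
  rw [Function.update_of_ne (by rintro rfl; omega), Function.update_of_ne (by rintro rfl; omega)]
  exact h.p_add_z_le

end shape

lemma exists_unique_prime_of_class {r c d : ℕ} (hd : d.Prime) (hdc : d % 12 = c)
    (huniq : ∀ x y : ℕ, x.Prime → y.Prime → x % 12 = c → y % 12 = c → r.factorization x ≠ 0 →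
      r.factorization y ≠ 0 → x = y) :
    ∃ p : ℕ, p.Prime ∧ p % 12 = c ∧
      ∀ l : ℕ, l.Prime → l % 12 = c → l ≠ p → r.factorization l = 0 := by
  by_cases h : ∃ p : ℕ, p.Prime ∧ p % 12 = c ∧ r.factorization p ≠ 0
  · obtain ⟨p, hp, hpc, hf⟩ := h
    refine ⟨p, hp, hpc, fun l hl hlc hne => ?_⟩
    by_contra hfl
    exact hne (huniq l p hl hp hlc hpc hfl hf)
  · push Not at h
    exact ⟨d, hd, hdc, fun l hl hlc _ => h l hl hlc⟩

/-- At most one member of L is mobile, so at most one prime ≡ 1 or 7 divides the norm, and only with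
multiplicity one in L. All exponents at other classes are even because the residue degree is 2. -/
theorem exists_b0Shape {a : LatticeTriangle} (ha : a ≠ 0) (hall : AllCongruent a) :
    ∃ (p z : ℕ) (Q W : Finset ℕ) (ρ : ℕ → ℕ), IsB0Shape p z Q W ρ ∧
      normN a = b0Norm p z Q W ρ := by
  obtain ⟨γ, L, hγ, h0, hL, hrn⟩ := exists_reduced ha
  have hc := card_le_of_allCongruent h0 hL hrn hall
  have hf {l : ℕ} (hl : IsSplitClass l) := hL.factorization_eq hγ h0 hrn hl
  have heven {l : ℕ} (hl : l % 12 ≠ 1) := even_factorization_normN ha hl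
  have hr0 := normN_ne_zero ha
  set r := normN a
  set K := L.map under with hK
  have hcount {x : ℕ} (hx : x % 12 = 1 ∨ x % 12 = 7) :
      K.count x = ((mobile L).map under).count x := by
    classical
    have hsplit : K = (mobile L).map under +
        (L.filter fun t => ¬ ¬ Associated (sigma5 t) t).map under := by
      rw [← Multiset.map_add, mobile, Multiset.filter_add_not]
    rw [hsplit, Multiset.count_add, Nat.add_eq_left]
    refine Multiset.count_eq_zero_of_notMem fun hm => ?_
    obtain ⟨t, ht, rfl⟩ := Multiset.mem_map.1 hm
    obtain ⟨htL, hn⟩ := Multiset.mem_filter.1 ht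
    exact hn (mem_mobile.1 (hL.mem_mobile_iff.2 ⟨htL, hx⟩)).2
  have hpair {x y : ℕ} (hx : x % 12 = 1 ∨ x % 12 = 7) (hy : y % 12 = 1 ∨ y % 12 = 7)
      (hxy : x ≠ y) : K.count x + K.count y ≤ 1 := by
    rw [hcount hx, hcount hy]
    refine (count_add_count_le_card hxy _).trans ?_
    rwa [Multiset.card_map]
  have hpos {x : ℕ} (hx : x % 12 = 1 ∨ x % 12 = 7) (h : r.factorization x ≠ 0) :
      1 ≤ K.count x := by
    rw [hf (by unfold IsSplitClass; omega)] at h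
    exact Nat.one_le_iff_ne_zero.2 (right_ne_zero_of_mul h)
  have huniq (c : ℕ) (hc : c = 1 ∨ c = 7) (x y : ℕ) (_ : x.Prime) (_ : y.Prime)
      (hx : x % 12 = c) (hy : y % 12 = c) (hfx : r.factorization x ≠ 0)
      (hfy : r.factorization y ≠ 0) : x = y := by
    by_contra hxy
    have h1 := hpair (x := x) (y := y) (by omega) (by omega) hxy
    have h2 := hpos (by omega) hfx
    have h3 := hpos (by omega) hfy
    omega
  -- The primes 13 and 7 are placeholders, used with exponent 0 when no prime of the class divides
  -- r.
  obtain ⟨p, hp, hpm, hp'⟩ := exists_unique_prime_of_class (r := r) (d := 13) (c := 1)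
    (by norm_num) (by norm_num) (huniq 1 (Or.inl rfl))
  obtain ⟨z, hz, hzm, hz'⟩ := exists_unique_prime_of_class (r := r) (d := 7) (c := 7)
    (by norm_num) (by norm_num) (huniq 7 (Or.inr rfl))
  let ρ : ℕ → ℕ := fun l => if l % 12 = 1 then r.factorization l else r.factorization l / 2
  have hρ1 {l : ℕ} (hl : l % 12 = 1) : ρ l = r.factorization l := if_pos hl
  have hρ2 {l : ℕ} (hl : l % 12 ≠ 1) : 2 * ρ l = r.factorization l := by
    simp only [ρ, if_neg hl]
    exact Nat.mul_div_cancel' (heven hl)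
  have hshape : IsB0Shape p z (r.primeFactors.filter fun l => l % 12 = 11)
      (r.primeFactors.filter fun l => l % 12 = 5) ρ := by
    refine ⟨hp, hpm, hz, hzm, fun q hq => ?_, fun q hq => ?_, fun w hw => ?_, fun w hw => ?_, ?_⟩
    · exact Nat.prime_of_mem_primeFactors (Finset.mem_filter.1 hq).1
    · exact (Finset.mem_filter.1 hq).2
    · exact Nat.prime_of_mem_primeFactors (Finset.mem_filter.1 hw).1
    · exact (Finset.mem_filter.1 hw).2
    · have h1 := hpair (x := p) (y := z) (by omega) (by omega) (by rintro rfl; omega)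
      have h2 := hf (l := p) (Or.inl hpm)
      have h3 := hf (l := z) (Or.inr (Or.inr hzm))
      rw [residueDegree, if_pos hpm, ← hρ1 hpm] at h2
      rw [residueDegree, if_neg (by omega), ← hρ2 (by omega)] at h3
      omega
  refine ⟨p, z, _, _, ρ, hshape, Nat.eq_of_factorization_eq hr0 hshape.norm_ne_zero fun l => ?_⟩
  by_cases hl : l.Prime
  swap
  · rw [Nat.factorization_eq_zero_of_not_prime _ hl, Nat.factorization_eq_zero_of_not_prime _ hl]
  have hmem (c : ℕ) : l ∈ r.primeFactors.filter (fun l => l % 12 = c) ↔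
      l % 12 = c ∧ r.factorization l ≠ 0 := by
    rw [Finset.mem_filter, ← Nat.support_factorization, Finsupp.mem_support_iff, and_comm]
  rw [hshape.factorization_norm]
  simp only [hmem]
  rcases prime_mod_twelve hl with h | h | h | h | h | h
  · subst h
    rw [if_pos rfl, if_neg (by omega), if_neg (by rintro rfl; omega), if_neg (by omega),
      if_neg (by omega), if_neg (by rintro rfl; omega), hρ2 (by norm_num)]
    omega
  · subst h
    rw [if_neg (by omega), if_pos rfl, if_neg (by rintro rfl; omega), if_neg (by omega),
      if_neg (by omega), if_neg (by rintro rfl; omega), hρ2 (by norm_num)]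
    omega
  · rw [if_neg (by omega), if_neg (by omega), if_neg (c := _ ∧ _) (by omega),
      if_neg (c := _ ∧ _) (by omega), if_neg (c := l = z) (by rintro rfl; omega)]
    split_ifs with hlp
    · rw [← hlp, hρ1 h]; omega
    · rw [hp' l hl h hlp]
  · rw [if_neg (by omega), if_neg (by omega), if_neg (c := l = p) (by rintro rfl; omega),
      if_neg (by omega), if_neg (c := l = z) (by rintro rfl; omega), hρ2 (by omega)]
    split_ifs <;> omega
  · rw [if_neg (by omega), if_neg (by omega), if_neg (c := l = p) (by rintro rfl; omega),
      if_neg (by omega), if_neg (by omega)]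
    split_ifs with hlz
    · rw [← hlz, hρ2 (by omega)]; omega
    · rw [hz' l hl h hlz]
  · rw [if_neg (by omega), if_neg (by omega), if_neg (c := l = p) (by rintro rfl; omega),
      if_neg (c := l % 12 = 5 ∧ _) (by omega), if_neg (c := l = z) (by rintro rfl; omega),
      hρ2 (by omega)]
    split_ifs <;> omega

/-- The product in the size formula is at most 2 to the sum of the exponents; a sum below 2 leaves a
single coset. -/
lemma IsB0Shape.data_of_nontrivial {p z : ℕ} {Q W : Finset ℕ} {ρ : ℕ → ℕ}
    (h : IsB0Shape p z Q W ρ) {a : LatticeTriangle} (hn : normN a = b0Norm p z Q W ρ)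
    (hnt : (family a).Nontrivial) : IsB0Data p z Q W ρ := by
  refine ⟨h.prime_p, h.p_mod, h.prime_z, h.z_mod, h.prime_q, h.q_mod, h.prime_w, h.w_mod,
    h.p_add_z_le, ?_⟩
  obtain ⟨-, hfin, hcard⟩ := h.family_spec hn
  have h1 : 1 < (family a).ncard :=
    Set.one_lt_ncard_iff_nontrivial_and_finite.2 ⟨hnt, hfin⟩
  rw [hcard, b0Size] at h1
  by_contra! hlt
  have h2 : (ρ p + 1) * (ρ z + 1) * ∏ w ∈ W, (ρ w + 1) ≤
      2 ^ (ρ p + ρ z + ∑ w ∈ W, ρ w) := by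
    rw [pow_add, pow_add]
    exact Nat.mul_le_mul (Nat.mul_le_mul Nat.lt_two_pow_self Nat.lt_two_pow_self)
      (prod_le_two_pow_sum W ρ)
  have h3 : 2 ^ (ρ p + ρ z + ∑ w ∈ W, ρ w) ≤ 2 ^ 1 := Nat.pow_le_pow_right (by norm_num) (by omega)
  omega

end LatticeTriangle

open LatticeTriangle

theorem theorem7 :
    -- the case of a given `r`
    (∀ (p z : ℕ) (Q W : Finset ℕ) (ρ : ℕ → ℕ), IsB0Data p z Q W ρ →
      -- the solution cosets are partitioned into finitely many (at least one) B0 families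
      ((b0Families (b0Norm p z Q W ρ)).Nonempty ∧
        (b0Families (b0Norm p z Q W ρ)).Finite ∧
        ⋃₀ b0Families (b0Norm p z Q W ρ) = solutionCosets (b0Norm p z Q W ρ) ∧
        (b0Families (b0Norm p z Q W ρ)).PairwiseDisjoint id) ∧
      -- the families are finite and of equal size
      (∀ F ∈ b0Families (b0Norm p z Q W ρ), F.Finite) ∧
      (∀ F ∈ b0Families (b0Norm p z Q W ρ), ∀ F' ∈ b0Families (b0Norm p z Q W ρ),
        F.ncard = F'.ncard) ∧
      -- the size if all `ρ(w) ≤ 1`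
      ((∀ w ∈ W, ρ w ≤ 1) → ∀ F ∈ b0Families (b0Norm p z Q W ρ),
        F.ncard = 2 ^ (ρ p + ρ z + ∑ w ∈ W, ρ w - 1)) ∧
      -- the size does not decrease if one of the `ρ(w)` is increased, and it increases unless
      -- `ρ(p)`, `ρ(z)` and the other `ρ(w)` vanish
      (∀ w₁ ∈ W, ∀ v : ℕ, ρ w₁ < v →
        ∀ F ∈ b0Families (b0Norm p z Q W ρ),
        ∀ F' ∈ b0Families (b0Norm p z Q W (Function.update ρ w₁ v)),
          F.ncard ≤ F'.ncard ∧
          ((ρ p + ρ z ≠ 0 ∨ ∃ w ∈ W, w ≠ w₁ ∧ ρ w ≠ 0) → F.ncard < F'.ncard)) ∧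
      -- the size in the case of a single `w`
      (∀ w₁ ∈ W, (∀ w ∈ W, w ≠ w₁ → ρ w = 0) → ∀ F ∈ b0Families (b0Norm p z Q W ρ),
        F.ncard = if ρ p + ρ z ≠ 0 then ρ w₁ + 1 else ρ w₁ / 2 + 1)) ∧
    -- conversely, every B0 family comes from such an `r`
    (∀ F : Set TriangleSequence, IsB0Family F →
      ∃ (p z : ℕ) (Q W : Finset ℕ) (ρ : ℕ → ℕ), IsB0Data p z Q W ρ ∧
        F ∈ b0Families (b0Norm p z Q W ρ)) := by
  refine ⟨fun p z Q W ρ h => ?_, fun F hF => ?_⟩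
  · have hs : IsB0Shape p z Q W ρ := IsB0Data.shape h
    have hr := hs.norm_ne_zero
    refine ⟨⟨?_, finite_b0Families hr, ?_, pairwiseDisjoint_b0Families hr⟩,
      fun F hF => (hs.finite_and_ncard hF).1, fun F hF F' hF' => ?_, fun hw F hF => ?_,
      fun w₁ hw v hv F hF F' hF' => ?_, fun w₁ hw h0 F hF => ?_⟩
    · obtain ⟨a, hn, hlead⟩ := hs.exists_leader
      exact ⟨_, IsB0Data.family_mem h hn hlead⟩
    · refine Set.Subset.antisymm (Set.sUnion_subset fun F hF => hF.2) fun C hC => ?_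
      obtain ⟨a, hn, hlead, rfl⟩ := exists_eq_cosetSeq hC
      exact ⟨_, IsB0Data.family_mem h hn hlead, mem_family_self a⟩
    · rw [(hs.finite_and_ncard hF).2, (hs.finite_and_ncard hF').2]
    · rw [(hs.finite_and_ncard hF).2, b0Size_of_le_one h.p_add_z_le h.two_le hw]
    · rw [(hs.finite_and_ncard hF).2, ((hs.update hw v).finite_and_ncard hF').2]
      refine b0Size_update (fun hp => ?_) (fun hz => ?_) hw hv
      · have h1 := h.w_mod p hp
        have h2 := h.p_mod
        omega
      · have h1 := h.w_mod z hz
        have h2 := h.z_mod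
        omega
    · rw [(hs.finite_and_ncard hF).2, b0Size_single h.p_add_z_le hw h0]
  · obtain ⟨a, ha, hlead, rfl, hnt, hall⟩ := isB0Family_iff.1 hF
    obtain ⟨p, z, Q, W, ρ, hs, hn⟩ := exists_b0Shape ha hall
    have h := hs.data_of_nontrivial hn hnt
    exact ⟨p, z, Q, W, ρ, h, IsB0Data.family_mem h hn hlead⟩
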